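/- Let $\mathcal G_*$ (resp. $\mathcal G_{**}$) be the space of isomorphism classes of connected locally finite graphs with one root (resp. an ordered pair of roots), with the Borel $\sigma$-algebra of the local topology; let $\mathcal G_*^{[0,1]}$, $\mathcal G_{**}^{[0,1]}$ be the corresponding spaces of graphs whose vertices carry labels in $[0,1]$, where two labelled graphs are close if large balls around their roots are isomorphic by a root-preserving isomorphism that changes the labels only a little. A random rooted graph $(T,o)$ with law $\mu$ on $\mathcal G_*$ is *unimodular* if $$\mathbf E\sum_{y} f(T,o,y)=\mathbf E\sum_{y} f(T,y,o)\qquad\text{for every Borel } f:\mathcal G_{**}\to[0,\infty],$$ and *ergodic* if every Borel set $\mathcal A\subset\mathcal G_*$ that is closed under change of the root has $\mu(\mathcal A)\in\{0,1\}$. Put iid uniform $[0,1]$ labels $\lambda=(\lambda(v))_{v\in V(T)}$ on the vertices of $T$. A random subset $U$ of $V(T)$ is *fiid* (a factor of iid) if there is a Borel set $\mathcal U\subset\mathcal G_*^{[0,1]}$ such that $x\in U$ if and only if $(T,x,\lambda)\in\mathcal U$; a random partition $\mathcal Q$ of $U$ is *fiid* if there is a Borel set $\mathcal R\subset\mathcal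 G_{**}^{[0,1]}$ such that $x,y$ lie in the same class of $\mathcal Q$ if and only if $(T,x,y,\lambda)\in\mathcal R$. Write $\mathcal Q(x)$ for the class of $x$ in $\mathcal Q$. **Lemma.** Let $d\in\mathbb N$ and let $(T,o)$ be an ergodic unimodular random graph that is almost surely a tree with exactly one end and all degrees at most $d$. Then there exist a fiid subset $U\subset V(T)$ and a fiid sequence $(\mathcal Q_n)_{n\ge 0}$ of partitions of $U$ such that, almost surely: 1. $U$ is nonempty and induces a connected subgraph of $T$; 2. $\mathcal Q_{n}$ is coarser than (or equal to) $\mathcal Q_m$ whenever $m\le n$; 3. any $x,y\in U$ are in the same class of $\mathcal Q_n$ for all sufficiently large $n$; 4. for every $x\in U$ there are infinitely many $n$ such that $\mathcal Q_n(x)$ induces a connected subgraph of $T$ and has exactly $2^n$ elements. -/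

import Mathlib

open MeasureTheory Filter
open scoped ENNReal

noncomputable section

/-- A connected, locally finite (simple) graph with `k` distinguished vertices (`k` roots, not
necessarily distinct) whose vertices carry marks in `X`.  Taking `X = Unit` gives unmarked graphs,
and `X = unitInterval` gives graphs with `[0,1]`-labels on the vertices. -/
structure RootedGraph (k : ℕ) (X : Type) : Type 1 where
  V : Type
  graph : SimpleGraph V
  connected : graph.Connected
  locallyFinite : ∀ v, (graph.neighborSet v).Finite
  root : Fin k → V
  mark : V → X

namespace RootedGraph

variable {k m : ℕ} {X Y : Type}

/-- The same graph, with new roots and new marks. -/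
def decorate (g : RootedGraph k X) (root : Fin m → g.V) (mark : g.V → Y) : RootedGraph m Y where
  V := g.V
  graph := g.graph
  connected := g.connected
  locallyFinite := g.locallyFinite
  root := root
  mark := mark

/-- Isomorphism of rooted marked graphs: a graph isomorphism that maps roots to roots, in order,
and preserves the marks. -/
def Iso (g h : RootedGraph k X) : Prop :=
  ∃ φ : g.graph ≃g h.graph, (∀ i, φ (g.root i) = h.root i) ∧ ∀ v, h.mark (φ v) = g.mark v

theorem iso_equivalence : Equivalence (Iso (k := k) (X := X)) where
  refl g := ⟨SimpleGraph.Iso.refl, fun _ => rfl, fun _ => rfl⟩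
  symm := by
    rintro g h ⟨φ, h1, h2⟩
    refine ⟨φ.symm, fun i => ?_, fun v => ?_⟩
    · rw [← h1 i]; exact φ.symm_apply_apply _
    · rw [← h2 (φ.symm v)]; exact congrArg h.mark (φ.apply_symm_apply v)
  trans := by
    rintro g h l ⟨φ, h1, h2⟩ ⟨ψ, h3, h4⟩
    refine ⟨φ.trans ψ, fun i => ?_, fun v => ?_⟩
    · rw [← h3 i, ← h1 i]; rfl
    · rw [← h2 v, ← h4 (φ v)]; rfl

instance isoSetoid (k : ℕ) (X : Type) : Setoid (RootedGraph k X) := ⟨Iso, iso_equivalence⟩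

/-- The vertices at graph distance at most `r` from (one of) the roots. -/
def ball (g : RootedGraph k X) (r : ℕ) : Set g.V := {v | ∃ i, g.graph.dist (g.root i) v ≤ r}

theorem root_mem_ball (g : RootedGraph k X) (r : ℕ) (i : Fin k) : g.root i ∈ g.ball r :=
  ⟨i, by simp⟩

/-- The `r`-balls around the roots of `g` and `h` are isomorphic as rooted graphs, through an
isomorphism that changes the marks by at most `1 / (r + 1)`. -/
def Close [PseudoMetricSpace X] (r : ℕ) (g h : RootedGraph k X) : Prop :=
  ∃ φ : g.graph.induce (g.ball r) ≃g h.graph.induce (h.ball r),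
    (∀ i, (φ ⟨g.root i, g.root_mem_ball r i⟩ : h.V) = h.root i) ∧
    ∀ v : g.ball r, dist (g.mark v) (h.mark (φ v)) ≤ 1 / ((r : ℝ) + 1)

/-- The topology of local convergence, that is, of the (pseudo)distance
`d(g, h) = inf {1 / (r + 1) : Close r g h}`: the graphs `h` with `Close r g h` for some `r ≥ R` are
those in the closed ball of radius `1 / (R + 1)` around `g`. -/
instance localTopology [PseudoMetricSpace X] : TopologicalSpace (RootedGraph k X) where
  IsOpen S := ∀ g ∈ S, ∃ R : ℕ, ∀ r ≥ R, ∀ h, Close r g h → h ∈ S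
  isOpen_univ := fun _ _ => ⟨0, fun _ _ _ _ => trivial⟩
  isOpen_inter := by
    intro S S' hS hS' g hg
    obtain ⟨R, hR⟩ := hS g hg.1
    obtain ⟨R', hR'⟩ := hS' g hg.2
    exact ⟨max R R', fun r hr h hc =>
      ⟨hR r (le_trans (le_max_left _ _) hr) h hc, hR' r (le_trans (le_max_right _ _) hr) h hc⟩⟩
  isOpen_sUnion := by
    intro s hs g hg
    obtain ⟨S, hS, hgS⟩ := hg
    obtain ⟨R, hR⟩ := hs S hS g hgS
    exact ⟨R, fun r hr h hc => ⟨S, hS, hR r hr h hc⟩⟩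

end RootedGraph

/-- Isomorphism classes of connected locally finite graphs with `k` roots and marks in `X`. For
`X = Unit` this is the space `𝒢_*` if `k = 1` and the space `𝒢_**` if `k = 2`. -/
def GraphSpace (k : ℕ) (X : Type) : Type 1 := Quotient (RootedGraph.isoSetoid k X)

namespace GraphSpace

variable {k : ℕ} {X : Type}

/-- The isomorphism class of a rooted marked graph. -/
def cls (g : RootedGraph k X) : GraphSpace k X := Quotient.mk _ g

/-- The local topology on isomorphism classes. -/
instance [PseudoMetricSpace X] : TopologicalSpace (GraphSpace k X) :=
  inferInstanceAs (TopologicalSpace (Quotient (RootedGraph.isoSetoid k X)))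

/-- The Borel σ-algebra of the local topology. -/
instance [PseudoMetricSpace X] : MeasurableSpace (GraphSpace k X) := borel _

instance [PseudoMetricSpace X] : BorelSpace (GraphSpace k X) := ⟨rfl⟩

/-- `(G, o) ↦ ∑_y f(G, o, y)`, the total mass sent out by the root. -/
def massOut (f : GraphSpace 2 Unit → ℝ≥0∞) : GraphSpace 1 Unit → ℝ≥0∞ :=
  Quotient.lift (fun g => ∑' y : g.V, f (cls (g.decorate ![g.root 0, y] g.mark))) (by
    rintro g h ⟨φ, h1, h2⟩
    refine Eq.trans ?_ (φ.toEquiv.tsum_eq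
      (fun y : h.V => f (cls (h.decorate ![h.root 0, y] h.mark))))
    refine tsum_congr fun y => congrArg f (Quotient.sound ⟨φ, fun i => ?_, h2⟩)
    fin_cases i
    · exact h1 0
    · rfl)

/-- `(G, o) ↦ ∑_y f(G, y, o)`, the total mass received by the root. -/
def massIn (f : GraphSpace 2 Unit → ℝ≥0∞) : GraphSpace 1 Unit → ℝ≥0∞ :=
  Quotient.lift (fun g => ∑' y : g.V, f (cls (g.decorate ![y, g.root 0] g.mark))) (by
    rintro g h ⟨φ, h1, h2⟩
    refine Eq.trans ?_ (φ.toEquiv.tsum_eq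
      (fun y : h.V => f (cls (h.decorate ![y, h.root 0] h.mark))))
    refine tsum_congr fun y => congrArg f (Quotient.sound ⟨φ, fun i => ?_, h2⟩)
    fin_cases i
    · rfl
    · exact h1 0)

end GraphSpace

open GraphSpace

/-- The law `μ` of a random rooted graph is unimodular if it satisfies the Mass Transport
Principle. -/
def IsUnimodular (μ : Measure (GraphSpace 1 Unit)) : Prop :=
  ∀ f : GraphSpace 2 Unit → ℝ≥0∞, Measurable f → ∫⁻ t, massOut f t ∂μ = ∫⁻ t, massIn f t ∂μ

/-- An invariant property of rooted graphs: a Borel set closed under the change of root. -/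
def IsInvariantProperty (A : Set (GraphSpace 1 Unit)) : Prop :=
  MeasurableSet A ∧
    ∀ g : RootedGraph 1 Unit, cls g ∈ A → ∀ x : g.V, cls (g.decorate ![x] g.mark) ∈ A

/-- A random rooted graph is ergodic if every invariant property holds almost surely or fails
almost surely. -/
def IsErgodic (μ : Measure (GraphSpace 1 Unit)) : Prop :=
  ∀ A, IsInvariantProperty A → (∀ᵐ t ∂μ, t ∈ A) ∨ (∀ᵐ t ∂μ, t ∉ A)

/-- The property `P`, which should not distinguish isomorphic rooted graphs, holds almost surely
for the random rooted graph with law `μ`. -/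
def AlmostSurely (μ : Measure (GraphSpace 1 Unit)) (P : RootedGraph 1 Unit → Prop) : Prop :=
  ∀ᵐ t ∂μ, ∀ g : RootedGraph 1 Unit, cls g = t → P g

/-- A tree with exactly one end. -/
def IsOneEndedTree {V : Type} (G : SimpleGraph V) : Prop :=
  G.IsTree ∧ ∃! e, e ∈ G.end

/-- The law of iid Lebesgue`[0,1]` labels on the vertices. -/
def iidLabels (V : Type) : Measure (V → unitInterval) :=
  Measure.infinitePi fun _ : V => (volume : Measure unitInterval)

/-- A rule for a factor-of-iid vertex set: it decides whether a vertex belongs to the set by a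
Borel property of the isomorphism class of the labelled graph, seen from the vertex. -/
structure FiidSet where
  rule : Set (GraphSpace 1 unitInterval)
  measurable : MeasurableSet rule

/-- The random set of vertices that the rule selects in `g` for the labels `lab`. -/
def FiidSet.eval (U : FiidSet) (g : RootedGraph 1 Unit) (lab : g.V → unitInterval) : Set g.V :=
  {x | cls (g.decorate ![x] lab) ∈ U.rule}

/-- A rule for a factor-of-iid binary relation on the vertices: it decides whether two vertices
are related by a Borel property of the isomorphism class of the labelled graph, seen from the
ordered pair of vertices. -/
structure FiidRel where
  rule : Set (GraphSpace 2 unitInterval)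
  measurable : MeasurableSet rule

/-- The random relation that the rule defines in `g` for the labels `lab`. -/
def FiidRel.eval (Q : FiidRel) (g : RootedGraph 1 Unit) (lab : g.V → unitInterval)
    (x y : g.V) : Prop :=
  cls (g.decorate ![x, y] lab) ∈ Q.rule

/-- `r` is the relation "to be in the same class" of a partition of the set `U`. -/
structure IsPartitionOf {V : Type} (r : V → V → Prop) (U : Set V) : Prop where
  subset : ∀ x y, r x y → x ∈ U ∧ y ∈ U
  refl : ∀ x ∈ U, r x x
  symm : ∀ x y, r x y → r y x
  trans : ∀ x y z, r x y → r y z → r x z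

end

/-! In a one-ended tree every vertex has exactly one neighbour in the direction of infinity.
Following these neighbours gives an order (`IsAncestorOrder`) in which a vertex has finitely many
descendants and any two vertices have a common ancestor. The classes of the partitions are what
remains of sets of descendants ("blocks") after a random pruning.

Sizes. Every block of size at least 2 has size `r * 2 ^ n` with `r` in `[2, 4]`. By compactness and
ergodicity there is a constant `c` such that almost surely every vertex has arbitrarily large
ancestors with `r` as close to `c` as desired (`IsErgodic.exists_isRecurrent`). Stage `k` uses the
maximal blocks whose size lies in a window `[lo k, hi k]` and is very close to some `c * 2 ^ n`. The
windows are so long that the root is uncovered with probability at most `2⁻¹ ^ k`, and so far apart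
that the blocks of a stage are tiny compared with those of the next.

Pruning. A block of about `c * 2 ^ n` vertices is reduced to exactly `2 ^ n`. This needs a density
slightly above `1 / c` beforehand (`α k`) and may leave one slightly below it (`β k`). The surplus
is restored by leaving a proportion of about `θ k` of each block of stage `k + 1` unpruned at stage
`k` (`le_card_kept`). The vertices kept are those with the largest key: first the random label of
the block of the previous stage, then the number of descendants, then the own label. The key
increases towards infinity, so what is kept is closed under ancestors. Its first coordinate makes a
pruning discard blocks of the previous stage one after the other, so that at most one of them is cut
in part (`isCut_unique`).

Limit. In a block of stage `k + 1`, unpruned or cut blocks of stage `k` take up a proportion of at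
most `3 * θ k`. A block that is removed entirely loses at least an eighth of its original vertices
at that moment, and a vertex is lost only once. The mass transport principle turns these proportions
into summable probabilities, and Borel–Cantelli shows that every vertex is eventually in pruned
blocks that are neither cut nor removed (`ae_eventually_isGoodAt`, `ae_eventually_not_isRemovedAt`).
From then on a block containing a survivor keeps its `2 ^ n` vertices forever
(`exists_size_of_isGoodAt`), and `pruning_conclusion` reads off the claims. All rules are Borel
because quantifying or counting over one more root preserves measurability. -/

open GraphSpace

noncomputable section

/-! ### The local topology: changing roots, and Borel sets of representatives. -/

namespace RootedGraph

variable {k m : ℕ} {X Y : Type}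

/-- A vertex at distance `s + 1` has a neighbour at distance `s`. -/
theorem _root_.SimpleGraph.Connected.exists_adj_dist_eq {V : Type*} {G : SimpleGraph V}
    (hG : G.Connected) {a v : V} {s : ℕ} (h : G.dist a v = s + 1) :
    ∃ u, G.Adj u v ∧ G.dist a u = s := by
  obtain ⟨p, hp⟩ := hG.exists_walk_length_eq_dist v a
  cases p with
  | nil => simp at h
  | @cons _ u _ huv q =>
    refine ⟨u, huv.symm, ?_⟩
    rw [SimpleGraph.dist_comm] at h
    rw [h, SimpleGraph.Walk.length_cons] at hp
    have h1 : G.dist u a ≤ q.length := SimpleGraph.dist_le q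
    have h2 : G.dist v a ≤ G.dist v u + G.dist u a := hG.dist_triangle
    rw [SimpleGraph.dist_eq_one_iff_adj.2 huv] at h2
    rw [SimpleGraph.dist_comm]
    omega

theorem mem_ball_of_dist_le {g : RootedGraph k X} {i : Fin k} {a v : g.V} {n s r : ℕ}
    (ha : g.graph.dist (g.root i) a ≤ n) (hv : g.graph.dist a v ≤ s) (hr : n + s ≤ r) :
    v ∈ g.ball r :=
  ⟨i, (g.connected.dist_triangle (v := a)).trans (by omega)⟩

/-- An isomorphism of balls does not increase distances, as long as geodesics stay in the ball. -/
theorem dist_map_le {g : RootedGraph k X} {h : RootedGraph k Y} {r n : ℕ}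
    (φ : g.graph.induce (g.ball r) ≃g h.graph.induce (h.ball r)) {i : Fin k} {a : g.V}
    (ha : g.graph.dist (g.root i) a ≤ n) (har : a ∈ g.ball r) (s : ℕ) (hr : n + s ≤ r) :
    ∀ (v : g.V) (hv : v ∈ g.ball r), g.graph.dist a v ≤ s →
      h.graph.dist (φ ⟨a, har⟩ : h.V) (φ ⟨v, hv⟩) ≤ s := by
  induction s with
  | zero =>
    intro v hv hd
    have : a = v := g.connected.dist_eq_zero_iff.1 (by omega)
    subst this
    simp
  | succ s ih =>
    intro v hv hd
    rcases Nat.lt_or_ge (g.graph.dist a v) (s + 1) with hlt | hge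
    · exact (ih (by omega) v hv (by omega)).trans (by omega)
    · obtain ⟨u, huv, hu⟩ := g.connected.exists_adj_dist_eq (le_antisymm hd hge)
      have hub : u ∈ g.ball r := mem_ball_of_dist_le ha hu.le (by omega)
      have h1 := ih (by omega) u hub hu.le
      have h2 : h.graph.Adj (φ ⟨u, hub⟩ : h.V) (φ ⟨v, hv⟩) :=
        φ.map_rel_iff.2 (show (g.graph.induce _).Adj ⟨u, hub⟩ ⟨v, hv⟩ from huv)
      have h3 : h.graph.dist (φ ⟨a, har⟩ : h.V) (φ ⟨v, hv⟩) ≤ _ :=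
        h.connected.dist_triangle (v := (φ ⟨u, hub⟩ : h.V))
      rw [SimpleGraph.dist_eq_one_iff_adj.2 h2] at h3
      omega

/-- `φ` witnesses that the `r`-balls of `g` and `h` are close. -/
def IsCloseBy [PseudoMetricSpace X] {r : ℕ} {g h : RootedGraph k X}
    (φ : g.graph.induce (g.ball r) ≃g h.graph.induce (h.ball r)) : Prop :=
  (∀ i, (φ ⟨g.root i, g.root_mem_ball r i⟩ : h.V) = h.root i) ∧
    ∀ v : g.ball r, dist (g.mark v) (h.mark (φ v)) ≤ 1 / ((r : ℝ) + 1)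

theorem IsCloseBy.symm [PseudoMetricSpace X] {r : ℕ} {g h : RootedGraph k X}
    {φ : g.graph.induce (g.ball r) ≃g h.graph.induce (h.ball r)} (hφ : IsCloseBy φ) :
    IsCloseBy φ.symm := by
  refine ⟨fun i => ?_, fun v => ?_⟩
  · have : (⟨h.root i, h.root_mem_ball r i⟩ : h.ball r) = φ ⟨g.root i, g.root_mem_ball r i⟩ :=
      Subtype.ext (hφ.1 i).symm
    rw [this, φ.symm_apply_apply]
  · have := hφ.2 (φ.symm v)
    rwa [φ.apply_symm_apply, dist_comm] at this

theorem IsCloseBy.dist_le [PseudoMetricSpace X] {r n : ℕ} {g h : RootedGraph k X}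
    {φ : g.graph.induce (g.ball r) ≃g h.graph.induce (h.ball r)} (hφ : IsCloseBy φ)
    {i : Fin k} {a : g.V} (ha : g.graph.dist (g.root i) a ≤ n) (har : a ∈ g.ball r)
    (hn : n ≤ r) : h.graph.dist (h.root i) (φ ⟨a, har⟩ : h.V) ≤ n := by
  have := dist_map_le φ (i := i) (a := g.root i) (n := 0) (by simp) (g.root_mem_ball r i) n
    (by omega) a har ha
  rwa [hφ.1 i] at this

/-- Moving the roots of two close graphs in the same way keeps them close. -/
theorem IsCloseBy.close_decorate [PseudoMetricSpace X] {r n s : ℕ} {g h : RootedGraph k X}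
    {φ : g.graph.induce (g.ball r) ≃g h.graph.induce (h.ball r)} (hφ : IsCloseBy φ)
    (ρ : Fin m → g.V) (hρ : ∀ j, ∃ i, g.graph.dist (g.root i) (ρ j) ≤ n) (hr : n + s ≤ r)
    (ρ' : Fin m → h.V) (hb : ∀ j, ρ j ∈ g.ball r) (hρ' : ∀ j, ρ' j = φ ⟨ρ j, hb j⟩) :
    Close s (g.decorate ρ g.mark) (h.decorate ρ' h.mark) := by
  have hh : ∀ j, ∃ i, h.graph.dist (h.root i) (ρ' j) ≤ n := fun j => by
    obtain ⟨i, hi⟩ := hρ j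
    exact ⟨i, hρ' j ▸ hφ.dist_le hi (hb j) (by omega)⟩
  have hb' : ∀ j, ρ' j ∈ h.ball r := fun j => by rw [hρ' j]; exact (φ _).2
  have hs' : ∀ j, φ.symm ⟨ρ' j, hb' j⟩ = ⟨ρ j, hb j⟩ := fun j => by
    rw [RelIso.symm_apply_eq]; exact Subtype.ext (hρ' j)
  have sub : ∀ v, v ∈ (g.decorate ρ g.mark).ball s → v ∈ g.ball r := fun v ⟨j, hj⟩ => by
    obtain ⟨i, hi⟩ := hρ j
    exact mem_ball_of_dist_le hi hj hr
  have sub' : ∀ v, v ∈ (h.decorate ρ' h.mark).ball s → v ∈ h.ball r := fun v ⟨j, hj⟩ => by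
    obtain ⟨i, hi⟩ := hh j
    exact mem_ball_of_dist_le hi hj hr
  have fwd : ∀ v (hv : v ∈ (g.decorate ρ g.mark).ball s),
      (φ ⟨v, sub v hv⟩ : h.V) ∈ (h.decorate ρ' h.mark).ball s := by
    intro v hv
    obtain ⟨j, hj⟩ := hv
    obtain ⟨i, hi⟩ := hρ j
    refine ⟨j, ?_⟩
    have := dist_map_le φ hi (hb j) s hr v (sub v ⟨j, hj⟩) hj
    rwa [← hρ' j] at this
  have bwd : ∀ v (hv : v ∈ (h.decorate ρ' h.mark).ball s),
      (φ.symm ⟨v, sub' v hv⟩ : g.V) ∈ (g.decorate ρ g.mark).ball s := by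
    intro v hv
    obtain ⟨j, hj⟩ := hv
    obtain ⟨i, hi⟩ := hh j
    refine ⟨j, ?_⟩
    have := dist_map_le φ.symm hi (hb' j) s hr v (sub' v ⟨j, hj⟩) hj
    rwa [hs'] at this
  refine ⟨{ toFun := fun v => ⟨(φ ⟨v.1, sub v.1 v.2⟩).1, fwd v.1 v.2⟩
            invFun := fun v => ⟨(φ.symm ⟨v.1, sub' v.1 v.2⟩).1, bwd v.1 v.2⟩
            left_inv := fun v => Subtype.ext ?_
            right_inv := fun v => Subtype.ext ?_
            map_rel_iff' := fun {a b} =>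
              φ.map_rel_iff (a := ⟨a.1, sub a.1 a.2⟩) (b := ⟨b.1, sub b.1 b.2⟩) }, fun j => (hρ' j).symm, fun v => ?_⟩
  · have := congrArg Subtype.val (φ.symm_apply_apply ⟨v.1, sub v.1 v.2⟩)
    exact this
  · have := congrArg Subtype.val (φ.apply_symm_apply ⟨v.1, sub' v.1 v.2⟩)
    exact this
  · refine (hφ.2 ⟨v.1, sub v.1 v.2⟩).trans ?_
    have : (s : ℝ) ≤ r := by exact_mod_cast (by omega : s ≤ r)
    gcongr

theorem Close.mono [PseudoMetricSpace X] {r s : ℕ} {g h : RootedGraph k X} (hc : Close r g h)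
    (hs : s ≤ r) : Close s g h := by
  obtain ⟨φ, hφ⟩ := hc
  exact IsCloseBy.close_decorate (φ := φ) hφ g.root (n := 0) (fun j => ⟨j, by simp⟩) (by omega)
    h.root (g.root_mem_ball r) (fun j => (hφ.1 j).symm)

theorem Iso.close [PseudoMetricSpace X] {g h : RootedGraph k X} (hi : Iso g h) (r : ℕ) :
    Close r g h := by
  obtain ⟨φ, h1, h2⟩ := hi
  have e : ∀ v, v ∈ g.ball r ↔ φ v ∈ h.ball r := by
    intro v
    have hd : ∀ i, h.graph.dist (h.root i) (φ v) = g.graph.dist (g.root i) v := fun i => by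
      rw [← h1 i, SimpleGraph.dist_eq_sInf, SimpleGraph.dist_eq_sInf]
      congr 1
      ext n
      constructor
      · rintro ⟨w, rfl⟩
        refine ⟨(w.map φ.symm.toHom).copy (φ.symm_apply_apply _) (φ.symm_apply_apply _), ?_⟩
        simp
      · rintro ⟨w, rfl⟩
        exact ⟨w.map φ.toHom, by simp⟩
    simp only [ball, Set.mem_ofPred_eq, hd]
  refine ⟨{ toEquiv := φ.toEquiv.subtypeEquiv e
            map_rel_iff' := fun {a b} => φ.map_rel_iff (a := a) (b := b) },
    fun i => h1 i, fun v => ?_⟩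
  have : dist (g.mark v) (h.mark (φ v)) ≤ 1 / ((r : ℝ) + 1) := by
    rw [h2 v, dist_self]
    positivity
  exact this

theorem mem_of_iso [PseudoMetricSpace X] {S : Set (RootedGraph k X)} (hS : IsOpen S)
    {g h : RootedGraph k X} (hi : Iso g h) (hg : g ∈ S) : h ∈ S := by
  obtain ⟨R, hR⟩ := hS g hg
  exact hR R le_rfl h (hi.close R)

theorem isOpen_of_forall_close [PseudoMetricSpace X] {S : Set (RootedGraph k X)}
    (hS : ∀ g ∈ S, ∃ R, ∀ h, Close R g h → h ∈ S) : IsOpen S := fun g hg => by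
  obtain ⟨R, hR⟩ := hS g hg
  exact ⟨R, fun r hr h hc => hR h (hc.mono hr)⟩

instance [PseudoMetricSpace X] : MeasurableSpace (RootedGraph k X) := borel _
instance [PseudoMetricSpace X] : BorelSpace (RootedGraph k X) := ⟨rfl⟩

/-- Open sets of representatives are invariant under isomorphism, so the topology is induced from
the quotient. This allows working with rooted graphs instead of isomorphism classes. -/
theorem measurableSet_iff [PseudoMetricSpace X] {S : Set (RootedGraph k X)} :
    MeasurableSet S ↔ ∃ B : Set (GraphSpace k X), MeasurableSet B ∧ cls ⁻¹' B = S := by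
  have : (localTopology : TopologicalSpace (RootedGraph k X)) =
      TopologicalSpace.induced cls inferInstance := by
    refine le_antisymm ?_ ?_
    · rw [← continuous_iff_le_induced]
      exact continuous_quotient_mk'
    · intro S hS
      refine ⟨cls '' S, ?_, ?_⟩
      · refine isOpen_coinduced.2 ?_
        convert hS using 1
        ext g
        constructor
        · rintro ⟨h, hh, e⟩
          exact mem_of_iso hS (Quotient.exact e) hh
        · exact fun hg => ⟨g, hg, rfl⟩
      · ext g
        constructor
        · rintro ⟨h, hh, e⟩
          exact mem_of_iso hS (Quotient.exact e) hh
        · exact fun hg => ⟨g, hg, rfl⟩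
  have e : (borel (RootedGraph k X)) = MeasurableSpace.comap cls (borel (GraphSpace k X)) := by
    rw [← borel_comap, this]
  show MeasurableSet[borel _] S ↔ _
  rw [e]
  rfl

theorem measurable_cls [PseudoMetricSpace X] :
    Measurable (cls : RootedGraph k X → GraphSpace k X) :=
  fun B hB => measurableSet_iff.2 ⟨B, hB, rfl⟩

/-- A representative of an isomorphism class. -/
def rep (t : GraphSpace k X) : RootedGraph k X := Quotient.out t

theorem cls_rep (t : GraphSpace k X) : cls (rep t) = t := Quotient.out_eq t

theorem measurable_rep [PseudoMetricSpace X] :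
    Measurable (rep : GraphSpace k X → RootedGraph k X) := fun S hS => by
  obtain ⟨B, hB, rfl⟩ := measurableSet_iff.1 hS
  have : rep ⁻¹' (cls ⁻¹' B) = B := Set.ext fun t => by
    rw [Set.mem_preimage, Set.mem_preimage, cls_rep]
  rwa [this]

/-- Borel sets of representatives are pulled back from isomorphism classes, so measurable functions
are isomorphism invariants. -/
theorem measurable_eq_of_cls_eq [PseudoMetricSpace X] {β : Type*} [MeasurableSpace β]
    [MeasurableSingletonClass β] {F : RootedGraph k X → β} (hF : Measurable F)
    {g h : RootedGraph k X} (e : cls g = cls h) : F g = F h := by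
  obtain ⟨B, -, hB⟩ := measurableSet_iff.1 (hF (measurableSet_singleton (F h)))
  have : h ∈ cls ⁻¹' B := by rw [hB]; rfl
  have : g ∈ cls ⁻¹' B := by rw [Set.mem_preimage, e]; exact this
  rw [hB] at this
  exact this

/-- Choosing some of the roots (with repetitions) is measurable. -/
theorem measurable_reroot [PseudoMetricSpace X] (σ : Fin m → Fin k) :
    Measurable fun g : RootedGraph k X => g.decorate (fun j => g.root (σ j)) g.mark := by
  refine Continuous.measurable ⟨fun S hS => isOpen_of_forall_close fun g hg => ?_⟩
  obtain ⟨R, hR⟩ := hS _ hg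
  refine ⟨R, fun h ⟨φ, hφ⟩ => hR R le_rfl _ ?_⟩
  exact IsCloseBy.close_decorate (φ := φ) hφ _ (n := 0) (fun j => ⟨σ j, by simp⟩) (by omega)
    _ (fun j => g.root_mem_ball R _) (fun j => (hφ.1 _).symm)

/-! ### Sums, quantifiers and counts over an additional root. -/

/-- Add a new first root. -/
def cons (g : RootedGraph k X) (y : g.V) : RootedGraph (k + 1) X :=
  g.decorate (Fin.cons y g.root) g.mark

theorem finite_dist_le (g : RootedGraph k X) (a : g.V) (n : ℕ) :
    {y | g.graph.dist a y ≤ n}.Finite := by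
  induction n with
  | zero =>
    refine (Set.finite_singleton a).subset fun y hy => ?_
    exact (g.connected.dist_eq_zero_iff.1 (Nat.le_zero.1 hy)).symm
  | succ n ih =>
    refine (ih.union (ih.biUnion fun u _ => g.locallyFinite u)).subset fun y hy => ?_
    rcases Nat.lt_or_ge (g.graph.dist a y) (n + 1) with h | h
    · exact Or.inl (Nat.lt_succ_iff.1 h)
    · obtain ⟨u, huy, hu⟩ := g.connected.exists_adj_dist_eq (le_antisymm hy h)
      exact Or.inr (Set.mem_biUnion (show u ∈ {y | _} from hu.le) huy)

instance (g : RootedGraph k X) : Countable g.V := by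
  obtain ⟨a⟩ := g.connected.nonempty
  have : (Set.univ : Set g.V) = ⋃ n, {y | g.graph.dist a y ≤ n} := by
    ext y
    simp only [Set.mem_univ, Set.mem_iUnion, true_iff]
    exact ⟨g.graph.dist a y, le_refl (g.graph.dist a y)⟩
  rw [← Set.countable_univ_iff, this]
  exact Set.countable_iUnion fun n => (g.finite_dist_le a n).countable

theorem finite_sphere (g : RootedGraph k X) (a : g.V) (n : ℕ) :
    {y | g.graph.dist a y = n}.Finite :=
  (g.finite_dist_le a n).subset fun _ h => le_of_eq h

open Classical in
/-- The sum of the point masses at the graphs obtained from `g` by adding a new root at distance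
`n` from the first one. -/
def sphereMeasure [PseudoMetricSpace X] (n : ℕ) (g : RootedGraph (k + 1) X) :
    Measure (RootedGraph (k + 2) X) :=
  ∑ y ∈ (g.finite_sphere (g.root 0) n).toFinset, Measure.dirac (g.cons y)

instance [PseudoMetricSpace X] (n : ℕ) (g : RootedGraph (k + 1) X) :
    IsFiniteMeasure (sphereMeasure n g) := by
  unfold sphereMeasure; infer_instance

open Classical in
theorem sphereMeasure_apply [PseudoMetricSpace X] (n : ℕ) (g : RootedGraph (k + 1) X)
    {S : Set (RootedGraph (k + 2) X)} (hS : MeasurableSet S) :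
    sphereMeasure n g S =
      (((g.finite_sphere (g.root 0) n).toFinset.filter fun y => g.cons y ∈ S).card : ℝ≥0∞) := by
  simp only [sphereMeasure, Measure.coe_finsetSum, Finset.sum_apply, Measure.dirac_apply' _ hS,
    Finset.card_filter, Nat.cast_sum, Set.indicator_apply, Pi.one_apply]
  simp

open Classical in
-- For open `S` the number of admissible new roots is lower semicontinuous: an isomorphism of large
-- balls carries those of `g` injectively to those of a close graph.
theorem measurable_sphereMeasure_open [PseudoMetricSpace X] (n : ℕ)
    {S : Set (RootedGraph (k + 2) X)} (hS : IsOpen S) :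
    Measurable fun g : RootedGraph (k + 1) X => sphereMeasure n g S := by
  refine measurable_of_Ioi fun a => IsOpen.measurableSet (isOpen_of_forall_close fun g hg => ?_)
  have hg' : a < sphereMeasure n g S := hg
  rw [sphereMeasure_apply n g hS.measurableSet] at hg'
  set A := (g.finite_sphere (g.root 0) n).toFinset.filter fun y => g.cons y ∈ S with hA
  have : ∀ y : g.V, ∃ R, y ∈ A → ∀ r ≥ R, ∀ h, Close r (g.cons y) h → h ∈ S := fun y => by
    by_cases hy : y ∈ A
    · obtain ⟨R, hR⟩ := hS _ (Finset.mem_filter.1 hy).2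
      exact ⟨R, fun _ => hR⟩
    · exact ⟨0, fun h => absurd h hy⟩
  choose R hR using this
  set R' := A.sup R
  -- The new root is at distance `n` from the first one, so its `R'`-ball lies in the ball of radius
  -- `R' + n`.
  refine ⟨R' + n, fun h ⟨φ, hφ⟩ => ?_⟩
  have hφ : IsCloseBy φ := hφ
  show a < sphereMeasure n h S
  rw [sphereMeasure_apply n h hS.measurableSet]
  refine hg'.trans_le (Nat.cast_le.2 ?_)
  have hd : ∀ y ∈ A, g.graph.dist (g.root 0) y = n := fun y hy => by
    have := (Finset.mem_filter.1 hy).1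
    simpa using this
  have hb : ∀ y ∈ A, y ∈ g.ball (R' + n) := fun y hy => ⟨0, by rw [hd y hy]; omega⟩
  refine Finset.card_le_card_of_injOn
    (fun y => if hy : y ∈ A then (φ ⟨y, hb y hy⟩ : h.V) else h.root 0) ?_ ?_
  · intro y hy
    have hy : y ∈ A := hy
    simp only [hy, dif_pos, Finset.coe_filter, Set.Finite.mem_toFinset, Set.mem_ofPred_eq]
    constructor
    · refine le_antisymm (hφ.dist_le (hd y hy).le (hb y hy) (by omega)) ?_
      by_contra hlt
      push Not at hlt
      have := hφ.symm.dist_le (i := 0) (a := (φ ⟨y, hb y hy⟩ : h.V)) (n := n - 1)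
        (by omega) (φ _).2 (by omega)
      simp only [Subtype.coe_eta, RelIso.symm_apply_apply, hd y hy] at this
      omega
    · refine hR y hy R' (Finset.le_sup hy) _ ?_
      refine hφ.close_decorate _ (n := n) (fun j => ?_) (by omega) _ (fun j => ?_) (fun j => ?_)
      · refine Fin.cases ⟨0, (hd y hy).le⟩ (fun j => ⟨j, by simp⟩) j
      · exact Fin.cases (hb y hy) (fun j => g.root_mem_ball _ j) j
      · exact Fin.cases rfl (fun j => (hφ.1 j).symm) j
  · intro y hy z hz e
    have hy : y ∈ A := hy
    have hz : z ∈ A := hz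
    simp only [hy, hz, dif_pos] at e
    exact congrArg Subtype.val (φ.injective (Subtype.ext e))

theorem measurable_sphereMeasure [PseudoMetricSpace X] (n : ℕ) :
    Measurable (sphereMeasure n : RootedGraph (k + 1) X → Measure (RootedGraph (k + 2) X)) :=
  .measure_of_isPiSystem rfl
    isPiSystem_isOpen
    (fun _ hs => measurable_sphereMeasure_open n hs) (measurable_sphereMeasure_open n isOpen_univ)

/-- Summing a measurable function over the position of one root is measurable. -/
theorem measurable_tsum_cons [PseudoMetricSpace X] {f : RootedGraph (k + 2) X → ℝ≥0∞}
    (hf : Measurable f) : Measurable fun g : RootedGraph (k + 1) X => ∑' y, f (g.cons y) := by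
  have : (fun g : RootedGraph (k + 1) X => ∑' y, f (g.cons y)) =
      fun g => ∑' n, ∫⁻ h, f h ∂(sphereMeasure n g) := by
    funext g
    rw [← (Equiv.sigmaFiberEquiv fun y => g.graph.dist (g.root 0) y).tsum_eq, ENNReal.tsum_sigma']
    refine tsum_congr fun n => ?_
    rw [sphereMeasure, lintegral_finsetSum_measure]
    simp_rw [lintegral_dirac' _ hf]
    rw [← Finset.tsum_subtype]
    let e : {y // g.graph.dist (g.root 0) y = n} ≃
        {y // y ∈ (g.finite_sphere (g.root 0) n).toFinset} :=
      Equiv.subtypeEquivRight fun y => by simp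
    exact e.tsum_eq (fun y => f (g.cons y))
  rw [this]
  exact Measurable.tsum fun n => (Measure.measurable_lintegral hf).comp (measurable_sphereMeasure n)

/-- The image of a measurable set under forgetting the first root is measurable. -/
theorem measurableSet_exists [PseudoMetricSpace X] {S : Set (RootedGraph (k + 2) X)}
    (hS : MeasurableSet S) : MeasurableSet {g : RootedGraph (k + 1) X | ∃ y, g.cons y ∈ S} := by
  have h := measurable_tsum_cons ((measurable_const (a := (1 : ℝ≥0∞))).indicator hS)
  have : {g : RootedGraph (k + 1) X | ∃ y, g.cons y ∈ S} =
      {g | ∑' y, S.indicator (fun _ => (1 : ℝ≥0∞)) (g.cons y) = 0}ᶜ := by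
    ext g
    simp [ENNReal.tsum_eq_zero]
  rw [this]
  exact (h (measurableSet_singleton 0)).compl

theorem measurableSet_forall [PseudoMetricSpace X] {S : Set (RootedGraph (k + 2) X)}
    (hS : MeasurableSet S) : MeasurableSet {g : RootedGraph (k + 1) X | ∀ y, g.cons y ∈ S} := by
  convert (measurableSet_exists hS.compl).compl using 1
  ext g
  simp

theorem tsum_indicator_cons (g : RootedGraph k X) (S : Set (RootedGraph (k + 1) X)) :
    ∑' y, S.indicator (fun _ => (1 : ℝ≥0∞)) (g.cons y) =
      (({y | g.cons y ∈ S}.encard : ℕ∞) : ℝ≥0∞) := by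
  rw [← ENNReal.tsum_set_one, tsum_subtype {y | g.cons y ∈ S} (fun _ => (1 : ℝ≥0∞))]
  rfl

theorem measurableSet_infinite [PseudoMetricSpace X] {S : Set (RootedGraph (k + 2) X)}
    (hS : MeasurableSet S) :
    MeasurableSet {g : RootedGraph (k + 1) X | {y | g.cons y ∈ S}.Infinite} := by
  have h := measurable_tsum_cons ((measurable_const (a := (1 : ℝ≥0∞))).indicator hS)
  simp_rw [tsum_indicator_cons] at h
  convert h (measurableSet_singleton ⊤) using 1
  ext g
  simp

theorem measurable_ncard [PseudoMetricSpace X] {S : Set (RootedGraph (k + 2) X)}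
    (hS : MeasurableSet S) :
    Measurable fun g : RootedGraph (k + 1) X => {y | g.cons y ∈ S}.ncard := by
  have h := measurable_tsum_cons ((measurable_const (a := (1 : ℝ≥0∞))).indicator hS)
  simp_rw [tsum_indicator_cons] at h
  convert Nat.measurable_floor.comp h.ennreal_toReal using 1
  funext g
  simp only [Function.comp, Set.ncard]
  cases {y | g.cons y ∈ S}.encard <;> simp

/-- The infimum is below `a` exactly if some admissible root has a value below `a`, which is an
existential condition on a root. -/
theorem measurable_iInf_cons [PseudoMetricSpace X] {S : Set (RootedGraph (k + 2) X)}
    (hS : MeasurableSet S) {f : RootedGraph (k + 2) X → ℝ≥0∞} (hf : Measurable f) :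
    Measurable fun g : RootedGraph (k + 1) X => ⨅ y, ⨅ _ : g.cons y ∈ S, f (g.cons y) := by
  refine measurable_of_Iio fun a => ?_
  convert measurableSet_exists (hS.inter (hf measurableSet_Iio)) using 1
  ext g
  simp [iInf_lt_iff]
  rfl

end RootedGraph

/-! ### The graph with iid labels: its law and mass transport. -/

namespace RootedGraph

variable {k m : ℕ} {X Y : Type}

theorem finite_ball (g : RootedGraph k X) (r : ℕ) : (g.ball r).Finite := by
  have : g.ball r = ⋃ i, {v | g.graph.dist (g.root i) v ≤ r} := by
    ext v; simp [ball]
  rw [this]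
  exact Set.finite_iUnion fun i => g.finite_dist_le _ _

/-- Put labels on an unmarked graph. -/
def label (g : RootedGraph k Unit) (lab : g.V → unitInterval) : RootedGraph k unitInterval :=
  g.decorate g.root lab

/-- Forget the marks. -/
def forget (g : RootedGraph k X) : RootedGraph k Unit := g.decorate g.root fun _ => ()

theorem close_label {r : ℕ} {g h : RootedGraph k Unit}
    (φ : g.graph.induce (g.ball r) ≃g h.graph.induce (h.ball r))
    (hφ : ∀ i, (φ ⟨g.root i, g.root_mem_ball r i⟩ : h.V) = h.root i)
    (lab : g.V → unitInterval) (lab' : h.V → unitInterval)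
    (hl : ∀ v : g.ball r, dist (lab v) (lab' (φ v)) ≤ 1 / ((r : ℝ) + 1)) :
    Close r (g.label lab) (h.label lab') :=
  ⟨φ, hφ, hl⟩

theorem continuous_label (g : RootedGraph k Unit) : Continuous g.label := by
  refine ⟨fun S hS => isOpen_iff_mem_nhds.2 fun lab hlab => ?_⟩
  obtain ⟨R, hR⟩ := hS _ hlab
  have : ∀ᶠ lab' in nhds lab, ∀ v ∈ g.ball R, dist (lab v) (lab' v) < 1 / ((R : ℝ) + 1) := by
    refine (eventually_all_finite (g.finite_ball R)).2 fun v _ => ?_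
    have h1 : Tendsto (fun lab' : g.V → unitInterval => dist (lab v) (lab' v)) (nhds lab)
        (nhds (dist (lab v) (lab v))) :=
      ((continuous_const.dist (continuous_apply v)).tendsto _)
    rw [dist_self] at h1
    exact h1.eventually_lt_const (by positivity)
  filter_upwards [this] with lab' h'
  exact hR R le_rfl _ (close_label SimpleGraph.Iso.refl (fun _ => rfl) lab lab'
    fun v => (h' v v.2).le)

theorem measurable_label (g : RootedGraph k Unit) : Measurable g.label :=
  g.continuous_label.measurable

theorem measurable_forget [PseudoMetricSpace X] :
    Measurable (forget : RootedGraph k X → RootedGraph k Unit) := by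
  refine Continuous.measurable ⟨fun S hS => isOpen_of_forall_close fun g hg => ?_⟩
  obtain ⟨R, hR⟩ := hS _ hg
  refine ⟨R, fun h ⟨φ, hφ⟩ => hR R le_rfl _ ⟨φ, hφ.1, fun v => ?_⟩⟩
  show dist () () ≤ _
  rw [dist_self]
  positivity

instance (V : Type) : IsProbabilityMeasure (iidLabels V) := by
  unfold iidLabels; infer_instance

/-- The law of the labelled graph, for iid labels. -/
def labelLaw (g : RootedGraph k Unit) : Measure (RootedGraph k unitInterval) :=
  (iidLabels g.V).map g.label

instance (g : RootedGraph k Unit) : IsProbabilityMeasure g.labelLaw :=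
  Measure.isProbabilityMeasure_map g.measurable_label.aemeasurable

/-- Lower semicontinuity again: up to small probability, membership of the labelled graph in `S` is
decided by one ball with some tolerance, and isomorphic balls carry labels of the same law. -/
theorem measurable_labelLaw_open {S : Set (RootedGraph k unitInterval)} (hS : IsOpen S) :
    Measurable fun g : RootedGraph k Unit => labelLaw g S := by
  refine measurable_of_Ioi fun a => IsOpen.measurableSet (isOpen_of_forall_close fun g hg => ?_)
  have hg' : a < labelLaw g S := hg
  rw [labelLaw, Measure.map_apply g.measurable_label hS.measurableSet] at hg'
  -- `E R` consists of the labellings for which closeness at every radius from `R` on suffices for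
  -- membership in `S`.
  set E : ℕ → Set (g.V → unitInterval) :=
    fun R => {lab | ∀ r ≥ R, ∀ h, Close r (g.label lab) h → h ∈ S} with hE
  have hmono : Monotone E := fun R R' hRR' lab hl r hr => hl r (hRR'.trans hr)
  have hU : g.label ⁻¹' S = ⋃ R, E R := by
    ext lab
    simp only [Set.mem_iUnion]
    constructor
    · exact fun h => hS _ h
    · rintro ⟨R, hR⟩
      exact hR R le_rfl _ (Iso.close ⟨SimpleGraph.Iso.refl, fun _ => rfl, fun _ => rfl⟩ R)
  rw [hU, hmono.measure_iUnion, lt_iSup_iff] at hg'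
  obtain ⟨R, hR⟩ := hg'
  refine ⟨R, fun h ⟨φ, hφ⟩ => ?_⟩
  show a < labelLaw h S
  rw [labelLaw, Measure.map_apply h.measurable_label hS.measurableSet]
  have := (g.finite_ball R).fintype
  have hδ : (0 : ℝ) < 1 / ((R : ℝ) + 1) := by positivity
  -- `E R` need not be measurable or depend only on the ball. The thickening of its projection is
  -- open, depends only on the labels in the ball, and uses exactly the tolerance allowed by `Close
  -- R`.
  set O : Set (g.ball R → unitInterval) :=
    Metric.thickening (1 / ((R : ℝ) + 1)) ((fun lab (v : g.ball R) => lab v) '' E R) with hO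
  have hOm : MeasurableSet O := Metric.isOpen_thickening.measurableSet
  have key : ∀ {h : RootedGraph k Unit} (j : g.ball R → h.V), Function.Injective j →
      iidLabels h.V {lab | (fun v => lab (j v)) ∈ O} =
        Measure.infinitePi (fun _ : g.ball R => (volume : Measure unitInterval)) O := by
    intro h j hj
    have e := Measure.map_infinitePi_infinitePi_of_inj
      (P := fun _ : h.V => (volume : Measure unitInterval)) hj
    rw [← e, Measure.map_apply (by fun_prop) hOm]
    rfl
  calc a < iidLabels g.V (E R) := hR
    _ ≤ iidLabels g.V {lab | (fun v : g.ball R => lab v) ∈ O} :=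
      measure_mono fun lab hl => Metric.self_subset_thickening hδ _ ⟨lab, hl, rfl⟩
    _ = iidLabels h.V {lab | (fun v : g.ball R => lab (φ v)) ∈ O} := by
      rw [key (h := g) (fun v => (v : g.V)) Subtype.val_injective,
        key (h := h) (fun v => (φ v : h.V)) (Subtype.val_injective.comp φ.injective)]
    _ ≤ _ := measure_mono fun lab' hl => by
      obtain ⟨_, ⟨lab, hlab, rfl⟩, hd⟩ := Metric.mem_thickening_iff.1 hl
      refine hlab R le_rfl _ (close_label φ hφ.1 lab lab' fun v => ?_)
      rw [dist_comm]
      exact (dist_le_pi_dist (fun v : g.ball R => lab' (φ v)) (fun v => lab v) v).trans hd.le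

theorem measurable_labelLaw :
    Measurable (labelLaw : RootedGraph k Unit → Measure (RootedGraph k unitInterval)) :=
  .measure_of_isPiSystem_of_isProbabilityMeasure rfl isPiSystem_isOpen
    fun _ hs => measurable_labelLaw_open hs

/-- The law of the random rooted graph with iid labels. -/
def labelledLaw (μ : Measure (GraphSpace 1 Unit)) : Measure (RootedGraph 1 unitInterval) :=
  (μ.map rep).bind labelLaw

theorem lintegral_labelledLaw (μ : Measure (GraphSpace 1 Unit))
    {f : RootedGraph 1 unitInterval → ℝ≥0∞} (hf : Measurable f) :
    ∫⁻ g, f g ∂(labelledLaw μ) =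
      ∫⁻ t, ∫⁻ lab, f ((rep t).label lab) ∂(iidLabels (rep t).V) ∂μ := by
  rw [labelledLaw, Measure.lintegral_bind measurable_labelLaw.aemeasurable hf.aemeasurable,
    lintegral_map (f := fun g => ∫⁻ x, f x ∂(labelLaw g))
      ((Measure.measurable_lintegral hf).comp measurable_labelLaw) measurable_rep]
  refine lintegral_congr fun t => ?_
  rw [labelLaw, lintegral_map hf (measurable_label _)]

theorem labelledLaw_apply (μ : Measure (GraphSpace 1 Unit))
    {A : Set (RootedGraph 1 unitInterval)} (hA : MeasurableSet A) :
    labelledLaw μ A = ∫⁻ t, labelLaw (rep t) A ∂μ := by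
  rw [labelledLaw, Measure.bind_apply hA measurable_labelLaw.aemeasurable,
    lintegral_map (f := fun g => labelLaw g A)
      ((Measure.measurable_coe hA).comp measurable_labelLaw) measurable_rep]

instance (μ : Measure (GraphSpace 1 Unit)) [IsProbabilityMeasure μ] :
    IsProbabilityMeasure (labelledLaw μ) :=
  ⟨by simp [labelledLaw_apply μ MeasurableSet.univ]⟩

/-- `labelledLaw` sees one chosen representative, `AlmostSurely` all of them. The probability of the
bad labellings is measurable in the graph, hence the same for all representatives. -/
theorem almostSurely_of_ae {μ : Measure (GraphSpace 1 Unit)}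
    {P : RootedGraph 1 unitInterval → Prop} (hP : MeasurableSet {g | P g})
    (h : ∀ᵐ g ∂(labelledLaw μ), P g) :
    AlmostSurely μ fun T => ∀ᵐ lab ∂(iidLabels T.V), P (T.label lab) := by
  have hF : Measurable fun g : RootedGraph 1 Unit => labelLaw g {g | P g}ᶜ :=
    (Measure.measurable_coe hP.compl).comp measurable_labelLaw
  have h0 : labelledLaw μ {g | P g}ᶜ = 0 := h
  rw [labelledLaw_apply μ hP.compl] at h0
  replace h0 := (lintegral_eq_zero_iff (hF.comp measurable_rep)).1 h0
  filter_upwards [h0] with t ht g hg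
  have e := measurable_eq_of_cls_eq hF (g := g) (h := rep t) (by rw [hg, cls_rep])
  have ht : labelLaw (rep t) {g | P g}ᶜ = 0 := ht
  rw [ht, labelLaw, Measure.map_apply g.measurable_label hP.compl] at e
  exact e

theorem ae_of_almostSurely {μ : Measure (GraphSpace 1 Unit)} {P : RootedGraph 1 Unit → Prop}
    (h : AlmostSurely μ P) : ∀ᵐ g ∂(labelledLaw μ), P g.forget := by
  obtain ⟨N, hN, hNm, h0⟩ := exists_measurable_superset_of_null h
  have hA : MeasurableSet {g : RootedGraph 1 unitInterval | cls g.forget ∈ N} :=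
    measurable_forget (measurable_cls hNm)
  have : labelledLaw μ {g | cls g.forget ∈ N} = 0 := by
    rw [labelledLaw_apply μ hA]
    refine (lintegral_eq_zero_iff ((Measure.measurable_coe hA).comp
      (measurable_labelLaw.comp measurable_rep))).2 ?_
    have hN0 : ∀ᵐ t ∂μ, t ∉ N := measure_eq_zero_iff_ae_notMem.1 h0
    filter_upwards [hN0] with t ht
    show labelLaw (rep t) _ = 0
    rw [labelLaw, Measure.map_apply (measurable_label _) hA]
    convert measure_empty (μ := iidLabels (rep t).V)
    refine Set.eq_empty_of_forall_notMem fun lab hl => ht ?_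
    have : cls (rep t) ∈ N := hl
    rwa [cls_rep] at this
  refine measure_mono_null (fun g hg => ?_) this
  by_contra hgN
  have : ∀ g', cls g' = cls g.forget → P g' := by
    by_contra hcon
    exact hgN (hN hcon)
  exact hg (this _ rfl)

theorem ae_injective_mark (V : Type) [Countable V] :
    ∀ᵐ lab ∂(iidLabels V), Function.Injective lab := by
  have : ∀ᵐ lab ∂(iidLabels V), ∀ x y : V, x ≠ y → lab x ≠ lab y := by
    refine ae_all_iff.2 fun x => ae_all_iff.2 fun y => ?_
    by_cases hxy : x = y
    · simp [hxy]
    have h := Measure.infinitePi_map_eval_prod (P := fun _ : V => (volume : Measure unitInterval))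
      hxy
    have hd : MeasurableSet {p : unitInterval × unitInterval | p.1 = p.2} :=
      measurableSet_eq_fun measurable_fst measurable_snd
    have h0 : ((volume : Measure unitInterval).prod volume) {p | p.1 = p.2} = 0 := by
      rw [Measure.prod_apply hd]
      refine (lintegral_congr fun x => ?_).trans lintegral_zero
      convert measure_singleton (μ := (volume : Measure unitInterval)) x using 2
      ext y
      simp [eq_comm]
    rw [← h, Measure.map_apply (by fun_prop) hd] at h0
    have : ∀ᵐ lab ∂(iidLabels V), lab x ≠ lab y := by
      refine measure_mono_null (fun lab hl => ?_) h0
      simpa using hl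
    filter_upwards [this] with lab hl _ using hl
  filter_upwards [this] with lab hl x y h
  by_contra hxy
  exact hl x y hxy h

theorem measurable_tsum_snd [PseudoMetricSpace X] {f : RootedGraph 2 X → ℝ≥0∞}
    (hf : Measurable f) :
    Measurable fun g : RootedGraph 1 X => ∑' y, f (g.decorate ![g.root 0, y] g.mark) := by
  have : (fun g : RootedGraph 1 X => ∑' y, f (g.decorate ![g.root 0, y] g.mark)) =
      fun g => ∑' y, (f ∘ fun g => g.decorate (fun j => g.root (![1, 0] j)) g.mark) (g.cons y) :=
    funext fun g => tsum_congr fun y => congrArg (fun ρ => f (g.decorate ρ g.mark))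
      (funext fun j => by fin_cases j <;> rfl)
  rw [this]
  exact measurable_tsum_cons (hf.comp (measurable_reroot ![1, 0]))

theorem measurable_tsum_fst [PseudoMetricSpace X] {f : RootedGraph 2 X → ℝ≥0∞}
    (hf : Measurable f) :
    Measurable fun g : RootedGraph 1 X => ∑' y, f (g.decorate ![y, g.root 0] g.mark) := by
  have : (fun g : RootedGraph 1 X => ∑' y, f (g.decorate ![y, g.root 0] g.mark)) =
      fun g => ∑' y, f (g.cons y) :=
    funext fun g => tsum_congr fun y => congrArg (fun ρ => f (g.decorate ρ g.mark))
      (funext fun j => by fin_cases j <;> rfl)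
  rw [this]
  exact measurable_tsum_cons hf

/-- The mass transport principle for the graph with iid labels. -/
theorem lintegral_tsum_comm {μ : Measure (GraphSpace 1 Unit)} (hμ : IsUnimodular μ)
    {f : RootedGraph 2 unitInterval → ℝ≥0∞} (hf : Measurable f) :
    ∫⁻ g, ∑' y, f (g.decorate ![g.root 0, y] g.mark) ∂(labelledLaw μ) =
      ∫⁻ g, ∑' y, f (g.decorate ![y, g.root 0] g.mark) ∂(labelledLaw μ) := by
  -- Integrating out the labels leaves a measurable function of the unlabelled graph with two roots,
  -- to which unimodularity applies.
  set F : RootedGraph 2 Unit → ℝ≥0∞ := fun g => ∫⁻ h, f h ∂(labelLaw g) with hF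
  have hFm : Measurable F := (Measure.measurable_lintegral hf).comp measurable_labelLaw
  have hFrep : ∀ g, F (rep (cls g)) = F g := fun g => measurable_eq_of_cls_eq hFm (cls_rep _)
  have h := hμ (fun t => F (rep t)) (hFm.comp measurable_rep)
  rw [lintegral_labelledLaw μ (measurable_tsum_snd hf),
    lintegral_labelledLaw μ (measurable_tsum_fst hf)]
  have e1 : ∀ t, ∫⁻ lab, ∑' y : (rep t).V, f (((rep t).label lab).decorate ![(rep t).root 0, y] lab)
      ∂(iidLabels (rep t).V) = massOut (fun t => F (rep t)) t := fun t => by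
    refine Eq.trans ?_ (congrArg (massOut (fun t => F (rep t))) (cls_rep t))
    refine (lintegral_tsum fun y => ?_).trans (tsum_congr fun y => ?_)
    · exact (hf.comp
        (measurable_label ((rep t).decorate ![(rep t).root 0, y] (rep t).mark))).aemeasurable
    · refine Eq.trans ?_ (hFrep _).symm
      simp only [hF, labelLaw]
      rw [lintegral_map hf (measurable_label _)]
      rfl
  have e2 : ∀ t, ∫⁻ lab, ∑' y : (rep t).V, f (((rep t).label lab).decorate ![y, (rep t).root 0] lab)
      ∂(iidLabels (rep t).V) = massIn (fun t => F (rep t)) t := fun t => by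
    refine Eq.trans ?_ (congrArg (massIn (fun t => F (rep t))) (cls_rep t))
    refine (lintegral_tsum fun y => ?_).trans (tsum_congr fun y => ?_)
    · exact (hf.comp
        (measurable_label ((rep t).decorate ![y, (rep t).root 0] (rep t).mark))).aemeasurable
    · refine Eq.trans ?_ (hFrep _).symm
      simp only [hF, labelLaw]
      rw [lintegral_map hf (measurable_label _)]
      rfl
  exact (lintegral_congr e1).trans (h.trans (lintegral_congr e2).symm)

/-- Everything that happens somewhere happens at the root with positive probability. -/
theorem ae_forall_vertex {μ : Measure (GraphSpace 1 Unit)} (hμ : IsUnimodular μ)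
    {P : RootedGraph 1 unitInterval → Prop} (hP : MeasurableSet {g | P g})
    (h : ∀ᵐ g ∂(labelledLaw μ), P g) :
    ∀ᵐ g ∂(labelledLaw μ), ∀ y, P (g.decorate ![y] g.mark) := by
  -- Every vertex sends unit mass to each vertex at which `P` fails. The root almost surely receives
  -- nothing, so it almost surely sends nothing.
  set f : RootedGraph 2 unitInterval → ℝ≥0∞ :=
    fun g => {g | P g}ᶜ.indicator 1 (g.decorate (fun j => g.root (![1] j)) g.mark) with hf
  have hfm : Measurable f := (measurable_one.indicator hP.compl).comp (measurable_reroot ![1])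
  have e1 : ∀ g : RootedGraph 1 unitInterval, ∀ y,
      f (g.decorate ![g.root 0, y] g.mark) = {g | P g}ᶜ.indicator 1 (g.decorate ![y] g.mark) := by
    intro g y
    show {g | P g}ᶜ.indicator 1 (g.decorate _ g.mark) = _
    congr 2
    funext j
    fin_cases j; rfl
  have e2 : ∀ g : RootedGraph 1 unitInterval, ∀ y,
      f (g.decorate ![y, g.root 0] g.mark) = {g | P g}ᶜ.indicator 1 g := by
    intro g y
    show {g | P g}ᶜ.indicator 1 (g.decorate _ g.mark) = {g | P g}ᶜ.indicator 1 (g.decorate _ _)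
    congr 2
    funext j
    fin_cases j; rfl
  have key := lintegral_tsum_comm hμ hfm
  have h0 : ∫⁻ g, ∑' y, f (g.decorate ![y, g.root 0] g.mark) ∂(labelledLaw μ) = 0 := by
    refine (lintegral_congr_ae ?_).trans lintegral_zero
    filter_upwards [h] with g hg
    simp [e2, hg]
  rw [h0, lintegral_eq_zero_iff (measurable_tsum_snd hfm)] at key
  filter_upwards [key] with g hg y
  have := ENNReal.tsum_eq_zero.1 hg y
  rw [e1] at this
  by_contra hc
  simp [hc] at this

end RootedGraph

/-! ### The ancestor order of a one-ended tree. -/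

/-- An order in which the elements above any given one form an unbounded chain, and only finitely
many elements are below any given one: the ancestor order of a one-ended tree. -/
structure IsAncestorOrder {V : Type*} (le : V → V → Prop) : Prop where
  refl : ∀ x, le x x
  trans : ∀ {x y z}, le x y → le y z → le x z
  antisymm : ∀ {x y}, le x y → le y x → x = y
  total : ∀ {x y z}, le x y → le x z → le y z ∨ le z y
  finite : ∀ v, {x | le x v}.Finite
  directed : ∀ x y, ∃ z, le x z ∧ le y z
  unbounded : ∀ x, ∃ y, le x y ∧ y ≠ x

namespace SimpleGraph

variable {V : Type*} {G : SimpleGraph V}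

/-- The vertices that are closer to `u` than to its neighbour `x`. -/
def branch (G : SimpleGraph V) (x u : V) : Set V := {z | G.dist x z = G.dist u z + 1}

/-- The neighbour `u` of `x` lies in the direction of infinity. -/
def TowardsEnd (G : SimpleGraph V) (x u : V) : Prop := G.Adj x u ∧ (G.branch x u).Infinite

/-- The ancestor order of a one-ended tree. -/
def EndLE (G : SimpleGraph V) : V → V → Prop := Relation.ReflTransGen G.TowardsEnd

theorem IsTree.eq_of_dist_eq (hG : G.IsTree) {x u w z : V} (hu : G.Adj x u) (hw : G.Adj x w)
    (hzu : G.dist x z = G.dist u z + 1) (hzw : G.dist x z = G.dist w z + 1) : u = w := by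
  obtain ⟨p, hp⟩ := hG.connected.exists_walk_length_eq_dist u z
  obtain ⟨q, hq⟩ := hG.connected.exists_walk_length_eq_dist w z
  have h1 := (Walk.cons hu p).isPath_of_length_eq_dist (by rw [Walk.length_cons, hp, hzu])
  have h2 := (Walk.cons hw q).isPath_of_length_eq_dist (by rw [Walk.length_cons, hq, hzw])
  have := (hG.existsUnique_path x z).unique h1 h2
  simp only [Walk.cons.injEq] at this
  exact this.1

theorem IsTree.mem_branch_or (hG : G.IsTree) {x u : V} (hu : G.Adj x u) (z : V) :
    z ∈ G.branch x u ∨ z ∈ G.branch u x := by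
  have := hG.dist_eq_dist_add_one_of_adj z hu
  rw [G.dist_comm (u := z), G.dist_comm (u := z)] at this
  exact this

theorem notMem_branch_of_mem {x u z : V} (h : z ∈ G.branch x u) : z ∉ G.branch u x := by
  intro h'
  have h : G.dist x z = G.dist u z + 1 := h
  have h' : G.dist u z = G.dist x z + 1 := h'
  omega

theorem left_notMem_branch (x u : V) : x ∉ G.branch x u := fun h => by
  have h : G.dist x x = G.dist u x + 1 := h
  simp at h

theorem right_mem_branch {x u : V} (h : G.Adj x u) : u ∈ G.branch x u := by
  show G.dist x u = G.dist u u + 1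
  simpa using h

theorem Connected.exists_mem_branch (hG : G.Connected) {x z : V} (h : z ≠ x) :
    ∃ u, G.Adj x u ∧ z ∈ G.branch x u := by
  have : G.dist z x ≠ 0 := fun h' => h (hG.dist_eq_zero_iff.1 h')
  obtain ⟨u, hu, hd⟩ := hG.exists_adj_dist_eq (s := G.dist z x - 1) (a := z) (v := x) (by omega)
  refine ⟨u, hu.symm, ?_⟩
  show G.dist x z = G.dist u z + 1
  rw [G.dist_comm, G.dist_comm (u := u)]
  omega

/-- A branch at `x` is a connected component of the complement of `x`. -/
theorem IsTree.mem_branch_of_adj (hG : G.IsTree) {x u t z : V} (hu : G.Adj x u)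
    (ht : t ∈ G.branch x u) (htz : G.Adj t z) (hz : z ≠ x) : z ∈ G.branch x u := by
  rcases hG.mem_branch_or hu z with h | h
  · exact h
  exfalso
  have ht : G.dist x t = G.dist u t + 1 := ht
  have h : G.dist u z = G.dist x z + 1 := h
  have h1 := hG.dist_eq_dist_add_one_of_adj x htz
  have h2 := hG.dist_eq_dist_add_one_of_adj u htz
  obtain ⟨y, hy, hyz⟩ := hG.connected.exists_mem_branch hz
  have hyz : G.dist x z = G.dist y z + 1 := hyz
  have h3 := hG.dist_eq_dist_add_one_of_adj y htz
  have h4 := hG.dist_eq_dist_add_one_of_adj t hy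
  rw [G.dist_comm (u := t), G.dist_comm (u := t)] at h4
  have : y = u := hG.eq_of_dist_eq hy hu (z := t) (by omega) ht
  subst this
  omega

theorem Connected.branch_subset_component (hG : G.Connected) {x u : V} (hu : G.Adj x u)
    {K : Set V} (hK : ∀ z, z ∈ K → z = x) {C : G.ComponentCompl K} (huC : u ∈ C) :
    G.branch x u ⊆ C.supp := by
  have : ∀ n z, G.dist u z = n → z ∈ G.branch x u → z ∈ C := by
    intro n
    induction n with
    | zero =>
      intro z hz _
      rwa [← hG.dist_eq_zero_iff.1 hz]
    | succ n ih =>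
      intro z hz hzb
      obtain ⟨t, htz, ht⟩ := hG.exists_adj_dist_eq hz
      have hzb' : G.dist x z = G.dist u z + 1 := hzb
      have htb : t ∈ G.branch x u := by
        show G.dist x t = G.dist u t + 1
        have h1 : G.dist x z ≤ G.dist x t + G.dist t z := hG.dist_triangle
        have h2 : G.dist x t ≤ G.dist x u + G.dist u t := hG.dist_triangle
        rw [dist_eq_one_iff_adj.2 htz] at h1
        rw [dist_eq_one_iff_adj.2 hu] at h2
        omega
      refine ComponentCompl.mem_of_adj t z (ih t ht htb) ?_ htz
      intro hzK
      obtain rfl := hK z hzK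
      exact left_notMem_branch _ _ hzb
  exact fun z hz => this _ z rfl hz

theorem IsTree.component_subset_branch (hG : G.IsTree) {x u : V} (hu : G.Adj x u)
    {K : Set V} (hK : x ∈ K) {C : G.ComponentCompl K} (huC : u ∈ C) : C.supp ⊆ G.branch x u := by
  obtain ⟨hu0, rfl⟩ := huC
  have : ∀ a b : (Kᶜ : Set V), (G.induce Kᶜ).Reachable a b →
      (a : V) ∈ G.branch x u → (b : V) ∈ G.branch x u := by
    rintro a b ⟨p⟩
    induction p with
    | nil => exact id
    | @cons a b c hab p ih =>
      exact fun ha => ih (hG.mem_branch_of_adj hu ha hab fun hbx => b.2 (hbx ▸ hK))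
  rintro z ⟨hz, hzC⟩
  exact this ⟨u, hu0⟩ ⟨z, hz⟩ (ConnectedComponent.exact hzC).symm (right_mem_branch hu)

/-- Every infinite component of the complement of a finite set contains an end. -/
theorem exists_end_of_infinite (hG : G.Connected) (hfin : ∀ v, (G.neighborSet v).Finite)
    {K : Finset V} (C : G.ComponentCompl (K : Set V)) (hC : C.supp.Infinite) :
    ∃ e ∈ G.end, e (Opposite.op K) = C := by
  have : LocallyFinite G := fun v => (hfin v).fintype
  have : Fact G.Preconnected := ⟨hG.preconnected⟩
  have : Infinite V := Set.infinite_univ_iff.1 (hC.mono (Set.subset_univ _))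
  have hF : ∀ j, Finite (G.componentComplFunctor.obj j) := fun K => G.componentCompl_finite K.unop
  have hF' : ∀ j, Nonempty (G.componentComplFunctor.obj j) := fun K =>
    G.componentCompl_nonempty_of_infinite K.unop
  have hF'' : ∀ j, Finite (G.componentComplFunctor.toEventualRanges.obj j) :=
    CategoryTheory.Functor.toEventualRanges_finite _
  have hML : G.componentComplFunctor.IsMittagLeffler :=
    G.componentComplFunctor.isMittagLeffler_of_exists_finite_range fun j =>
      ⟨j, CategoryTheory.CategoryStruct.id j, Set.toFinite _⟩
  have hne : ∀ j, Nonempty (G.componentComplFunctor.toEventualRanges.obj j) :=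
    G.componentComplFunctor.toEventualRanges_nonempty hML
  -- The components of complements of finite sets form an inverse system of finite sets. Infinite
  -- components are those in the eventual ranges, where the transition maps are surjective, so `C`
  -- extends to a section.
  have hCe := (infinite_iff_in_eventualRange G (K := Opposite.op K) C).1 hC
  obtain ⟨s, hs⟩ := G.componentComplFunctor.toEventualRanges.eval_section_surjective_of_surjective
    (G.componentComplFunctor.surjective_toEventualRanges hML) (Opposite.op K) ⟨C, hCe⟩
  refine ⟨_, (G.componentComplFunctor.toEventualRangesSectionsEquiv s).2, ?_⟩
  exact congrArg Subtype.val hs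

end SimpleGraph

namespace IsOneEndedTree

open SimpleGraph

variable {V : Type} {G : SimpleGraph V}

theorem infinite (h : IsOneEndedTree G) : Infinite V := by
  rw [← not_finite_iff_infinite]
  intro hf
  obtain ⟨e, he, -⟩ := h.2
  exact IsEmpty.false (⟨e, he⟩ : G.end)

/-- An infinite branch at `x` contains an end. Different branches are different components of the
complement of `x`, so two infinite ones would give two ends. -/
theorem towardsEnd_unique (h : IsOneEndedTree G) (hfin : ∀ v, (G.neighborSet v).Finite)
    {x u w : V} (hu : G.TowardsEnd x u) (hw : G.TowardsEnd x w) : u = w := by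
  have hx : ∀ {a}, G.Adj x a → a ∉ (({x} : Finset V) : Set V) := fun ha => by
    simpa using ha.ne'
  have key : ∀ {a}, (ha : G.TowardsEnd x a) →
      ∃ e ∈ G.end, e (Opposite.op {x}) = G.componentComplMk (hx ha.1) := fun {a} ha => by
    refine exists_end_of_infinite h.1.connected hfin _ (ha.2.mono ?_)
    exact h.1.connected.branch_subset_component ha.1 (by simp) (G.componentComplMk_mem (hx ha.1))
  obtain ⟨e, he, heu⟩ := key hu
  obtain ⟨e', he', hew⟩ := key hw
  obtain rfl := h.2.unique he he'
  have hwC := G.componentComplMk_mem (hx hw.1)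
  rw [← hew, heu] at hwC
  have hb : w ∈ G.branch x u := h.1.component_subset_branch hu.1 (by simp)
    (G.componentComplMk_mem (hx hu.1)) hwC
  have hb : G.dist x w = G.dist u w + 1 := hb
  rw [dist_eq_one_iff_adj.2 hw.1] at hb
  exact h.1.connected.dist_eq_zero_iff.1 (by omega)

theorem univ_subset_iUnion_branch (h : IsOneEndedTree G) (x : V) :
    (Set.univ : Set V) ⊆ {x} ∪ ⋃ u ∈ G.neighborSet x, G.branch x u := fun z _ => by
  by_cases hz : z = x
  · exact Or.inl hz
  · obtain ⟨u, hu, hzu⟩ := h.1.connected.exists_mem_branch hz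
    exact Or.inr (Set.mem_biUnion hu hzu)

theorem exists_towardsEnd (h : IsOneEndedTree G) (hfin : ∀ v, (G.neighborSet v).Finite) (x : V) :
    ∃ u, G.TowardsEnd x u := by
  by_contra hcon
  push Not at hcon
  have := h.infinite
  refine Set.infinite_univ (((Set.finite_singleton x).union
    ((hfin x).biUnion fun u hu => ?_)).subset (h.univ_subset_iUnion_branch x))
  by_contra hinf
  exact hcon u ⟨hu, hinf⟩

/-- What lies behind `x`, seen from `u`, consists of `x` and its other branches. These are finitely
many, and finite by uniqueness. -/
theorem finite_branch (h : IsOneEndedTree G) (hfin : ∀ v, (G.neighborSet v).Finite) {x u : V}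
    (hxu : G.TowardsEnd x u) : (G.branch u x).Finite := by
  classical
  by_contra hinf
  refine hinf (((Set.finite_singleton x).union
    ((hfin x).biUnion (t := fun w => if w = u then ∅ else G.branch x w) fun w hw => ?_)).subset
    fun z hz => ?_)
  · split_ifs with hwu
    · exact Set.finite_empty
    · by_contra hw'
      exact hwu (h.towardsEnd_unique hfin ⟨hw, hw'⟩ hxu)
  · rcases h.univ_subset_iUnion_branch x (Set.mem_univ z) with h1 | h1
    · exact Or.inl h1
    · obtain ⟨w, hw, hzw⟩ := Set.mem_iUnion₂.1 h1
      refine Or.inr (Set.mem_biUnion hw ?_)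
      have : w ≠ u := by
        rintro rfl
        exact notMem_branch_of_mem hz hzw
      simpa [this] using hzw

theorem branch_ssubset (h : IsOneEndedTree G) (hfin : ∀ v, (G.neighborSet v).Finite) {x u w : V}
    (hxu : G.TowardsEnd x u) (huw : G.TowardsEnd u w) : G.branch u w ⊆ G.branch x u := by
  intro z hz
  rcases h.1.mem_branch_or hxu.1 z with h1 | h1
  · exact h1
  · have : w = x := h.1.eq_of_dist_eq huw.1 hxu.1.symm hz h1
    subst this
    exact absurd (h.finite_branch hfin hxu) huw.2

theorem branch_subset_of_le (h : IsOneEndedTree G) (hfin : ∀ v, (G.neighborSet v).Finite)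
    {x v u w : V} (hxv : G.EndLE x v) (hx : G.TowardsEnd x u) (hv : G.TowardsEnd v w) :
    G.branch v w ⊆ G.branch x u := by
  induction hxv using Relation.ReflTransGen.head_induction_on generalizing u with
  | refl => rw [h.towardsEnd_unique hfin hx hv]
  | @head a b hab _ ih =>
    obtain rfl := h.towardsEnd_unique hfin hx hab
    obtain ⟨c, hc⟩ := h.exists_towardsEnd hfin u
    exact (ih hc).trans (h.branch_ssubset hfin hx hc)

theorem comparable_of_adj (h : IsOneEndedTree G) {x y : V} (hxy : G.Adj x y) :
    G.TowardsEnd x y ∨ G.TowardsEnd y x := by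
  have := h.infinite
  by_contra hcon
  push Not at hcon
  refine Set.infinite_univ (α := V) (((Set.not_infinite.1 fun hi => hcon.1 ⟨hxy, hi⟩).union
    (Set.not_infinite.1 fun hi => hcon.2 ⟨hxy.symm, hi⟩)).subset
    fun z _ => h.1.mem_branch_or hxy z)

/-- The branch towards infinity shrinks along the order and never contains a vertex already passed.
This gives antisymmetry, and it places the descendants of `v` in the finite complement of its
infinite branch. -/
theorem isAncestorOrder (h : IsOneEndedTree G) (hfin : ∀ v, (G.neighborSet v).Finite) :
    IsAncestorOrder G.EndLE := by
  have hne : ∀ {x y}, G.EndLE x y → x ≠ y → ∃ u, G.TowardsEnd x u ∧ G.EndLE u y := by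
    intro x y hxy hn
    rcases Relation.ReflTransGen.cases_head hxy with h1 | h1
    · exact absurd h1 hn
    · exact h1
  have htot : ∀ {x y z}, G.EndLE x y → G.EndLE x z → G.EndLE y z ∨ G.EndLE z y :=
    fun hy hz => Relation.ReflTransGen.total_of_right_unique
      (fun _ _ _ h1 h2 => h.towardsEnd_unique hfin h1 h2) hy hz
  have hnotmem : ∀ {x y w}, G.EndLE x y → G.TowardsEnd y w → x ∉ G.branch y w := by
    intro x y w hxy hyw hx
    obtain ⟨u, hu⟩ := h.exists_towardsEnd hfin x
    exact left_notMem_branch x u (h.branch_subset_of_le hfin hxy hu hyw hx)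
  refine ⟨fun _ => .refl, fun h1 h2 => h1.trans h2, ?_, htot, fun v => ?_, fun x y => ?_,
    fun x => ?_⟩
  · intro x y hxy hyx
    by_contra hn
    obtain ⟨u, hu, huy⟩ := hne hxy hn
    exact hnotmem (huy.trans hyx) hu (right_mem_branch hu.1)
  · obtain ⟨w, hw⟩ := h.exists_towardsEnd hfin v
    refine (h.finite_branch hfin hw).subset fun x hx => ?_
    exact (h.1.mem_branch_or hw.1 x).resolve_left (hnotmem hx hw)
  · obtain ⟨p⟩ := h.1.connected x y
    induction p with
    | nil => exact ⟨_, .refl, .refl⟩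
    | @cons x a y hxa p ih =>
      obtain ⟨z, haz, hyz⟩ := ih
      rcases h.comparable_of_adj hxa with h1 | h1
      · exact ⟨z, .head h1 haz, hyz⟩
      · rcases htot (.single h1) haz with h2 | h2
        · exact ⟨z, h2, hyz⟩
        · exact ⟨x, .refl, hyz.trans h2⟩
  · obtain ⟨u, hu⟩ := h.exists_towardsEnd hfin x
    exact ⟨u, .single hu, hu.1.ne'⟩

end IsOneEndedTree

/-- A set of vertices induces a connected graph if any two of its elements have a common ancestor
up to which all their ancestors lie in the set. -/
theorem SimpleGraph.connected_induce_of_endLE {V : Type*} {G : SimpleGraph V} {A : Set V}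
    (hne : A.Nonempty)
    (hA : ∀ x ∈ A, ∀ y ∈ A, ∃ z, G.EndLE x z ∧ G.EndLE y z ∧
      ∀ t, (G.EndLE x t ∨ G.EndLE y t) → G.EndLE t z → t ∈ A) : (G.induce A).Connected := by
  have up : ∀ x z, G.EndLE x z → (∀ t, G.EndLE x t → G.EndLE t z → t ∈ A) →
      ∀ (hx : x ∈ A) (hz : z ∈ A), (G.induce A).Reachable ⟨x, hx⟩ ⟨z, hz⟩ := by
    intro x z hxz
    induction hxz using Relation.ReflTransGen.head_induction_on with
    | refl => exact fun _ _ _ => SimpleGraph.Reachable.refl _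
    | @head a b hab hbz ih =>
      intro hA' ha hz
      have hb : b ∈ A := hA' b (.single hab) hbz
      have hadj : (G.induce A).Adj ⟨a, ha⟩ ⟨b, hb⟩ := hab.1
      exact hadj.reachable.trans (ih (fun t hbt => hA' t (.head hab hbt)) hb hz)
  have : Nonempty A := hne.to_subtype
  refine ⟨fun ⟨x, hx⟩ ⟨y, hy⟩ => ?_⟩
  obtain ⟨z, hxz, hyz, hz⟩ := hA x hx y hy
  have hzA : z ∈ A := hz z (Or.inl hxz) .refl
  exact (up x z hxz (fun t h1 => hz t (Or.inl h1)) hx hzA).trans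
    (up y z hyz (fun t h1 => hz t (Or.inr h1)) hy hzA).symm

/-! ### The pruning procedure. -/

/-- The numerical data of the pruning procedure. At stage `k` one looks at maximal subtrees with a
size `s ∈ sizes k`, and prunes them to `2 ^ expo s` vertices, except for a proportion of about
`θ k` of them. The density of what is left is at least `α k` before the stage, and `β k` in the
pruned subtrees. -/
structure PruningScheme where
  sizes : ℕ → Set ℕ
  expo : ℕ → ℕ
  lo : ℕ → ℕ
  hi : ℕ → ℕ
  α : ℕ → ℝ
  β : ℕ → ℝ
  θ : ℕ → ℝ
  lo_le : ∀ {k s}, s ∈ sizes k → lo k ≤ s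
  le_hi : ∀ {k s}, s ∈ sizes k → s ≤ hi k
  lo_le_hi : ∀ k, lo k ≤ hi k
  lo_pos : ∀ k, 0 < lo k
  hi_le : ∀ k, (hi k : ℝ) ≤ θ k * lo (k + 1)
  θ_pos : ∀ k, 0 < θ k
  θ_lt : ∀ k, θ k < 1
  le_expo : ∀ {k s}, s ∈ sizes k → β k * s ≤ 2 ^ expo s
  expo_le : ∀ {k s}, s ∈ sizes k → (2 ^ expo s : ℝ) ≤ α k * s
  expo_lt : ∀ {j k s t}, j < k → s ∈ sizes j → t ∈ sizes k → expo s < expo t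
  α_zero : α 0 ≤ 1
  α_succ : ∀ k, α (k + 1) ≤ β k + θ k * (α k - β k)
  β_le_α : ∀ k, β k ≤ α k
  le_β : ∀ k, 1 / 8 ≤ β k

section Definitions

variable {V : Type*} (le : V → V → Prop) (lab : V → unitInterval) (P : PruningScheme)

/-- The number of descendants of `v`. -/
def treeSize (v : V) : ℕ := {x | le x v}.ncard

/-- `v` is maximal among the vertices whose number of descendants lies in `S`. -/
def IsTopVertex (S : Set ℕ) (v : V) : Prop :=
  treeSize le v ∈ S ∧ ∀ u, le v u → treeSize le u ∈ S → u = v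

/-- The label of the vertex of `W` above `x` (infinite if there is none). -/
def blockLabel (W : V → Prop) (x : V) : ℝ≥0∞ :=
  ⨅ v, ⨅ _ : W v ∧ le x v, ENNReal.ofReal (lab v)

/-- The sorting key for the order in which vertices are pruned. -/
def pruneKey (W : V → Prop) (x : V) : ℝ≥0∞ ×ₗ (ℕ ×ₗ unitInterval) :=
  toLex (blockLabel le lab W x, toLex (treeSize le x, lab x))

/-- `v` is one of the vertices whose subtree gets pruned at stage `k`. -/
def IsActive (k : ℕ) (v : V) : Prop :=
  ∃ w, IsTopVertex le (P.sizes (k + 1)) w ∧ le v w ∧ P.θ k * treeSize le w ≤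
    {y | le y w ∧ blockLabel le lab (IsTopVertex le (P.sizes k)) y < ENNReal.ofReal (lab v)}.ncard

/-- The tops of the previous stage. -/
def previousTop : ℕ → V → Prop
  | 0 => fun _ => False
  | k + 1 => IsTopVertex le (P.sizes k)

/-- The vertices that survive the stages before `k`. -/
def Kept : ℕ → V → Prop
  | 0 => fun _ => True
  | k + 1 => fun x => Kept k x ∧ ∀ v, IsTopVertex le (P.sizes k) v → le x v →
      IsActive le lab P k v → {y | le y v ∧ Kept k y ∧ pruneKey le lab (previousTop le P k) x <
        pruneKey le lab (previousTop le P k) y}.ncard < 2 ^ P.expo (treeSize le v)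

/-- Stage `k + 1` removes a part of what stage `k` left of the subtree of `v`, but not all. -/
def IsCut (k : ℕ) (v : V) : Prop :=
  ∃ x y, le x v ∧ le y v ∧ Kept le lab P (k + 2) x ∧ Kept le lab P (k + 1) y ∧
    ¬ Kept le lab P (k + 2) y

/-- `x` lies in a subtree that is pruned at stage `k` and not cut at the next stage. -/
def IsGoodAt (k : ℕ) (x : V) : Prop :=
  ∃ v, IsTopVertex le (P.sizes k) v ∧ le x v ∧ IsActive le lab P k v ∧ ¬ IsCut le lab P k v

/-- `x` lies in a subtree of stage `k` nothing of which survives the next stage. -/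
def IsRemovedAt (k : ℕ) (x : V) : Prop :=
  ∃ v, IsTopVertex le (P.sizes k) v ∧ le x v ∧ ∀ y, le y v → ¬ Kept le lab P (k + 2) y

end Definitions

/-- The number of elements with larger key takes each value below `A.card` exactly once, so the
condition selects the `m` elements with the largest keys. -/
theorem Finset.card_filter_card_lt {V L : Type*} [LinearOrder L] (A : Finset V) (f : V → L)
    (hf : Set.InjOn f A) {m : ℕ} (hm : m ≤ A.card) :
    (A.filter fun x => (A.filter fun y => f x < f y).card < m).card = m := by
  set r : V → ℕ := fun x => (A.filter fun y => f x < f y).card with hr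
  have hlt : ∀ x ∈ A, ∀ y ∈ A, f x < f y → r y < r x := fun x _ y hy hxy => by
    refine Finset.card_lt_card ⟨fun z hz => ?_, fun hsub => ?_⟩
    · rw [Finset.mem_filter] at hz ⊢
      exact ⟨hz.1, hxy.trans hz.2⟩
    · have := hsub (Finset.mem_filter.2 ⟨hy, hxy⟩)
      exact lt_irrefl _ (Finset.mem_filter.1 this).2
  have hinj : Set.InjOn r A := fun x hx y hy hxy => by
    refine hf hx hy (le_antisymm (not_lt.1 fun h => ?_) (not_lt.1 fun h => ?_))
    · exact (hlt y hy x hx h).ne hxy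
    · exact (hlt x hx y hy h).ne hxy.symm
  have hmaps : A.image r ⊆ Finset.range A.card := fun n hn => by
    obtain ⟨x, hx, rfl⟩ := Finset.mem_image.1 hn
    refine Finset.mem_range.2 (Finset.card_lt_card ⟨Finset.filter_subset _ _, fun hsub => ?_⟩)
    exact lt_irrefl _ (Finset.mem_filter.1 (hsub hx)).2
  have himg : A.image r = Finset.range A.card :=
    Finset.eq_of_subset_of_card_le hmaps (by
      rw [Finset.card_range, Finset.card_image_of_injOn hinj])
  have : (A.filter fun x => r x < m).image r = Finset.range m := by
    ext n
    simp only [Finset.mem_image, Finset.mem_filter, Finset.mem_range]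
    constructor
    · rintro ⟨x, ⟨_, hx⟩, rfl⟩
      exact hx
    · intro hn
      have : n ∈ A.image r := by rw [himg]; exact Finset.mem_range.2 (hn.trans_le hm)
      obtain ⟨x, hx, rfl⟩ := Finset.mem_image.1 this
      exact ⟨x, ⟨hx, hn⟩, rfl⟩
  rw [← Finset.card_image_of_injOn (hinj.mono fun x hx => (Finset.mem_filter.1 hx).1), this,
    Finset.card_range]

/-! ### Blocks, keys and densities for a fixed labelling. -/

namespace PruningScheme

variable (P : PruningScheme)

theorem hi_lt_lo_succ (k : ℕ) : P.hi k < P.lo (k + 1) := by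
  have h0 : (0 : ℝ) < P.lo (k + 1) := by exact_mod_cast P.lo_pos _
  have h1 := P.hi_le k
  have h2 := P.θ_lt k
  have : (P.hi k : ℝ) < P.lo (k + 1) := by nlinarith
  exact_mod_cast this

theorem lo_strictMono : StrictMono P.lo :=
  strictMono_nat_of_lt_succ fun k => (P.lo_le_hi k).trans_lt (P.hi_lt_lo_succ k)

theorem hi_lt_lo {j k : ℕ} (h : j < k) : P.hi j < P.lo k :=
  (P.hi_lt_lo_succ j).trans_le (P.lo_strictMono.monotone h)

end PruningScheme

namespace IsAncestorOrder

open Classical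

variable {V : Type*} {le : V → V → Prop} (h : IsAncestorOrder le)
include h

theorem treeSize_lt {x y : V} (hxy : le x y) (hne : x ≠ y) : treeSize le x < treeSize le y :=
  Set.ncard_lt_ncard ⟨fun _ hz => h.trans hz hxy, fun hsub =>
    hne (h.antisymm hxy (hsub (h.refl y)))⟩ (h.finite y)

theorem treeSize_pos (x : V) : 0 < treeSize le x :=
  (Set.ncard_pos (h.finite x)).2 ⟨x, h.refl x⟩

theorem exists_le_treeSize (x : V) (n : ℕ) : ∃ v, le x v ∧ n ≤ treeSize le v := by
  induction n with
  | zero => exact ⟨x, h.refl x, Nat.zero_le _⟩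
  | succ n ih =>
    obtain ⟨v, hxv, hv⟩ := ih
    obtain ⟨w, hvw, hne⟩ := h.unbounded v
    exact ⟨w, h.trans hxv hvw, hv.trans_lt (h.treeSize_lt hvw hne.symm)⟩

theorem le_of_treeSize_le {x v w : V} (hv : le x v) (hw : le x w)
    (hs : treeSize le v ≤ treeSize le w) : le v w := by
  rcases h.total hv hw with h1 | h1
  · exact h1
  · by_cases hne : w = v
    · exact hne ▸ h.refl _
    · exact absurd (h.treeSize_lt h1 hne) (not_lt.2 hs)

theorem isTop_unique {S : Set ℕ} {x v w : V} (hv : IsTopVertex le S v) (hw : IsTopVertex le S w)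
    (hxv : le x v) (hxw : le x w) : v = w := by
  rcases h.total hxv hxw with h1 | h1
  · exact (hv.2 w h1 hw.1).symm
  · exact hw.2 v h1 hv.1

omit h in
-- The blocks of `W` are disjoint, so an inequality on each block adds up over the part of `F` that
-- they cover.
theorem _root_.Finset.sum_le_sum_of_blocks {W : V → Prop}
    (hW : ∀ {x v w}, W v → W w → le x v → le x w → v = w) (F : Finset V) (f g : V → ℝ)
    (hfg : ∀ w, W w → (∃ x ∈ F, le x w) →
      ∑ x ∈ F with le x w, f x ≤ ∑ x ∈ F with le x w, g x) :
    ∑ x ∈ F with ∃ w, W w ∧ le x w, f x ≤ ∑ x ∈ F with ∃ w, W w ∧ le x w, g x := by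
  set F' := F.filter fun x => ∃ w, W w ∧ le x w with hF'
  set τ : V → V := fun x => if hx : ∃ w, W w ∧ le x w then hx.choose else x with hτ
  have hτs : ∀ x ∈ F', W (τ x) ∧ le x (τ x) := fun x hx => by
    have hx := (Finset.mem_filter.1 hx).2
    simp only [hτ, dif_pos hx]
    exact hx.choose_spec
  have hmaps : ∀ x ∈ F', τ x ∈ F'.image τ := fun x hx => Finset.mem_image_of_mem _ hx
  rw [← Finset.sum_fiberwise_of_maps_to hmaps, ← Finset.sum_fiberwise_of_maps_to hmaps]
  refine Finset.sum_le_sum fun w hw => ?_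
  obtain ⟨x, hx, rfl⟩ := Finset.mem_image.1 hw
  have hfil : (F'.filter fun y => τ y = τ x) = F.filter fun y => le y (τ x) := by
    ext y
    constructor
    · intro hy
      obtain ⟨hy, e⟩ := Finset.mem_filter.1 hy
      exact Finset.mem_filter.2 ⟨(Finset.mem_filter.1 hy).1, e ▸ (hτs y hy).2⟩
    · intro hy
      obtain ⟨hy, e⟩ := Finset.mem_filter.1 hy
      have hyF : y ∈ F' := Finset.mem_filter.2 ⟨hy, _, (hτs x hx).1, e⟩
      exact Finset.mem_filter.2 ⟨hyF, hW (hτs y hyF).1 (hτs x hx).1 (hτs y hyF).2 e⟩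
  rw [hfil]
  exact hfg _ (hτs x hx).1 ⟨x, (Finset.mem_filter.1 hx).1, (hτs x hx).2⟩

variable {lab : V → unitInterval} {P : PruningScheme}

/-- Blocks of different stages are nested or disjoint, because the ancestors of `x` are ordered by
size and later windows contain larger sizes. -/
theorem isTop_le {j k : ℕ} (hjk : j ≤ k) {x v w : V} (hv : IsTopVertex le (P.sizes j) v)
    (hw : IsTopVertex le (P.sizes k) w) (hxv : le x v) (hxw : le x w) : le v w := by
  rcases hjk.eq_or_lt with rfl | hlt
  · rw [h.isTop_unique hv hw hxv hxw]; exact h.refl _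
  · exact h.le_of_treeSize_le hxv hxw
      ((P.le_hi hv.1).trans ((P.hi_lt_lo hlt).le.trans (P.lo_le hw.1)))

theorem blockLabel_mono (W : V → Prop) {x y : V} (hxy : le x y) :
    blockLabel le lab W x ≤ blockLabel le lab W y :=
  le_iInf fun v => le_iInf fun hv => iInf_le_of_le v (iInf_le_of_le ⟨hv.1, h.trans hxy hv.2⟩ le_rfl)

theorem blockLabel_eq {S : Set ℕ} {x v : V} (hv : IsTopVertex le S v) (hxv : le x v) :
    blockLabel le lab (IsTopVertex le S) x = ENNReal.ofReal (lab v) := by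
  refine le_antisymm (iInf_le_of_le v (iInf_le_of_le ⟨hv, hxv⟩ le_rfl)) ?_
  refine le_iInf fun w => le_iInf fun hw => ?_
  rw [h.isTop_unique hv hw.1 hxv hw.2]

/-- Moving up can only lose tops above, which raises the infimum of labels (to infinity where there
are none), and it increases the number of descendants. -/
theorem pruneKey_mono (W : V → Prop) {x y : V} (hxy : le x y) :
    pruneKey le lab W x ≤ pruneKey le lab W y := by
  by_cases hne : x = y
  · rw [hne]
  have h1 := h.blockLabel_mono (lab := lab) W hxy
  have h2 := h.treeSize_lt hxy hne
  simp only [pruneKey, Prod.Lex.toLex_le_toLex]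
  rcases h1.lt_or_eq with h1 | h1
  · exact Or.inl h1
  · exact Or.inr ⟨h1, Or.inl h2⟩

omit h in
theorem _root_.pruneKey_injective (hl : Function.Injective lab) (W : V → Prop) :
    Function.Injective (pruneKey le lab W) := fun x y e => by
  simp only [pruneKey, EmbeddingLike.apply_eq_iff_eq, Prod.mk.injEq] at e
  exact hl e.2.2

omit h in
theorem _root_.Kept.of_succ {k : ℕ} {x : V} (hx : Kept le lab P (k + 1) x) : Kept le lab P k x :=
  hx.1

omit h in
theorem _root_.Kept.of_le {j k : ℕ} (hjk : j ≤ k) {x : V} (hx : Kept le lab P k x) :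
    Kept le lab P j x := by
  induction hjk with
  | refl => exact hx
  | step _ ih => exact ih hx.of_succ

/-- An ancestor has fewer competitors with a larger key, and each top above it is also above `x`.
This closure under ancestors is what yields connectedness. -/
theorem kept_of_le {k : ℕ} : ∀ {x y : V}, Kept le lab P k x → le x y → Kept le lab P k y := by
  induction k with
  | zero => exact fun _ _ => trivial
  | succ k ih =>
    intro x y hx hxy
    refine ⟨ih hx.1 hxy, fun v hv hyv hact => ?_⟩
    refine lt_of_le_of_lt (Set.ncard_le_ncard (fun z hz => ?_) ?_) (hx.2 v hv (h.trans hxy hyv) hact)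
    · exact ⟨hz.1, hz.2.1, (h.pruneKey_mono _ hxy).trans_lt hz.2.2⟩
    · exact (h.finite v).subset fun z hz => hz.1

/-- An active subtree is pruned to the prescribed size. -/
theorem ncard_kept_of_isActive (hl : Function.Injective lab) {k : ℕ} {v : V}
    (hv : IsTopVertex le (P.sizes k) v) (hact : IsActive le lab P k v)
    (hm : 2 ^ P.expo (treeSize le v) ≤ {x | le x v ∧ Kept le lab P k x}.ncard) :
    {x | le x v ∧ Kept le lab P (k + 1) x}.ncard = 2 ^ P.expo (treeSize le v) := by
  have hfin : {x | le x v ∧ Kept le lab P k x}.Finite := (h.finite v).subset fun x hx => hx.1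
  set A := hfin.toFinset with hA
  set f := pruneKey le lab (previousTop le P k)
  rw [Set.ncard_eq_toFinset_card _ hfin] at hm
  rw [← Finset.card_filter_card_lt A f (pruneKey_injective hl _).injOn hm, ← Set.ncard_coe_finset]
  congr 1
  have hAm : ∀ y, y ∈ A ↔ le y v ∧ Kept le lab P k y := fun y => by simp [hA]
  have e : ∀ x, (A.filter fun y => f x < f y).card =
      {y | le y v ∧ Kept le lab P k y ∧ f x < f y}.ncard := fun x => by
    rw [← Set.ncard_coe_finset]
    congr 1
    ext y
    simp [hAm, and_assoc]
  ext x
  simp only [Finset.coe_filter, e, hAm]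
  constructor
  · rintro ⟨hxv, hx⟩
    exact ⟨⟨hxv, hx.1⟩, hx.2 v hv hxv hact⟩
  · rintro ⟨⟨hxv, hx⟩, hlt⟩
    refine ⟨hxv, hx, fun w hw hxw _ => ?_⟩
    rwa [← h.isTop_unique hv hw hxv hxw]

omit h in
theorem _root_.Kept.succ_of_not_isActive {k : ℕ} {x : V} (hx : Kept le lab P k x)
    (hn : ∀ v, IsTopVertex le (P.sizes k) v → le x v → ¬ IsActive le lab P k v) :
    Kept le lab P (k + 1) x :=
  ⟨hx, fun v hv hxv ha => absurd ha (hn v hv hxv)⟩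

theorem le_top_of_isActive {k : ℕ} {x v w : V} (hv : IsActive le lab P k v) (hxv : le x v)
    (hw : IsTopVertex le (P.sizes (k + 1)) w) (hxw : le x w) : le v w ∧ P.θ k * treeSize le w ≤
    {y | le y w ∧ blockLabel le lab (IsTopVertex le (P.sizes k)) y <
      ENNReal.ofReal (lab v)}.ncard := by
  obtain ⟨w', hw', hvw', hle⟩ := hv
  obtain rfl := h.isTop_unique hw' hw (h.trans hxv hvw') hxw
  exact ⟨hvw', hle⟩

/-- At most a proportion `1 - θ k` of a subtree of stage `k + 1` is pruned at stage `k`. -/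
theorem ncard_active_le {k : ℕ} {w : V} (hw : IsTopVertex le (P.sizes (k + 1)) w) :
    ({x | le x w ∧ ∃ v, IsTopVertex le (P.sizes k) v ∧ IsActive le lab P k v ∧ le x v}.ncard : ℝ) ≤
      (1 - P.θ k) * treeSize le w := by
  set A := {x | le x w ∧ ∃ v, IsTopVertex le (P.sizes k) v ∧ IsActive le lab P k v ∧ le x v} with hA
  have hAfin : A.Finite := (h.finite w).subset fun x hx => hx.1
  rcases A.eq_empty_or_nonempty with hAe | hAne
  · rw [hAe, Set.ncard_empty]
    have := P.θ_lt k
    have : (0 : ℝ) ≤ treeSize le w := by positivity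
    push_cast
    nlinarith
  -- For the active block with the smallest label, all vertices with smaller block label are outside
  -- active blocks, and being active means that there are at least `θ k * treeSize w` of them.
  obtain ⟨x₀, hx₀, hmin⟩ := Set.exists_min_image A
    (fun x => blockLabel le lab (IsTopVertex le (P.sizes k)) x) hAfin hAne
  obtain ⟨hx₀w, v₀, hv₀, hact, hx₀v₀⟩ := hx₀
  have hθ := (h.le_top_of_isActive hact hx₀v₀ hw hx₀w).2
  rw [← h.blockLabel_eq hv₀ hx₀v₀] at hθ
  set B := {y | le y w ∧ blockLabel le lab (IsTopVertex le (P.sizes k)) y <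
    blockLabel le lab (IsTopVertex le (P.sizes k)) x₀} with hB
  have hBfin : B.Finite := (h.finite w).subset fun x hx => hx.1
  have hdisj : Disjoint A B := Set.disjoint_left.2 fun x hxA hxB => not_lt.2 (hmin x hxA) hxB.2
  have hle : (A ∪ B).ncard ≤ treeSize le w :=
    Set.ncard_le_ncard (Set.union_subset (fun x hx => hx.1) fun x hx => hx.1) (h.finite w)
  rw [Set.ncard_union_eq hdisj hAfin hBfin] at hle
  have : (A.ncard : ℝ) + B.ncard ≤ treeSize le w := by exact_mod_cast hle
  linarith

/-- Little more than a proportion `θ k` of a subtree of stage `k + 1` lies in subtrees of stage `k`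
that are not pruned at that stage. -/
theorem ncard_passive_le (hl : Function.Injective lab) {k : ℕ} {w : V}
    (hw : IsTopVertex le (P.sizes (k + 1)) w) :
    ({x | le x w ∧ ∃ v, IsTopVertex le (P.sizes k) v ∧ ¬ IsActive le lab P k v ∧
      le x v}.ncard : ℝ) ≤
      2 * P.θ k * treeSize le w := by
  set A := {x | le x w ∧ ∃ v, IsTopVertex le (P.sizes k) v ∧ ¬ IsActive le lab P k v ∧
    le x v} with hA
  have hAfin : A.Finite := (h.finite w).subset fun x hx => hx.1
  have hθ := P.θ_pos k
  rcases A.eq_empty_or_nonempty with hAe | hAne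
  · rw [hAe, Set.ncard_empty]
    push_cast
    positivity
  -- All other unpruned blocks have smaller labels than the one with the largest label, so together
  -- they take up less than `θ k * treeSize w`. That last block has at most `hi k ≤ θ k * lo (k +
  -- 1)` vertices, whence the factor 2.
  obtain ⟨x₀, hx₀, hmax⟩ := Set.exists_max_image A
    (fun x => blockLabel le lab (IsTopVertex le (P.sizes k)) x) hAfin hAne
  obtain ⟨hx₀w, v₀, hv₀, hact, hx₀v₀⟩ := hx₀
  have hv₀w : le v₀ w := h.isTop_le (Nat.le_succ k) hv₀ hw hx₀v₀ hx₀w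
  have hlt : ({y | le y w ∧ blockLabel le lab (IsTopVertex le (P.sizes k)) y <
      ENNReal.ofReal (lab v₀)}.ncard : ℝ) < P.θ k * treeSize le w := by
    by_contra hcon
    exact hact ⟨w, hw, hv₀w, not_lt.1 hcon⟩
  set B := {y | le y w ∧ blockLabel le lab (IsTopVertex le (P.sizes k)) y < ENNReal.ofReal (lab v₀)}
  have hBfin : B.Finite := (h.finite w).subset fun x hx => hx.1
  have hsub : A ⊆ B ∪ {x | le x v₀} := fun x hx => by
    have h1 := hmax x hx
    obtain ⟨hxw, v, hv, -, hxv⟩ := hx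
    rw [h.blockLabel_eq hv₀ hx₀v₀] at h1
    rcases h1.lt_or_eq with h2 | h2
    · exact Or.inl ⟨hxw, h2⟩
    · rw [h.blockLabel_eq hv hxv, ENNReal.ofReal_eq_ofReal_iff (lab v).2.1 (lab v₀).2.1] at h2
      have : v = v₀ := hl (Subtype.ext h2)
      exact Or.inr (this ▸ hxv)
  have h1 : A.ncard ≤ B.ncard + treeSize le v₀ :=
    (Set.ncard_le_ncard hsub (hBfin.union (h.finite v₀))).trans (Set.ncard_union_le _ _)
  have h2 : (A.ncard : ℝ) ≤ B.ncard + treeSize le v₀ := by exact_mod_cast h1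
  have h3 : (treeSize le v₀ : ℝ) ≤ P.hi k := by exact_mod_cast P.le_hi hv₀.1
  have h4 : (P.lo (k + 1) : ℝ) ≤ treeSize le w := by exact_mod_cast P.lo_le hw.1
  have h5 := P.hi_le k
  nlinarith

/-- The density of what is left is at least `α k` before stage `k`. -/
theorem le_card_kept (hl : Function.Injective lab) (k : ℕ) : ∀ F : Finset V,
    (∀ j ≤ k, ∀ v, IsTopVertex le (P.sizes j) v → ∀ x ∈ F, le x v → ∀ y, le y v → y ∈ F) →
      P.α k * F.card ≤ (F.filter (Kept le lab P k)).card := by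
  induction k with
  | zero =>
    intro F _
    rw [Finset.filter_true_of_mem (p := Kept le lab P 0) fun _ _ => trivial]
    have := P.α_zero
    have : (0 : ℝ) ≤ F.card := by positivity
    nlinarith
  | succ k ih =>
    intro F hF
    set a : V → Prop := fun x => ∃ v, (IsTopVertex le (P.sizes k) v ∧ IsActive le lab P k v) ∧ le x v
      with ha
    -- By induction at least `α k * treeSize v ≥ 2 ^ expo` vertices are left in an active block, so
    -- the pruning attains its target exactly.
    have hblock : ∀ v, IsTopVertex le (P.sizes k) v → IsActive le lab P k v →
        P.β k * treeSize le v ≤ {x | le x v ∧ Kept le lab P (k + 1) x}.ncard := by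
      intro v hv hact
      have h1 := ih (h.finite v).toFinset fun j hj u hu x hx hxu y hyu => by
        rw [Set.Finite.mem_toFinset] at hx ⊢
        exact h.trans hyu (h.isTop_le hj hu hv hxu hx)
      have e1 : ((h.finite v).toFinset.filter (Kept le lab P k)).card =
          {x | le x v ∧ Kept le lab P k x}.ncard := by
        rw [← Set.ncard_coe_finset]
        congr 1
        ext x
        simp
      rw [e1, ← Set.ncard_eq_toFinset_card _ (h.finite v)] at h1
      have h2 := P.expo_le hv.1
      have h3 : (2 ^ P.expo (treeSize le v) : ℝ) ≤ {x | le x v ∧ Kept le lab P k x}.ncard :=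
        h2.trans h1
      rw [h.ncard_kept_of_isActive hl hv hact (by exact_mod_cast h3)]
      exact_mod_cast P.le_expo hv.1
    have huniq : ∀ {x v w}, (IsTopVertex le (P.sizes k) v ∧ IsActive le lab P k v) →
        (IsTopVertex le (P.sizes k) w ∧ IsActive le lab P k w) → le x v → le x w → v = w :=
      fun hv hw => h.isTop_unique hv.1 hw.1
    have hD : ∀ j ≤ k + 1, ∀ v, IsTopVertex le (P.sizes j) v → (∃ x ∈ F, le x v) →
        ((F.filter fun x => le x v : Finset V) : Set V) = {x | le x v} := by
      rintro j hj v hv ⟨x, hx, hxv⟩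
      ext y
      simp only [Finset.coe_filter, Set.mem_ofPred_eq, and_iff_right_iff_imp]
      exact fun hy => hF j hj v hv x hx hxv y hy
    have hact : P.β k * (F.filter a).card ≤ ((F.filter a).filter (Kept le lab P (k + 1))).card := by
      have := Finset.sum_le_sum_of_blocks (le := le) huniq F (fun _ => P.β k)
        (fun x => if Kept le lab P (k + 1) x then 1 else 0) fun v hv hx => by
          have e := hD k (Nat.le_succ k) v hv.1 hx
          rw [Finset.sum_const, nsmul_eq_mul, Finset.sum_boole, ← Set.ncard_coe_finset, e, mul_comm]
          refine (hblock v hv.1 hv.2).trans (le_of_eq ?_)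
          rw [← Set.ncard_coe_finset, Finset.coe_filter]
          congr 2
          ext x
          have := Set.ext_iff.1 e x
          simp only [Finset.mem_coe] at this
          simp only [Set.mem_ofPred_eq, this]
      rw [Finset.sum_const, nsmul_eq_mul, Finset.sum_boole, mul_comm] at this
      exact this
    have hfrac : ((F.filter a).card : ℝ) ≤ (1 - P.θ k) * F.card := by
      have := Finset.sum_le_sum_of_blocks (le := le) (fun hv hw => h.isTop_unique hv hw) F
        (fun x => if a x then 1 else 0) (fun _ => 1 - P.θ k)
        (W := IsTopVertex le (P.sizes (k + 1))) fun w hw hx => by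
          have e := hD (k + 1) le_rfl w hw hx
          rw [Finset.sum_const, nsmul_eq_mul, Finset.sum_boole, ← Set.ncard_coe_finset,
            ← Set.ncard_coe_finset, e, mul_comm]
          refine le_trans (le_of_eq ?_) (h.ncard_active_le (lab := lab) hw)
          rw [Finset.coe_filter]
          congr 2
          ext x
          have := Set.ext_iff.1 e x
          simp only [Finset.mem_coe] at this
          simp only [Set.mem_ofPred_eq, this, ha, and_assoc]
      rw [Finset.sum_const, nsmul_eq_mul, Finset.sum_boole] at this
      have e : ((F.filter fun x => ∃ w, IsTopVertex le (P.sizes (k + 1)) w ∧ le x w).filter a) =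
          F.filter a := by
        ext x
        simp only [Finset.mem_filter, and_assoc]
        refine and_congr_right fun _ => and_iff_right_of_imp ?_
        rintro ⟨v, ⟨_, w, hw, hvw, _⟩, hxv⟩
        exact ⟨w, hw, h.trans hxv hvw⟩
      rw [e] at this
      have h1 := Finset.card_filter_le F fun x => ∃ w, IsTopVertex le (P.sizes (k + 1)) w ∧ le x w
      have h2 : ((F.filter fun x => ∃ w, IsTopVertex le (P.sizes (k + 1)) w ∧ le x w).card : ℝ) ≤
        F.card := by exact_mod_cast h1
      have h3 := P.θ_lt k
      nlinarith
    -- Nothing happens outside the active blocks at stage `k`. By nesting that part of `F` still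
    -- contains every block of stage at most `k` that it meets, so its density is at least `α k`.
    have hpas := ih (F.filter fun x => ¬ a x) fun j hj v hv x hx hxv y hyv => by
      rw [Finset.mem_filter] at hx ⊢
      refine ⟨hF j (hj.trans (Nat.le_succ k)) v hv x hx.1 hxv y hyv, ?_⟩
      rintro ⟨u, hu, hyu⟩
      exact hx.2 ⟨u, hu, h.trans hxv (h.isTop_le hj hv hu.1 hyv hyu)⟩
    have hpas' : (F.filter fun x => ¬ a x).filter (Kept le lab P k) =
        (F.filter fun x => ¬ a x).filter (Kept le lab P (k + 1)) := by
      refine Finset.filter_congr fun x hx => ⟨fun hk => ?_, fun hk => hk.1⟩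
      exact Kept.succ_of_not_isActive hk fun v hv hxv hv' =>
        (Finset.mem_filter.1 hx).2 ⟨v, ⟨hv, hv'⟩, hxv⟩
    rw [hpas'] at hpas
    have e1 := Finset.card_filter_add_card_filter_not (s := F) a
    have e2 := Finset.card_filter_add_card_filter_not (s := F.filter (Kept le lab P (k + 1))) a
    rw [Finset.filter_comm, Finset.filter_comm (p := Kept le lab P (k + 1))] at e2
    have e1' : ((F.filter a).card : ℝ) + (F.filter fun x => ¬ a x).card = F.card := by
      exact_mod_cast e1
    have e2' : (((F.filter a).filter (Kept le lab P (k + 1))).card : ℝ) +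
        ((F.filter fun x => ¬ a x).filter (Kept le lab P (k + 1))).card =
        (F.filter (Kept le lab P (k + 1))).card := by exact_mod_cast e2
    have hα := P.α_succ k
    have hβα := P.β_le_α k
    have hF0 : (0 : ℝ) ≤ F.card := by positivity
    -- The density drops from `α k` to `β k` on a proportion of at most `1 - θ k`.
    calc P.α (k + 1) * F.card ≤ (P.β k + P.θ k * (P.α k - P.β k)) * F.card := by gcongr
      _ = P.α k * F.card - (P.α k - P.β k) * ((1 - P.θ k) * F.card) := by ring
      _ ≤ P.α k * F.card - (P.α k - P.β k) * (F.filter a).card := by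
        have := mul_le_mul_of_nonneg_left hfrac (sub_nonneg.2 hβα)
        linarith
      _ = P.β k * (F.filter a).card + P.α k * (F.filter fun x => ¬ a x).card := by
        rw [← e1']; ring
      _ ≤ _ := by rw [← e2']; exact add_le_add hact hpas

end IsAncestorOrder

/-! ### Good, cut and removed blocks. -/

namespace IsAncestorOrder

open Classical

variable {V : Type*} {le : V → V → Prop} (h : IsAncestorOrder le)
  {lab : V → unitInterval} {P : PruningScheme}
include h

theorem le_ncard_kept (hl : Function.Injective lab) {k : ℕ} {v : V}
    (hv : IsTopVertex le (P.sizes k) v) :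
    P.α k * treeSize le v ≤ {x | le x v ∧ Kept le lab P k x}.ncard := by
  have h1 := h.le_card_kept hl k (P := P) (h.finite v).toFinset fun j hj u hu x hx hxu y hyu => by
    rw [Set.Finite.mem_toFinset] at hx ⊢
    exact h.trans hyu (h.isTop_le hj hu hv hxu hx)
  have e1 : ((h.finite v).toFinset.filter (Kept le lab P k)).card =
      {x | le x v ∧ Kept le lab P k x}.ncard := by
    rw [← Set.ncard_coe_finset]
    congr 1
    ext x
    simp
  rwa [e1, ← Set.ncard_eq_toFinset_card _ (h.finite v)] at h1

theorem ncard_kept_succ_of_isActive (hl : Function.Injective lab) {k : ℕ} {v : V}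
    (hv : IsTopVertex le (P.sizes k) v) (hact : IsActive le lab P k v) :
    {x | le x v ∧ Kept le lab P (k + 1) x}.ncard = 2 ^ P.expo (treeSize le v) := by
  refine h.ncard_kept_of_isActive hl hv hact ?_
  have := (P.expo_le hv.1).trans (h.le_ncard_kept hl hv)
  exact_mod_cast this

theorem le_ncard_kept_succ (hl : Function.Injective lab) {k : ℕ} {v : V}
    (hv : IsTopVertex le (P.sizes k) v) :
    P.β k * treeSize le v ≤ {x | le x v ∧ Kept le lab P (k + 1) x}.ncard := by
  by_cases hact : IsActive le lab P k v
  · rw [h.ncard_kept_succ_of_isActive hl hv hact]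
    exact_mod_cast P.le_expo hv.1
  · have e : {x | le x v ∧ Kept le lab P (k + 1) x} = {x | le x v ∧ Kept le lab P k x} := by
      ext x
      refine and_congr_right fun hxv => ⟨fun hx => hx.1, fun hx => ?_⟩
      exact hx.succ_of_not_isActive fun w hw hxw => h.isTop_unique hv hw hxv hxw ▸ hact
    rw [e]
    exact (mul_le_mul_of_nonneg_right (P.β_le_α k) (by positivity)).trans (h.le_ncard_kept hl hv)

theorem nonempty_kept_succ (hl : Function.Injective lab) {k : ℕ} {v : V}
    (hv : IsTopVertex le (P.sizes k) v) : ∃ x, le x v ∧ Kept le lab P (k + 1) x := by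
  have h1 := h.le_ncard_kept_succ hl hv
  have h2 : (0 : ℝ) < treeSize le v := by exact_mod_cast h.treeSize_pos v
  have h3 := P.le_β k
  have h4 : (0 : ℝ) < {x | le x v ∧ Kept le lab P (k + 1) x}.ncard := by nlinarith
  have h5 : 0 < {x | le x v ∧ Kept le lab P (k + 1) x}.ncard := by exact_mod_cast h4
  exact (Set.nonempty_of_ncard_ne_zero h5.ne')

/-- Every subtree of stage `k + 1` contains at most one subtree of stage `k` that is cut. -/
theorem isCut_unique (hl : Function.Injective lab) {k : ℕ} {v v' w : V}
    (hv : IsTopVertex le (P.sizes k) v) (hv' : IsTopVertex le (P.sizes k) v')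
    (hcut : IsCut le lab P k v) (hcut' : IsCut le lab P k v')
    (hw : IsTopVertex le (P.sizes (k + 1)) w) (hvw : le v w) (hvw' : le v' w) : v = v' := by
  have key : ∀ v v', IsTopVertex le (P.sizes k) v → IsTopVertex le (P.sizes k) v' →
      IsCut le lab P k v → IsCut le lab P k v' → le v w → le v' w → lab v ≤ lab v' → v = v' := by
    intro v v' hv hv' hcut hcut' hvw hvw' hlab
    by_contra hne
    have hlt : lab v < lab v' := lt_of_le_of_ne hlab fun e => hne (hl e)
    obtain ⟨x, -, hxv, -, hx, -, -⟩ := hcut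
    obtain ⟨-, y, -, hyv', -, hy, hy'⟩ := hcut'
    refine hy' ⟨hy, fun u hu hyu hact => ?_⟩
    obtain rfl := h.isTop_unique hw hu (h.trans hyv' hvw') hyu
    -- The block label is the leading coordinate of the key, so `y` in the block with the larger
    -- label outranks the kept vertex `x` and must be kept too.
    refine lt_of_le_of_lt (Set.ncard_le_ncard (fun z hz => ?_) ?_)
      (hx.2 w hw (h.trans hxv hvw) hact)
    · refine ⟨hz.1, hz.2.1, lt_trans ?_ hz.2.2⟩
      simp only [pruneKey, previousTop, Prod.Lex.toLex_lt_toLex]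
      left
      rw [h.blockLabel_eq hv hxv, h.blockLabel_eq hv' hyv']
      refine (ENNReal.ofReal_lt_ofReal_iff_of_nonneg (lab v).2.1).2 hlt
    · exact (h.finite w).subset fun z hz => hz.1
  rcases le_total (lab v) (lab v') with h1 | h1
  · exact key v v' hv hv' hcut hcut' hvw hvw' h1
  · exact (key v' v hv' hv hcut' hcut hvw' hvw h1).symm

/-- Only one block of stage `k` below `w` can be cut, and it has at most `hi k ≤ θ k * lo (k + 1)`
vertices. -/
theorem ncard_cut_le (hl : Function.Injective lab) {k : ℕ} {w : V}
    (hw : IsTopVertex le (P.sizes (k + 1)) w) :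
    ({x | le x w ∧ ∃ v, IsTopVertex le (P.sizes k) v ∧ IsCut le lab P k v ∧ le x v}.ncard : ℝ) ≤
      P.θ k * treeSize le w := by
  set A := {x | le x w ∧ ∃ v, IsTopVertex le (P.sizes k) v ∧ IsCut le lab P k v ∧ le x v} with hA
  have hθ := P.θ_pos k
  rcases A.eq_empty_or_nonempty with hAe | ⟨x₀, hx₀w, v₀, hv₀, hcut₀, hx₀v₀⟩
  · rw [hAe, Set.ncard_empty]
    push_cast
    positivity
  have hv₀w := h.isTop_le (Nat.le_succ k) hv₀ hw hx₀v₀ hx₀w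
  have hsub : A ⊆ {x | le x v₀} := by
    rintro x ⟨hxw, v, hv, hcut, hxv⟩
    rw [← h.isCut_unique hl hv hv₀ hcut hcut₀ hw (h.isTop_le (Nat.le_succ k) hv hw hxv hxw) hv₀w]
    exact hxv
  have h1 : A.ncard ≤ P.hi k := (Set.ncard_le_ncard hsub (h.finite v₀)).trans (P.le_hi hv₀.1)
  have h2 : (A.ncard : ℝ) ≤ P.hi k := by exact_mod_cast h1
  have h4 : (P.lo (k + 1) : ℝ) ≤ treeSize le w := by exact_mod_cast P.lo_le hw.1
  have h5 := P.hi_le k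
  nlinarith

/-- Few vertices of a subtree of stage `k + 1` are covered by subtrees of stage `k`, but not good
at stage `k`. -/
theorem ncard_not_isGoodAt_le (hl : Function.Injective lab) {k : ℕ} {w : V}
    (hw : IsTopVertex le (P.sizes (k + 1)) w) :
    ({x | le x w ∧ (∃ v, IsTopVertex le (P.sizes k) v ∧ le x v) ∧
      ¬ IsGoodAt le lab P k x}.ncard : ℝ) ≤ 3 * P.θ k * treeSize le w := by
  set A := {x | le x w ∧ ∃ v, IsTopVertex le (P.sizes k) v ∧ ¬ IsActive le lab P k v ∧ le x v}
  set B := {x | le x w ∧ ∃ v, IsTopVertex le (P.sizes k) v ∧ IsCut le lab P k v ∧ le x v}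
  have hAfin : A.Finite := (h.finite w).subset fun x hx => hx.1
  have hBfin : B.Finite := (h.finite w).subset fun x hx => hx.1
  have hsub : {x | le x w ∧ (∃ v, IsTopVertex le (P.sizes k) v ∧ le x v) ∧
      ¬ IsGoodAt le lab P k x} ⊆ A ∪ B := by
    rintro x ⟨hxw, ⟨v, hv, hxv⟩, hgood⟩
    by_cases hact : IsActive le lab P k v
    · by_cases hcut : IsCut le lab P k v
      · exact Or.inr ⟨hxw, v, hv, hcut, hxv⟩
      · exact absurd ⟨v, hv, hxv, hact, hcut⟩ hgood
    · exact Or.inl ⟨hxw, v, hv, hact, hxv⟩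
  have h1 := (Set.ncard_le_ncard hsub (hAfin.union hBfin)).trans (Set.ncard_union_le _ _)
  have h2 : (A.ncard : ℝ) ≤ 2 * P.θ k * treeSize le w := h.ncard_passive_le hl hw
  have h3 : (B.ncard : ℝ) ≤ P.θ k * treeSize le w := h.ncard_cut_le hl hw
  calc _ ≤ ((A.ncard + B.ncard : ℕ) : ℝ) := by exact_mod_cast h1
    _ ≤ _ := by push_cast; linarith

/-- A removed block still had density at least `β k ≥ 1 / 8` after its own stage, and all of that is
lost at the next one. The right-hand side can be summed over `k`, since a vertex is lost only once.
-/
theorem ncard_isRemovedAt_le (hl : Function.Injective lab) {k : ℕ} {v : V}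
    (hv : IsTopVertex le (P.sizes k) v) :
    ({x | le x v ∧ IsRemovedAt le lab P k x}.ncard : ℝ) ≤
      8 * {x | le x v ∧ Kept le lab P (k + 1) x ∧ ¬ Kept le lab P (k + 2) x}.ncard := by
  rcases {x | le x v ∧ IsRemovedAt le lab P k x}.eq_empty_or_nonempty with
    he | ⟨x, hxv, w, hw, hxw, hrem⟩
  · rw [he, Set.ncard_empty]
    push_cast
    positivity
  obtain rfl := h.isTop_unique hw hv hxw hxv
  have e : {x | le x w ∧ Kept le lab P (k + 1) x ∧ ¬ Kept le lab P (k + 2) x} =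
      {x | le x w ∧ Kept le lab P (k + 1) x} := by
    ext y
    exact and_congr_right fun hy => and_iff_left (hrem y hy)
  rw [e]
  have h1 := h.le_ncard_kept_succ hl hv
  have h2 := P.le_β k
  have h3 : {x | le x w ∧ IsRemovedAt le lab P k x}.ncard ≤ treeSize le w :=
    Set.ncard_le_ncard (fun x hx => hx.1) (h.finite w)
  have h4 : ({x | le x w ∧ IsRemovedAt le lab P k x}.ncard : ℝ) ≤ treeSize le w := by
    exact_mod_cast h3
  have h5 : (0 : ℝ) ≤ treeSize le w := by positivity
  nlinarith

/-- If a subtree of stage `k` contains a vertex that survives all later stages, and no subtree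
containing it is cut at a later stage, then nothing of it is lost. -/
theorem kept_of_forall {k : ℕ} {v : V}
    (hT : ∀ j ≥ k, ∃ w, IsTopVertex le (P.sizes j) w ∧ le v w ∧ ¬ IsCut le lab P j w ∧
      ∃ z, le z w ∧ Kept le lab P (j + 2) z) {y : V} (hyv : le y v) (hy : Kept le lab P (k + 1) y)
    (j : ℕ) : Kept le lab P j y := by
  have : ∀ i, Kept le lab P (k + 1 + i) y := by
    intro i
    induction i with
    | zero => exact hy
    | succ i ih =>
      obtain ⟨w, hw, hvw, hcut, z, hzw, hz⟩ := hT (k + i) (Nat.le_add_right _ _)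
      by_contra hcon
      refine hcut ⟨z, y, hzw, h.trans hyv hvw, hz, ?_, ?_⟩
      · convert ih using 1; omega
      · convert hcon using 2; omega
  exact (this j).of_le (by omega)

omit h in
/-- The classes of the `n`-th partition. -/
theorem _root_.isPartitionOf_blocks {V : Type} {le : V → V → Prop} (h : IsAncestorOrder le)
    (U : Set V) (B : V → Prop) :
    IsPartitionOf (fun x y => x ∈ U ∧ y ∈ U ∧ (x = y ∨ ∃ v, B v ∧ le x v ∧ le y v)) U where
  subset _ _ hxy := ⟨hxy.1, hxy.2.1⟩
  refl _ hx := ⟨hx, hx, Or.inl rfl⟩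
  symm _ _ hxy := ⟨hxy.2.1, hxy.1, hxy.2.2.imp Eq.symm fun ⟨v, h1, h2, h3⟩ => ⟨v, h1, h3, h2⟩⟩
  trans x y z := by
    rintro ⟨hx, hy, hxy⟩ ⟨-, hz, hyz⟩
    refine ⟨hx, hz, ?_⟩
    rcases hxy with rfl | ⟨v, hv, hxv, hyv⟩
    · exact hyz
    rcases hyz with rfl | ⟨w, hw, hyw, hzw⟩
    · exact Or.inr ⟨v, hv, hxv, hyv⟩
    rcases h.total hyv hyw with h1 | h1
    · exact Or.inr ⟨w, hw, h.trans hxv h1, hzw⟩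
    · exact Or.inr ⟨v, hv, hxv, h.trans hzw h1⟩

end IsAncestorOrder

/-! ### The surviving set and its partitions. -/

/-- The vertices that survive all stages. -/
def Survives {V : Type*} (le : V → V → Prop) (lab : V → unitInterval) (P : PruningScheme) (x : V) :
    Prop := ∀ k, Kept le lab P k x

/-- The relation of the `n`-th partition: `x` and `y` survive, and are equal or lie in a common
subtree of some stage whose prescribed size is at most `2 ^ n`. -/
def SameBlock {V : Type*} (le : V → V → Prop) (lab : V → unitInterval) (P : PruningScheme) (n : ℕ)
    (x y : V) : Prop :=
  Survives le lab P x ∧ Survives le lab P y ∧ (x = y ∨ ∃ v,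
    (∃ k, IsTopVertex le (P.sizes k) v ∧ P.expo (treeSize le v) ≤ n) ∧ le x v ∧ le y v)

namespace IsOneEndedTree

variable {V : Type} {G : SimpleGraph V} {lab : V → unitInterval} {P : PruningScheme}

theorem exists_size_of_isGoodAt {le : V → V → Prop} (h : IsAncestorOrder le)
    (hl : Function.Injective lab) (hgood : ∀ x, ∀ᶠ k in atTop, IsGoodAt le lab P k x) {x : V}
    (hx : Survives le lab P x) : ∃ K, ∀ k ≥ K, ∃ v, IsTopVertex le (P.sizes k) v ∧ le x v ∧
      {y | SameBlock le lab P (P.expo (treeSize le v)) x y} = {y | le y v ∧ Survives le lab P y} ∧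
      {y | le y v ∧ Survives le lab P y}.ncard = 2 ^ P.expo (treeSize le v) := by
  obtain ⟨K, hK⟩ := eventually_atTop.1 (hgood x)
  refine ⟨K, fun k hk => ?_⟩
  obtain ⟨v, hv, hxv, hact, hcut⟩ := hK k hk
  -- All later blocks around `x` are uncut and contain the survivor `x`, so nothing below `v` is
  -- lost after its own pruning.
  have e : {y | le y v ∧ Survives le lab P y} = {y | le y v ∧ Kept le lab P (k + 1) y} := by
    ext y
    refine and_congr_right fun hyv => ⟨fun hy => hy _, fun hy j => ?_⟩
    refine h.kept_of_forall (k := k) (v := v) (fun j hj => ?_) hyv hy j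
    obtain ⟨w, hw, hxw, -, hcutw⟩ := hK j (hk.le.trans hj)
    exact ⟨w, hw, h.isTop_le hj hv hw hxv hxw, hcutw, x, hxw, hx _⟩
  refine ⟨v, hv, hxv, ?_, by rw [e, h.ncard_kept_succ_of_isActive hl hv hact]⟩
  ext y
  constructor
  · rintro ⟨-, hy, rfl | ⟨w, ⟨j, hw, hle⟩, hxw, hyw⟩⟩
    · exact ⟨hxv, hy⟩
    · refine ⟨?_, hy⟩
      -- A common block of an earlier or equal stage lies below `v`. Blocks of later stages have
      -- larger exponents and are not used by this partition.
      rcases le_or_gt j k with hjk | hjk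
      · exact h.trans hyw (h.isTop_le hjk hw hv hxw hxv)
      · exact absurd hle (not_le.2 (P.expo_lt hjk hv.1 hw.1))
  · rintro ⟨hyv, hy⟩
    exact ⟨hx, hy, Or.inr ⟨v, ⟨k, hv, le_rfl⟩, hxv, hyv⟩⟩

theorem pruning_conclusion (hG : IsOneEndedTree G) (hfin : ∀ v, (G.neighborSet v).Finite)
    (hl : Function.Injective lab) (hgood : ∀ x, ∀ᶠ k in atTop, IsGoodAt G.EndLE lab P k x)
    (hrem : ∀ x, ∀ᶠ k in atTop, ¬ IsRemovedAt G.EndLE lab P k x) :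
    {x | Survives G.EndLE lab P x}.Nonempty ∧
      (G.induce {x | Survives G.EndLE lab P x}).Connected ∧
      (∀ n, IsPartitionOf (SameBlock G.EndLE lab P n) {x | Survives G.EndLE lab P x}) ∧
      (∀ m n, m ≤ n → ∀ x y, SameBlock G.EndLE lab P m x y → SameBlock G.EndLE lab P n x y) ∧
      (∀ x, Survives G.EndLE lab P x → ∀ y, Survives G.EndLE lab P y →
        ∀ᶠ n in atTop, SameBlock G.EndLE lab P n x y) ∧
      ∀ x, Survives G.EndLE lab P x →
        {n : ℕ | (G.induce {y | SameBlock G.EndLE lab P n x y}).Connected ∧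
          {y | SameBlock G.EndLE lab P n x y}.ncard = 2 ^ n}.Infinite := by
  have h := hG.isAncestorOrder hfin
  have hup : ∀ {x y}, Survives G.EndLE lab P x → G.EndLE x y → Survives G.EndLE lab P y :=
    fun hx hxy k => h.kept_of_le (hx k) hxy
  have hne : {x | Survives G.EndLE lab P x}.Nonempty := by
    obtain ⟨x⟩ := hG.1.connected.nonempty
    -- The vertex `x` itself may be lost. Its block at stage `K` still has a vertex after its own
    -- stage, and from then on the blocks around it are neither cut nor removed.
    obtain ⟨K, hK⟩ := eventually_atTop.1 ((hgood x).and (hrem x))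
    obtain ⟨⟨v, hv, hxv, -⟩, -⟩ := hK K le_rfl
    obtain ⟨y, hyv, hy⟩ := h.nonempty_kept_succ hl hv
    refine ⟨y, h.kept_of_forall (k := K) (v := v) (fun j hj => ?_) hyv hy⟩
    obtain ⟨⟨w, hw, hxw, -, hcut⟩, hr⟩ := hK j hj
    refine ⟨w, hw, h.isTop_le hj hv hw hxv hxw, hcut, ?_⟩
    by_contra hcon
    push Not at hcon
    exact hr ⟨w, hw, hxw, hcon⟩
  refine ⟨hne, SimpleGraph.connected_induce_of_endLE hne fun x hx y hy => ?_, fun n => ?_,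
    fun m n hmn x y hxy => ?_, fun x hx y hy => ?_, fun x hx => ?_⟩
  · obtain ⟨z, hxz, hyz⟩ := h.directed x y
    exact ⟨z, hxz, hyz, fun t ht _ => ht.elim (hup hx) (hup hy)⟩
  · exact isPartitionOf_blocks h _ _
  · refine ⟨hxy.1, hxy.2.1, hxy.2.2.imp_right ?_⟩
    rintro ⟨v, ⟨k, hv, hle⟩, hxv⟩
    exact ⟨v, ⟨k, hv, hle.trans hmn⟩, hxv⟩
  · obtain ⟨z, hxz, hyz⟩ := h.directed x y
    obtain ⟨K, hK⟩ := exists_size_of_isGoodAt h hl hgood hx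
    obtain ⟨v, hv, hxv, -⟩ := hK (max K (treeSize G.EndLE z)) (le_max_left _ _)
    have hzv : G.EndLE z v := h.le_of_treeSize_le hxz hxv
      ((le_max_right K _).trans ((P.lo_strictMono.le_apply).trans (P.lo_le hv.1)))
    filter_upwards [eventually_ge_atTop (P.expo (treeSize G.EndLE v))] with n hn
    exact ⟨hx, hy, Or.inr ⟨v, ⟨_, hv, hn⟩, hxv, h.trans hyz hzv⟩⟩
  · obtain ⟨K, hK⟩ := exists_size_of_isGoodAt h hl hgood hx
    have : Nonempty V := ⟨x⟩
    choose! v hv hxv he hcard using hK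
    have hmono : StrictMono fun i => P.expo (treeSize G.EndLE (v (K + i))) := by
      refine strictMono_nat_of_lt_succ fun i => ?_
      exact P.expo_lt (Nat.lt_succ_self _) (hv _ (by omega)).1 (hv _ (by omega)).1
    refine Set.infinite_of_injective_forall_mem hmono.injective fun i => ?_
    have hi : K ≤ K + i := by omega
    refine ⟨?_, by rw [he _ hi, hcard _ hi]⟩
    rw [he _ hi]
    refine SimpleGraph.connected_induce_of_endLE ⟨x, hxv _ hi, hx⟩ fun a ha b hb => ?_
    refine ⟨v (K + i), ha.1, hb.1, fun t ht htv => ⟨htv, ht.elim (hup ha.2) (hup hb.2)⟩⟩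

end IsOneEndedTree

/-! ### Measurability of the pruning procedure. -/

theorem Relation.reflTransGen_iff_exists_iterate {α : Type*} {r : α → α → Prop} {x y : α} :
    Relation.ReflTransGen r x y ↔
      ∃ n : ℕ, ((fun (s : α → α → Prop) a b => ∃ c, r a c ∧ s c b)^[n] Eq) x y := by
  constructor
  · intro h
    induction h using Relation.ReflTransGen.head_induction_on with
    | refl => exact ⟨0, rfl⟩
    | head hab _ ih =>
      obtain ⟨n, hn⟩ := ih
      refine ⟨n + 1, ?_⟩
      rw [Function.iterate_succ_apply']
      exact ⟨_, hab, hn⟩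
  · rintro ⟨n, hn⟩
    induction n generalizing x with
    | zero => exact (show x = y from hn) ▸ Relation.ReflTransGen.refl
    | succ n ih =>
      rw [Function.iterate_succ_apply'] at hn
      obtain ⟨c, hc, h⟩ := hn
      exact (ih h).head hc

namespace RootedGraph

variable {k m : ℕ} {X : Type} [PseudoMetricSpace X]

/-- The bound vertex becomes root `0` and the old roots are shifted by `Fin.succ`. With its
companions this reduces properties of several vertices, however nested their quantifiers, to atomic
ones. -/
theorem measurable_exists_cons [NeZero k] {p : RootedGraph (k + 1) X → Prop} (hp : Measurable p) :
    Measurable fun g : RootedGraph k X => ∃ y, p (g.cons y) := by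
  obtain ⟨k, rfl⟩ := Nat.exists_eq_succ_of_ne_zero (NeZero.ne k)
  exact measurableSet_setOfPred.1 (measurableSet_exists (measurableSet_setOfPred.2 hp))

theorem measurable_forall_cons [NeZero k] {p : RootedGraph (k + 1) X → Prop} (hp : Measurable p) :
    Measurable fun g : RootedGraph k X => ∀ y, p (g.cons y) := by
  obtain ⟨k, rfl⟩ := Nat.exists_eq_succ_of_ne_zero (NeZero.ne k)
  exact measurableSet_setOfPred.1 (measurableSet_forall (measurableSet_setOfPred.2 hp))

theorem measurable_infinite_cons [NeZero k] {p : RootedGraph (k + 1) X → Prop}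
    (hp : Measurable p) : Measurable fun g : RootedGraph k X => {y | p (g.cons y)}.Infinite := by
  obtain ⟨k, rfl⟩ := Nat.exists_eq_succ_of_ne_zero (NeZero.ne k)
  exact measurableSet_setOfPred.1 (measurableSet_infinite (measurableSet_setOfPred.2 hp))

theorem measurable_ncard_cons [NeZero k] {p : RootedGraph (k + 1) X → Prop} (hp : Measurable p) :
    Measurable fun g : RootedGraph k X => {y | p (g.cons y)}.ncard := by
  obtain ⟨k, rfl⟩ := Nat.exists_eq_succ_of_ne_zero (NeZero.ne k)
  exact measurable_ncard (measurableSet_setOfPred.2 hp)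

theorem measurable_dist (i j : Fin k) :
    Measurable fun g : RootedGraph k X => g.graph.dist (g.root i) (g.root j) := by
  refine measurable_to_countable' fun n => IsOpen.measurableSet (isOpen_of_forall_close ?_)
  intro g hg
  have hg : g.graph.dist (g.root i) (g.root j) = n := hg
  refine ⟨n, fun h ⟨φ, hφ⟩ => ?_⟩
  have hφ : IsCloseBy φ := hφ
  have h1 := hφ.dist_le (i := i) hg.le (g.root_mem_ball n j) le_rfl
  rw [hφ.1 j] at h1
  have h2 := hφ.symm.dist_le (i := i) (a := h.root j) le_rfl (h.root_mem_ball n j) h1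
  rw [hφ.symm.1 j, hg] at h2
  exact le_antisymm h1 h2

theorem measurable_root_eq (i j : Fin k) :
    Measurable fun g : RootedGraph k X => g.root i = g.root j := by
  simp_rw [← (connected _).dist_eq_zero_iff]
  exact (measurable_dist i j).eq measurable_const

theorem measurable_adj (i j : Fin k) :
    Measurable fun g : RootedGraph k X => g.graph.Adj (g.root i) (g.root j) := by
  simp_rw [← SimpleGraph.dist_eq_one_iff_adj]
  exact (measurable_dist i j).eq measurable_const

theorem measurable_mark [MeasurableSpace X] [BorelSpace X] (i : Fin k) :
    Measurable fun g : RootedGraph k X => g.mark (g.root i) := by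
  refine measurable_of_isOpen fun O hO => IsOpen.measurableSet (isOpen_of_forall_close ?_)
  intro g hg
  obtain ⟨ε, hε, hO⟩ := Metric.isOpen_iff.1 hO _ hg
  obtain ⟨R, hR⟩ := exists_nat_one_div_lt hε
  refine ⟨R, fun h ⟨φ, hφ⟩ => hO ?_⟩
  have h1 := hφ.2 ⟨g.root i, g.root_mem_ball R i⟩
  rw [hφ.1 i] at h1
  rw [Metric.mem_ball']
  exact h1.trans_lt hR

theorem measurable_towardsEnd [NeZero k] (i j : Fin k) :
    Measurable fun g : RootedGraph k X => g.graph.TowardsEnd (g.root i) (g.root j) :=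
  (measurable_adj i j).and <| measurable_infinite_cons
    (p := fun g => g.graph.dist (g.root i.succ) (g.root 0) =
      g.graph.dist (g.root j.succ) (g.root 0) + 1)
    ((measurable_dist _ _).eq ((measurable_dist _ _).add_const 1))

/-- The reflexive transitive closure is a countable union of iterated compositions, each of which
adds one existential quantifier over vertices. -/
theorem measurable_endLE [NeZero k] (i j : Fin k) :
    Measurable fun g : RootedGraph k X => g.graph.EndLE (g.root i) (g.root j) := by
  simp_rw [SimpleGraph.EndLE, Relation.reflTransGen_iff_exists_iterate]
  refine Measurable.exists fun n => ?_
  induction n generalizing k with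
  | zero => exact measurable_root_eq i j
  | succ n ih =>
    simp_rw [Function.iterate_succ_apply']
    exact measurable_exists_cons (p := fun g => g.graph.TowardsEnd (g.root i.succ) (g.root 0) ∧ _)
      ((measurable_towardsEnd _ _).and (ih 0 j.succ))

theorem measurable_treeSize [NeZero k] (i : Fin k) :
    Measurable fun g : RootedGraph k X => treeSize g.graph.EndLE (g.root i) :=
  measurable_ncard_cons (measurable_endLE 0 i.succ)

theorem measurable_isTopVertex [NeZero k] (S : Set ℕ) (i : Fin k) :
    Measurable fun g : RootedGraph k X => IsTopVertex g.graph.EndLE S (g.root i) := by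
  have h : ∀ {k : ℕ} [NeZero k] (i : Fin k),
      Measurable fun g : RootedGraph k X => treeSize g.graph.EndLE (g.root i) ∈ S :=
    fun i => (Measurable.of_discrete (f := (· ∈ S))).comp (measurable_treeSize i)
  exact (h i).and <| measurable_forall_cons (p := fun g =>
    g.graph.EndLE (g.root i.succ) (g.root 0) → treeSize g.graph.EndLE (g.root 0) ∈ S →
      g.root 0 = g.root i.succ)
    ((measurable_endLE _ _).imp ((h 0).imp (measurable_root_eq _ _)))

theorem measurable_previousTop [NeZero k] (P : PruningScheme) (n : ℕ) (i : Fin k) :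
    Measurable fun g : RootedGraph k X => previousTop g.graph.EndLE P n (g.root i) := by
  cases n with
  | zero => exact measurable_const
  | succ n => exact measurable_isTopVertex _ i

theorem measurable_isCovered [NeZero k] (S : Set ℕ) (i : Fin k) :
    Measurable fun g : RootedGraph k X =>
      ∃ v, IsTopVertex g.graph.EndLE S v ∧ g.graph.EndLE (g.root i) v :=
  measurable_exists_cons ((measurable_isTopVertex S 0).and (measurable_endLE i.succ 0))

section Labelled

variable (P : PruningScheme)

theorem measurable_ofReal_mark (i : Fin k) :
    Measurable fun g : RootedGraph k unitInterval => ENNReal.ofReal (g.mark (g.root i)) :=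
  (measurable_subtype_coe.comp (measurable_mark i)).ennreal_ofReal

theorem measurable_blockLabel [NeZero k] {W : ∀ {V : Type}, SimpleGraph V → V → Prop}
    (hW : ∀ {k : ℕ} [NeZero k] (i : Fin k),
      Measurable fun g : RootedGraph k unitInterval => W g.graph (g.root i))
    (i : Fin k) :
    Measurable fun g : RootedGraph k unitInterval =>
      blockLabel g.graph.EndLE g.mark (W g.graph) (g.root i) := by
  obtain ⟨k, rfl⟩ := Nat.exists_eq_succ_of_ne_zero (NeZero.ne k)
  exact measurable_iInf_cons
    (S := {g | W g.graph (g.root 0) ∧ g.graph.EndLE (g.root i.succ) (g.root 0)})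
    (f := fun g => ENNReal.ofReal (g.mark (g.root 0)))
    (measurableSet_setOfPred.2 ((hW 0).and (measurable_endLE _ _))) (measurable_ofReal_mark 0)

theorem measurable_pruneKey_lt [NeZero k] {W : ∀ {V : Type}, SimpleGraph V → V → Prop}
    (hW : ∀ {k : ℕ} [NeZero k] (i : Fin k),
      Measurable fun g : RootedGraph k unitInterval => W g.graph (g.root i))
    (i j : Fin k) :
    Measurable fun g : RootedGraph k unitInterval =>
      pruneKey g.graph.EndLE g.mark (W g.graph) (g.root i) <
      pruneKey g.graph.EndLE g.mark (W g.graph) (g.root j) := by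
  simp_rw [pruneKey, Prod.Lex.toLex_lt_toLex]
  have h1 := measurable_blockLabel hW i
  have h2 := measurable_blockLabel hW j
  have h3 := measurable_treeSize (X := unitInterval) i
  have h4 := measurable_treeSize (X := unitInterval) j
  have h5 := measurable_mark (X := unitInterval) i
  have h6 := measurable_mark (X := unitInterval) j
  exact (measurableSet_setOfPred.1 (measurableSet_lt h1 h2)).or
    ((measurableSet_setOfPred.1 (measurableSet_eq_fun h1 h2)).and
      ((measurableSet_setOfPred.1 (measurableSet_lt h3 h4)).or
        ((h3.eq h4).and (measurableSet_setOfPred.1 (measurableSet_lt h5 h6)))))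

theorem measurable_isActive [NeZero k] (n : ℕ) (i : Fin k) :
    Measurable fun g : RootedGraph k unitInterval =>
      IsActive g.graph.EndLE g.mark P n (g.root i) := by
  refine measurable_exists_cons (p := fun g => IsTopVertex g.graph.EndLE (P.sizes (n + 1))
    (g.root 0) ∧ g.graph.EndLE (g.root i.succ) (g.root 0) ∧
      P.θ n * treeSize g.graph.EndLE (g.root 0) ≤ {y | g.graph.EndLE y (g.root 0) ∧
        blockLabel g.graph.EndLE g.mark (IsTopVertex g.graph.EndLE (P.sizes n)) y <
          ENNReal.ofReal (g.mark (g.root i.succ))}.ncard)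
    ((measurable_isTopVertex _ 0).and ((measurable_endLE _ _).and ?_))
  refine measurableSet_setOfPred.1 (measurableSet_le ?_ ?_)
  · exact measurable_const.mul (measurable_from_top.comp (measurable_treeSize 0))
  · refine measurable_from_top.comp (measurable_ncard_cons (p := fun g =>
      g.graph.EndLE (g.root 0) (g.root 1) ∧
        blockLabel g.graph.EndLE g.mark (IsTopVertex g.graph.EndLE (P.sizes n)) (g.root 0) <
          ENNReal.ofReal (g.mark (g.root i.succ.succ)))
      ((measurable_endLE _ _).and (measurableSet_setOfPred.1 (measurableSet_lt ?_ ?_))))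
    · exact measurable_blockLabel (W := fun G => IsTopVertex G.EndLE (P.sizes n))
        (fun i => measurable_isTopVertex _ i) 0
    · exact measurable_ofReal_mark _

theorem measurable_kept [NeZero k] (n : ℕ) (i : Fin k) :
    Measurable fun g : RootedGraph k unitInterval => Kept g.graph.EndLE g.mark P n (g.root i) := by
  induction n generalizing k with
  | zero => exact measurable_const
  | succ n ih =>
    refine (ih i).and (measurable_forall_cons (p := fun g =>
      IsTopVertex g.graph.EndLE (P.sizes n) (g.root 0) →
      g.graph.EndLE (g.root i.succ) (g.root 0) →
      IsActive g.graph.EndLE g.mark P n (g.root 0) →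
      {y | g.graph.EndLE y (g.root 0) ∧ Kept g.graph.EndLE g.mark P n y ∧
        pruneKey g.graph.EndLE g.mark (previousTop g.graph.EndLE P n) (g.root i.succ) <
        pruneKey g.graph.EndLE g.mark (previousTop g.graph.EndLE P n) y}.ncard <
          2 ^ P.expo (treeSize g.graph.EndLE (g.root 0)))
      ((measurable_isTopVertex _ _).imp ((measurable_endLE _ _).imp
        ((measurable_isActive P n _).imp (measurableSet_setOfPred.1 (measurableSet_lt ?_ ?_))))))
    · exact measurable_ncard_cons (p := fun g => g.graph.EndLE (g.root 0) (g.root 1) ∧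
        Kept g.graph.EndLE g.mark P n (g.root 0) ∧
        pruneKey g.graph.EndLE g.mark (previousTop g.graph.EndLE P n) (g.root i.succ.succ) <
        pruneKey g.graph.EndLE g.mark (previousTop g.graph.EndLE P n) (g.root 0))
        ((measurable_endLE _ _).and ((ih 0).and (measurable_pruneKey_lt
          (W := fun G => previousTop G.EndLE P n) (fun i => measurable_previousTop P n i) _ _)))
    · exact (measurable_from_top (f := fun s => 2 ^ P.expo s)).comp (measurable_treeSize 0)

theorem measurable_isCut [NeZero k] (n : ℕ) (i : Fin k) :
    Measurable fun g : RootedGraph k unitInterval => IsCut g.graph.EndLE g.mark P n (g.root i) :=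
  measurable_exists_cons (p := fun g => ∃ y, g.graph.EndLE (g.root 0) (g.root i.succ) ∧
      g.graph.EndLE y (g.root i.succ) ∧ Kept g.graph.EndLE g.mark P (n + 2) (g.root 0) ∧
      Kept g.graph.EndLE g.mark P (n + 1) y ∧ ¬ Kept g.graph.EndLE g.mark P (n + 2) y) <|
    measurable_exists_cons (p := fun g => g.graph.EndLE (g.root 1) (g.root i.succ.succ) ∧
      g.graph.EndLE (g.root 0) (g.root i.succ.succ) ∧
      Kept g.graph.EndLE g.mark P (n + 2) (g.root 1) ∧
      Kept g.graph.EndLE g.mark P (n + 1) (g.root 0) ∧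
      ¬ Kept g.graph.EndLE g.mark P (n + 2) (g.root 0)) <|
    (measurable_endLE _ _).and <| (measurable_endLE _ _).and <| (measurable_kept P _ _).and <|
      (measurable_kept P _ _).and (measurable_kept P _ _).not

theorem measurable_isGoodAt [NeZero k] (n : ℕ) (i : Fin k) :
    Measurable fun g : RootedGraph k unitInterval => IsGoodAt g.graph.EndLE g.mark P n (g.root i) :=
  measurable_exists_cons ((measurable_isTopVertex _ 0).and <| (measurable_endLE i.succ 0).and <|
    (measurable_isActive P n 0).and (measurable_isCut P n 0).not)

theorem measurable_isRemovedAt [NeZero k] (n : ℕ) (i : Fin k) :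
    Measurable fun g : RootedGraph k unitInterval =>
      IsRemovedAt g.graph.EndLE g.mark P n (g.root i) :=
  measurable_exists_cons (p := fun g => IsTopVertex g.graph.EndLE (P.sizes n) (g.root 0) ∧
      g.graph.EndLE (g.root i.succ) (g.root 0) ∧
      ∀ y, g.graph.EndLE y (g.root 0) → ¬ Kept g.graph.EndLE g.mark P (n + 2) y) <|
    (measurable_isTopVertex _ 0).and <| (measurable_endLE i.succ 0).and <|
      measurable_forall_cons (p := fun g => g.graph.EndLE (g.root 0) (g.root 1) →
        ¬ Kept g.graph.EndLE g.mark P (n + 2) (g.root 0))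
        ((measurable_endLE _ _).imp (measurable_kept P _ _).not)

theorem measurable_survives [NeZero k] (i : Fin k) :
    Measurable fun g : RootedGraph k unitInterval => Survives g.graph.EndLE g.mark P (g.root i) :=
  Measurable.forall fun n => measurable_kept P n i

theorem measurable_sameBlock [NeZero k] (n : ℕ) (i j : Fin k) :
    Measurable fun g : RootedGraph k unitInterval =>
      SameBlock g.graph.EndLE g.mark P n (g.root i) (g.root j) := by
  refine (measurable_survives P i).and <| (measurable_survives P j).and <|
    (measurable_root_eq i j).or <| measurable_exists_cons (p := fun g =>
      (∃ k, IsTopVertex g.graph.EndLE (P.sizes k) (g.root 0) ∧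
        P.expo (treeSize g.graph.EndLE (g.root 0)) ≤ n) ∧
      g.graph.EndLE (g.root i.succ) (g.root 0) ∧ g.graph.EndLE (g.root j.succ) (g.root 0))
      (.and ?_ ((measurable_endLE _ _).and (measurable_endLE _ _)))
  exact Measurable.exists fun k => (measurable_isTopVertex _ 0).and
    ((measurable_from_top (f := fun s => P.expo s ≤ n)).comp (measurable_treeSize 0))

theorem measurable_injective_mark [NeZero k] :
    Measurable fun g : RootedGraph k unitInterval => Function.Injective g.mark :=
  measurable_forall_cons (p := fun g => ∀ y, g.mark (g.root 0) = g.mark y → g.root 0 = y) <|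
    measurable_forall_cons (p := fun g =>
      g.mark (g.root 1) = g.mark (g.root 0) → g.root 1 = g.root 0) <|
    .imp (measurableSet_setOfPred.1 (measurableSet_eq_fun (measurable_mark _) (measurable_mark _)))
      (measurable_root_eq _ _)

end Labelled

end RootedGraph

/-- Since `S` is bounded, some ancestor of `x` has the largest size in `S`; sizes increase strictly
along the order. -/
theorem IsAncestorOrder.exists_isTopVertex {V : Type*} {le : V → V → Prop}
    (h : IsAncestorOrder le) {S : Set ℕ} (hS : BddAbove S) {x v : V} (hxv : le x v)
    (hv : treeSize le v ∈ S) : ∃ w, IsTopVertex le S w ∧ le x w := by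
  obtain ⟨M, hM⟩ := hS
  have hne : {s | ∃ w, le x w ∧ treeSize le w = s ∧ s ∈ S}.Nonempty := ⟨_, v, hxv, rfl, hv⟩
  have hb : BddAbove {s | ∃ w, le x w ∧ treeSize le w = s ∧ s ∈ S} :=
    ⟨M, fun s ⟨_, _, _, hs⟩ => hM hs⟩
  obtain ⟨w, hxw, hw, hwS⟩ := Nat.sSup_mem hne hb
  refine ⟨w, ⟨hw ▸ hwS, fun u hwu hu => ?_⟩, hxw⟩
  by_contra hne
  have h1 := h.treeSize_lt hwu fun e => hne e.symm
  have h2 := le_csSup hb ⟨u, h.trans hxw hwu, rfl, hu⟩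
  omega

/-! ### Ergodicity and the limiting ratio of sizes to powers of two. -/

/-- Every vertex has ancestors with arbitrarily many descendants, the number of which lies in
`2 ^ n • S` for some `n`. -/
def IsRecurrent {V : Type} (G : SimpleGraph V) (S : Set ℝ) : Prop :=
  ∀ x, ∀ N : ℕ, ∃ v, G.EndLE x v ∧ N ≤ treeSize G.EndLE v ∧
    ∃ n : ℕ, (treeSize G.EndLE v : ℝ) / 2 ^ n ∈ S

section Recurrence

variable {V : Type} {G : SimpleGraph V}

theorem IsRecurrent.mono {S S' : Set ℝ} (hS : S ⊆ S') (h : IsRecurrent G S) : IsRecurrent G S' :=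
  fun x N =>
    let ⟨v, h1, h2, n, h3⟩ := h x N
    ⟨v, h1, h2, n, hS h3⟩

/-- If `S` fails above `x` and `S'` above `y`, then both fail above a common ancestor. -/
theorem IsRecurrent.of_union (ho : IsAncestorOrder G.EndLE) {S S' : Set ℝ}
    (h : IsRecurrent G (S ∪ S')) : IsRecurrent G S ∨ IsRecurrent G S' := by
  by_contra! hcon
  simp only [IsRecurrent, not_forall] at hcon
  obtain ⟨⟨x, N, hx⟩, ⟨y, M, hy⟩⟩ := hcon
  obtain ⟨z, hxz, hyz⟩ := ho.directed x y
  obtain ⟨v, hzv, hv, n, hn⟩ := h z (max N M)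
  rcases hn with hn | hn
  · exact hx ⟨v, ho.trans hxz hzv, (le_max_left _ _).trans hv, n, hn⟩
  · exact hy ⟨v, ho.trans hyz hzv, (le_max_right _ _).trans hv, n, hn⟩

theorem IsAncestorOrder.isRecurrent_Icc (ho : IsAncestorOrder G.EndLE) :
    IsRecurrent G (Set.Icc 2 4) := by
  intro x N
  obtain ⟨v, hxv, hv⟩ := ho.exists_le_treeSize x (max N 2)
  have h2 : 2 ≤ treeSize G.EndLE v := (le_max_right _ _).trans hv
  -- One less than the logarithm, so that the ratio is at least 2 and not just 1.
  refine ⟨v, hxv, (le_max_left _ _).trans hv, Nat.log 2 (treeSize G.EndLE v) - 1, ?_⟩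
  have h1 := Nat.pow_log_le_self 2 (x := treeSize G.EndLE v) (by omega)
  have h3 := Nat.lt_pow_succ_log_self (b := 2) (by norm_num) (treeSize G.EndLE v)
  have h4 : 1 ≤ Nat.log 2 (treeSize G.EndLE v) := Nat.le_log_of_pow_le (by norm_num) (by omega)
  obtain ⟨m, hm⟩ := Nat.exists_eq_add_of_le' h4
  rw [hm] at h1 h3 ⊢
  have h1' : (2 : ℝ) ^ (m + 1) ≤ treeSize G.EndLE v := by exact_mod_cast h1
  have h3' : (treeSize G.EndLE v : ℝ) < 2 ^ (m + 1 + 1) := by exact_mod_cast h3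
  rw [Nat.add_sub_cancel]
  constructor
  · rw [le_div_iff₀ (by positivity)]
    rw [pow_succ] at h1'
    linarith
  · rw [div_le_iff₀ (by positivity)]
    rw [pow_succ, pow_succ] at h3'
    linarith

end Recurrence

namespace RootedGraph

theorem measurable_isRecurrent {k : ℕ} [NeZero k] {X : Type} [PseudoMetricSpace X] (S : Set ℝ) :
    Measurable fun g : RootedGraph k X => IsRecurrent g.graph S := by
  refine measurable_forall_cons (p := fun g => ∀ N : ℕ, ∃ v, g.graph.EndLE (g.root 0) v ∧
    N ≤ treeSize g.graph.EndLE v ∧ ∃ n : ℕ, (treeSize g.graph.EndLE v : ℝ) / 2 ^ n ∈ S) <|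
    Measurable.forall fun N => measurable_exists_cons (p := fun g =>
      g.graph.EndLE (g.root 1) (g.root 0) ∧ N ≤ treeSize g.graph.EndLE (g.root 0) ∧
        ∃ n : ℕ, (treeSize g.graph.EndLE (g.root 0) : ℝ) / 2 ^ n ∈ S) <|
    (measurable_endLE _ _).and (.and ?_ ?_)
  · exact (measurable_from_top (f := fun s => N ≤ s)).comp (measurable_treeSize 0)
  · exact (measurable_from_top (f := fun s : ℕ => ∃ n : ℕ, (s : ℝ) / 2 ^ n ∈ S)).comp
      (measurable_treeSize 0)

end RootedGraph

section Ergodic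

variable {μ : Measure (GraphSpace 1 Unit)}

theorem almostSurely_iff {P : RootedGraph 1 Unit → Prop} (hP : Measurable P) :
    AlmostSurely μ P ↔ ∀ᵐ t ∂μ, P (RootedGraph.rep t) := by
  refine eventually_congr (Eventually.of_forall fun t => ⟨fun h => h _ (RootedGraph.cls_rep t),
    fun h g hg => ?_⟩)
  rwa [RootedGraph.measurable_eq_of_cls_eq hP (hg.trans (RootedGraph.cls_rep t).symm)]

theorem IsErgodic.isRecurrent_or (h : IsErgodic μ) (S : Set ℝ) :
    (AlmostSurely μ fun T => IsRecurrent T.graph S) ∨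
      AlmostSurely μ fun T => ¬ IsRecurrent T.graph S := by
  have hm := RootedGraph.measurable_isRecurrent (k := 1) (X := Unit) S
  have hcls : ∀ g : RootedGraph 1 Unit, IsRecurrent (RootedGraph.rep (cls g)).graph S ↔
      IsRecurrent g.graph S := fun g =>
    iff_of_eq (RootedGraph.measurable_eq_of_cls_eq hm (RootedGraph.cls_rep _))
  rw [almostSurely_iff hm, almostSurely_iff hm.not]
  refine h {t | IsRecurrent (RootedGraph.rep t).graph S} ⟨?_, fun g hg x => ?_⟩
  · exact measurableSet_setOfPred.2 (hm.comp RootedGraph.measurable_rep)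
  · exact (hcls _).2 ((hcls g).1 hg)

/-- Otherwise the zero-one law gives each `c` in `[2, 4]` a ball that is almost surely not
recurrent. Finitely many balls cover the interval, and failure of recurrence passes to unions,
contradicting `isRecurrent_Icc`. -/
theorem IsErgodic.exists_isRecurrent [NeZero μ] (h : IsErgodic μ)
    (htree : AlmostSurely μ fun T => IsOneEndedTree T.graph) :
    ∃ c ∈ Set.Icc (2 : ℝ) 4, ∀ δ > 0,
      AlmostSurely μ fun T => IsRecurrent T.graph (Metric.closedBall c δ) := by
  by_contra! hcon
  have hord : AlmostSurely μ fun T => IsAncestorOrder T.graph.EndLE := by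
    filter_upwards [htree] with t ht g hg using (ht g hg).isAncestorOrder g.locallyFinite
  have key : AlmostSurely μ fun T => ¬ IsRecurrent T.graph (Set.Icc 2 4) := by
    refine isCompact_Icc.induction_on
      (p := fun S => AlmostSurely μ fun T => ¬ IsRecurrent T.graph S) ?_ ?_ ?_ ?_
    · refine Eventually.of_forall fun t g _ hr => ?_
      obtain ⟨x⟩ := g.connected.nonempty
      obtain ⟨v, -, -, n, hn⟩ := hr x 0
      exact hn
    · intro S S' hS hS'
      filter_upwards [hS'] with t ht g hg hr using ht g hg (hr.mono hS)
    · intro S S' hS hS'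
      filter_upwards [hS, hS', hord] with t h1 h2 h3 g hg hr
      exact (hr.of_union (h3 g hg)).elim (h1 g hg) (h2 g hg)
    · intro c hc
      obtain ⟨δ, hδ, hn⟩ := hcon c hc
      exact ⟨_, mem_nhdsWithin_of_mem_nhds (Metric.closedBall_mem_nhds c hδ),
        (h.isRecurrent_or _).resolve_left hn⟩
  have : ∀ᵐ t ∂μ, False := by
    filter_upwards [key, hord] with t h1 h2
    exact h1 _ (RootedGraph.cls_rep t) (h2 _ (RootedGraph.cls_rep t)).isRecurrent_Icc
  exact NeZero.ne μ (ae_eq_bot.1 (eventually_false_iff_eq_bot.1 this))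

end Ergodic

/-! ### From proportions in blocks to probabilities at the root. -/

namespace RootedGraph

variable {μ : Measure (GraphSpace 1 Unit)}

theorem ae_injective_mark_labelledLaw :
    ∀ᵐ g ∂(labelledLaw μ), Function.Injective g.mark := by
  have hm := measurableSet_setOfPred.2 (measurable_injective_mark (k := 1)).not
  show labelledLaw μ {g | ¬ Function.Injective g.mark} = 0
  rw [labelledLaw_apply μ hm]
  refine (lintegral_congr fun t => ?_).trans lintegral_zero
  rw [labelLaw, Measure.map_apply (measurable_label _) hm]
  exact ae_injective_mark _

/-- The event that the root has the property `A` and lies below a top vertex, in terms of what the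
root sees if it is a top vertex itself. -/
theorem measure_and_covered (hμ : IsUnimodular μ)
    (hord : ∀ᵐ g ∂(labelledLaw μ), IsAncestorOrder g.graph.EndLE) (S : Set ℕ)
    {A : ∀ {V : Type}, SimpleGraph V → (V → unitInterval) → V → Prop}
    (hA : Measurable fun g : RootedGraph 1 unitInterval => A g.graph g.mark (g.root 0)) :
    (Measurable fun g : RootedGraph 1 unitInterval => (({x | IsTopVertex g.graph.EndLE S (g.root 0)
        ∧ g.graph.EndLE x (g.root 0) ∧ A g.graph g.mark x}.encard : ℕ∞) : ℝ≥0∞)) ∧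
    labelledLaw μ {g | A g.graph g.mark (g.root 0) ∧
        ∃ v, IsTopVertex g.graph.EndLE S v ∧ g.graph.EndLE (g.root 0) v} =
      ∫⁻ g, (({x | IsTopVertex g.graph.EndLE S (g.root 0) ∧ g.graph.EndLE x (g.root 0) ∧
        A g.graph g.mark x}.encard : ℕ∞) : ℝ≥0∞) ∂(labelledLaw μ) := by
  -- Every vertex with the property `A` sends unit mass to the top vertex above it, which is unique.
  set B : Set (RootedGraph 2 unitInterval) := {g | IsTopVertex g.graph.EndLE S (g.root 1) ∧
    g.graph.EndLE (g.root 0) (g.root 1) ∧ A g.graph g.mark (g.root 0)} with hB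
  have hBm : MeasurableSet B := measurableSet_setOfPred.2 <| (measurable_isTopVertex _ _).and <|
    (measurable_endLE _ _).and (hA.comp (measurable_reroot ![0]))
  set f : RootedGraph 2 unitInterval → ℝ≥0∞ := B.indicator fun _ => 1 with hf
  have hfm : Measurable f := measurable_const.indicator hBm
  have e1 : ∀ g : RootedGraph 1 unitInterval, ∑' y, f (g.decorate ![y, g.root 0] g.mark) =
      (({x | IsTopVertex g.graph.EndLE S (g.root 0) ∧ g.graph.EndLE x (g.root 0) ∧
        A g.graph g.mark x}.encard : ℕ∞) : ℝ≥0∞) := fun g => by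
    rw [← ENNReal.tsum_set_one, tsum_subtype _ (fun _ => (1 : ℝ≥0∞))]
    rfl
  have e2 : ∀ g : RootedGraph 1 unitInterval, ∑' y, f (g.decorate ![g.root 0, y] g.mark) =
      (({y | IsTopVertex g.graph.EndLE S y ∧ g.graph.EndLE (g.root 0) y ∧
        A g.graph g.mark (g.root 0)}.encard : ℕ∞) : ℝ≥0∞) := fun g => by
    rw [← ENNReal.tsum_set_one, tsum_subtype _ (fun _ => (1 : ℝ≥0∞))]
    rfl
  have hm := measurable_tsum_fst hfm
  have key := lintegral_tsum_comm hμ hfm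
  simp_rw [e1] at hm key
  refine ⟨hm, ?_⟩
  have hCm : MeasurableSet {g : RootedGraph 1 unitInterval | A g.graph g.mark (g.root 0) ∧
      ∃ v, IsTopVertex g.graph.EndLE S v ∧ g.graph.EndLE (g.root 0) v} :=
    measurableSet_setOfPred.2 (hA.and (measurable_isCovered S 0))
  rw [← key, ← lintegral_indicator_one hCm]
  refine lintegral_congr_ae ?_
  filter_upwards [hord] with g hg
  rw [e2]
  by_cases hC : g ∈ {g : RootedGraph 1 unitInterval | A g.graph g.mark (g.root 0) ∧
      ∃ v, IsTopVertex g.graph.EndLE S v ∧ g.graph.EndLE (g.root 0) v}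
  · rw [Set.indicator_of_mem hC]
    obtain ⟨hAg, v, hv, hle⟩ := hC
    have : {y | IsTopVertex g.graph.EndLE S y ∧ g.graph.EndLE (g.root 0) y ∧
        A g.graph g.mark (g.root 0)} = {v} := by
      ext y
      exact ⟨fun hy => hg.isTop_unique hy.1 hv hy.2.1 hle, fun e => e ▸ ⟨hv, hle, hAg⟩⟩
    rw [this]
    simp
  · rw [Set.indicator_of_notMem hC]
    have : {y | IsTopVertex g.graph.EndLE S y ∧ g.graph.EndLE (g.root 0) y ∧
        A g.graph g.mark (g.root 0)} = ∅ :=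
      Set.eq_empty_of_forall_notMem fun y hy => hC ⟨hy.2.2, y, hy.1, hy.2.1⟩
    rw [this]
    simp

/-- Proportions in the subtrees of top vertices become probabilities at the root. -/
theorem measure_and_covered_le (hμ : IsUnimodular μ)
    (hord : ∀ᵐ g ∂(labelledLaw μ), IsAncestorOrder g.graph.EndLE) (S : Set ℕ)
    {A B : ∀ {V : Type}, SimpleGraph V → (V → unitInterval) → V → Prop}
    (hA : Measurable fun g : RootedGraph 1 unitInterval => A g.graph g.mark (g.root 0))
    (hB : Measurable fun g : RootedGraph 1 unitInterval => B g.graph g.mark (g.root 0))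
    {ε : ℝ} (hε : 0 ≤ ε)
    (h : ∀ᵐ g ∂(labelledLaw μ), ∀ v, IsTopVertex g.graph.EndLE S v →
      ({x | g.graph.EndLE x v ∧ A g.graph g.mark x}.ncard : ℝ) ≤
        ε * {x | g.graph.EndLE x v ∧ B g.graph g.mark x}.ncard) :
    labelledLaw μ {g | A g.graph g.mark (g.root 0) ∧
        ∃ v, IsTopVertex g.graph.EndLE S v ∧ g.graph.EndLE (g.root 0) v} ≤
      ENNReal.ofReal ε * labelledLaw μ {g | B g.graph g.mark (g.root 0)} := by
  have h1 := measure_and_covered hμ hord S hA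
  have h2 := measure_and_covered hμ hord S hB
  calc _ = _ := h1.2
    _ ≤ ∫⁻ g, ENNReal.ofReal ε * (({x | IsTopVertex g.graph.EndLE S (g.root 0) ∧
        g.graph.EndLE x (g.root 0) ∧ B g.graph g.mark x}.encard : ℕ∞) : ℝ≥0∞)
          ∂(labelledLaw μ) := by
      refine lintegral_mono_ae ?_
      filter_upwards [h, hord] with g hg ho
      by_cases ht : IsTopVertex g.graph.EndLE S (g.root 0)
      · simp only [ht, true_and]
        have hfin : ∀ p : g.V → Prop, {x | g.graph.EndLE x (g.root 0) ∧ p x}.Finite := fun p =>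
          (ho.finite (g.root 0)).subset fun x hx => hx.1
        rw [← (hfin _).cast_ncard_eq, ← (hfin _).cast_ncard_eq]
        have := ENNReal.ofReal_le_ofReal (hg _ ht)
        rw [ENNReal.ofReal_mul hε, ENNReal.ofReal_natCast, ENNReal.ofReal_natCast] at this
        exact_mod_cast this
      · simp [ht]
    _ = _ := lintegral_const_mul _ h2.1
    _ ≤ _ := by
      rw [← h2.2]
      gcongr
      exact And.left

/-- A vertex is eventually in good subtrees, that are not removed. -/
theorem ae_eventually_isGoodAt (hμ : IsUnimodular μ) [IsProbabilityMeasure μ]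
    (hord : ∀ᵐ g ∂(labelledLaw μ), IsAncestorOrder g.graph.EndLE) (P : PruningScheme)
    (hθ : Summable P.θ)
    (hcov : ∑' k, labelledLaw μ {g | ¬ ∃ v, IsTopVertex g.graph.EndLE (P.sizes k) v ∧
      g.graph.EndLE (g.root 0) v} ≠ ∞) :
    ∀ᵐ g ∂(labelledLaw μ), ∀ x, ∀ᶠ k in atTop, IsGoodAt g.graph.EndLE g.mark P k x := by
  have hm : Measurable fun g : RootedGraph 1 unitInterval =>
      ∀ᶠ k in atTop, IsGoodAt g.graph.EndLE g.mark P k (g.root 0) := by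
    simp only [eventually_atTop]
    exact Measurable.exists fun K => Measurable.forall fun k =>
      measurable_const.imp (measurable_isGoodAt P k 0)
  refine ae_forall_vertex hμ
    (P := fun g => ∀ᶠ k in atTop, IsGoodAt g.graph.EndLE g.mark P k (g.root 0))
    (measurableSet_setOfPred.2 hm) ?_
  set u : ℕ → ℝ≥0∞ := fun k => labelledLaw μ {g | ¬ ∃ v, IsTopVertex g.graph.EndLE (P.sizes k) v ∧
      g.graph.EndLE (g.root 0) v} with hu
  -- The root is uncovered at stage `k` or at stage `k + 1`, or it belongs to the proportion `3 * θ
  -- k` of a block of stage `k + 1` bounded by `ncard_not_isGoodAt_le`.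
  have key : ∀ k, labelledLaw μ {g | ¬ IsGoodAt g.graph.EndLE g.mark P k (g.root 0)} ≤
      u k + u (k + 1) + ENNReal.ofReal (3 * P.θ k) := fun k => by
    have h3 : 0 ≤ 3 * P.θ k := by have := P.θ_pos k; positivity
    have h1 := measure_and_covered_le hμ hord (P.sizes (k + 1))
      (A := fun {V} G lab x => (∃ v, IsTopVertex G.EndLE (P.sizes k) v ∧ G.EndLE x v) ∧
        ¬ IsGoodAt G.EndLE lab P k x) (B := fun _ _ _ => True)
      ((measurable_isCovered _ _).and (measurable_isGoodAt P k 0).not) measurable_const h3 (by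
        filter_upwards [hord, ae_injective_mark_labelledLaw] with g ho hl v hv
        simpa [treeSize] using ho.ncard_not_isGoodAt_le hl hv)
    calc _ ≤ labelledLaw μ ({g | ¬ ∃ v, IsTopVertex g.graph.EndLE (P.sizes k) v ∧
            g.graph.EndLE (g.root 0) v} ∪ {g | ¬ ∃ v, IsTopVertex g.graph.EndLE (P.sizes (k + 1)) v ∧
            g.graph.EndLE (g.root 0) v} ∪ _) := measure_mono fun g hg => ?_
      _ ≤ _ := measure_union_le _ _
      _ ≤ _ := by
        gcongr
        · exact measure_union_le _ _
        · refine h1.trans ?_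
          exact (mul_le_mul_right prob_le_one _).trans_eq (mul_one _)
    by_cases hk : ∃ v, IsTopVertex g.graph.EndLE (P.sizes k) v ∧ g.graph.EndLE (g.root 0) v
    · by_cases hk' : ∃ v, IsTopVertex g.graph.EndLE (P.sizes (k + 1)) v ∧
          g.graph.EndLE (g.root 0) v
      · exact Or.inr ⟨⟨hk, hg⟩, hk'⟩
      · exact Or.inl (Or.inr hk')
    · exact Or.inl (Or.inl hk)
  have hsum : ∑' k, labelledLaw μ {g | ¬ IsGoodAt g.graph.EndLE g.mark P k (g.root 0)} ≠ ∞ := by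
    refine ne_top_of_le_ne_top ?_ (ENNReal.tsum_le_tsum key)
    rw [ENNReal.tsum_add, ENNReal.tsum_add]
    refine ENNReal.add_ne_top.2 ⟨ENNReal.add_ne_top.2 ⟨hcov, ?_⟩,
      (hθ.mul_left 3).tsum_ofReal_ne_top⟩
    exact ne_top_of_le_ne_top hcov (ENNReal.tsum_comp_le_tsum_of_injective Nat.succ_injective u)
  filter_upwards [ae_eventually_notMem hsum] with g hg
  filter_upwards [hg] with k hk
  exact not_not.1 hk

theorem ae_eventually_not_isRemovedAt (hμ : IsUnimodular μ) [IsProbabilityMeasure μ]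
    (hord : ∀ᵐ g ∂(labelledLaw μ), IsAncestorOrder g.graph.EndLE) (P : PruningScheme) :
    ∀ᵐ g ∂(labelledLaw μ), ∀ x, ∀ᶠ k in atTop, ¬ IsRemovedAt g.graph.EndLE g.mark P k x := by
  have hm : Measurable fun g : RootedGraph 1 unitInterval =>
      ∀ᶠ k in atTop, ¬ IsRemovedAt g.graph.EndLE g.mark P k (g.root 0) := by
    simp only [eventually_atTop]
    exact Measurable.exists fun K => Measurable.forall fun k =>
      measurable_const.imp (measurable_isRemovedAt P k 0).not
  refine ae_forall_vertex hμ
    (P := fun g => ∀ᶠ k in atTop, ¬ IsRemovedAt g.graph.EndLE g.mark P k (g.root 0))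
    (measurableSet_setOfPred.2 hm) ?_
  set E : ℕ → Set (RootedGraph 1 unitInterval) := fun k =>
    {g | Kept g.graph.EndLE g.mark P (k + 1) (g.root 0) ∧
      ¬ Kept g.graph.EndLE g.mark P (k + 2) (g.root 0)} with hE
  have hEm : ∀ k, Measurable fun g : RootedGraph 1 unitInterval =>
      Kept g.graph.EndLE g.mark P (k + 1) (g.root 0) ∧
      ¬ Kept g.graph.EndLE g.mark P (k + 2) (g.root 0) := fun k =>
    (measurable_kept P _ _).and (measurable_kept P _ _).not
  -- The root is lost at most once, so the measures of the events `E k` have a finite sum.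
  have hdisj : Pairwise (Function.onFun Disjoint E) := by
    rw [pairwise_disjoint_on]
    intro j k hjk
    refine Set.disjoint_left.2 fun g hg hg' => hg.2 (hg'.1.of_le (by omega))
  have key : ∀ k, labelledLaw μ {g | IsRemovedAt g.graph.EndLE g.mark P k (g.root 0)} ≤
      ENNReal.ofReal 8 * labelledLaw μ (E k) := fun k => by
    refine le_trans (measure_mono ?_) (measure_and_covered_le hμ hord (P.sizes k)
      (A := fun {V} G lab x => IsRemovedAt G.EndLE lab P k x)
      (B := fun {V} G lab x => Kept G.EndLE lab P (k + 1) x ∧ ¬ Kept G.EndLE lab P (k + 2) x)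
      (measurable_isRemovedAt P k 0) (hEm k) (by norm_num) (by
        filter_upwards [hord, ae_injective_mark_labelledLaw] with g ho hl v hv
        exact ho.ncard_isRemovedAt_le hl hv))
    rintro g hg
    obtain ⟨v, hv, hle, -⟩ := id hg
    exact ⟨hg, v, hv, hle⟩
  have hsum : ∑' k, labelledLaw μ {g | IsRemovedAt g.graph.EndLE g.mark P k (g.root 0)} ≠ ∞ := by
    refine ne_top_of_le_ne_top ?_ (ENNReal.tsum_le_tsum key)
    rw [ENNReal.tsum_mul_left]
    refine ENNReal.mul_ne_top ENNReal.ofReal_ne_top (ne_top_of_le_ne_top (measure_ne_top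
      (labelledLaw μ) _) (tsum_meas_le_meas_iUnion_of_disjoint _
        (fun k => measurableSet_setOfPred.2 (hEm k)) hdisj))
  filter_upwards [ae_eventually_notMem hsum] with g hg
  filter_upwards [hg] with k hk
  exact hk

end RootedGraph

/-! ### The numerical choices. -/

/-- The exponent `n` for which `s` is close to `c * 2 ^ n`, if there is one. -/
def nearestExpo (c : ℝ) (s : ℕ) : ℕ :=
  Classical.epsilon fun n : ℕ => |(s : ℝ) - c * 2 ^ n| ≤ 1 / 2 * 2 ^ n

/-- The intervals of radius `2 ^ n / 2` around `c * 2 ^ n` are disjoint, since `2 * (c - 1 / 2) > c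
+ 1 / 2` for `c ≥ 2`. -/
theorem nearestExpo_eq {c : ℝ} (hc : 2 ≤ c) {s n : ℕ}
    (h : |(s : ℝ) - c * 2 ^ n| ≤ 1 / 2 * 2 ^ n) : nearestExpo c s = n := by
  have key : ∀ {m n : ℕ}, |(s : ℝ) - c * 2 ^ m| ≤ 1 / 2 * 2 ^ m →
      |(s : ℝ) - c * 2 ^ n| ≤ 1 / 2 * 2 ^ n → ¬ m < n := fun {m n} hm hn hlt => by
    have h1 := (abs_le.1 hm).2
    have h2 := (abs_le.1 hn).1
    have h3 : (2 : ℝ) ^ (m + 1) ≤ 2 ^ n := pow_le_pow_right₀ (by norm_num) hlt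
    rw [pow_succ] at h3
    have h4 : (0 : ℝ) < 2 ^ m := by positivity
    nlinarith
  have h' := Classical.epsilon_spec (p := fun n : ℕ => |(s : ℝ) - c * 2 ^ n| ≤ 1 / 2 * 2 ^ n) ⟨n, h⟩
  exact le_antisymm (not_lt.1 (key h h')) (not_lt.1 (key h' h))

/-- The sizes `s` that are close to some `c * 2 ^ n`. -/
def nearSizes (c δ : ℝ) : Set ℕ :=
  {s | |(s : ℝ) - c * 2 ^ nearestExpo c s| ≤ δ * 2 ^ nearestExpo c s}

theorem mem_nearSizes {c δ : ℝ} (hc : 2 ≤ c) (hδ : δ ≤ 1 / 2) {s n : ℕ}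
    (h : (s : ℝ) / 2 ^ n ∈ Metric.closedBall c δ) : s ∈ nearSizes c δ := by
  have h2 : (0 : ℝ) < 2 ^ n := by positivity
  have h1 : |(s : ℝ) - c * 2 ^ n| ≤ δ * 2 ^ n := by
    rw [Metric.mem_closedBall, Real.dist_eq] at h
    have : (s : ℝ) - c * 2 ^ n = (s / 2 ^ n - c) * 2 ^ n := by field_simp
    rw [this, abs_mul, abs_of_pos h2]
    gcongr
  show |(s : ℝ) - c * 2 ^ nearestExpo c s| ≤ δ * 2 ^ nearestExpo c s
  rwa [nearestExpo_eq hc (n := n) (h1.trans (by gcongr))]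

theorem nearestExpo_lt {c δ ε : ℝ} (hc : 2 ≤ c) (hδ : δ ≤ 1 / 2) (hε : ε ≤ 1 / 2) {s t : ℕ}
    (hs : s ∈ nearSizes c δ) (ht : t ∈ nearSizes c ε) (h0 : 0 < s) (hst : 2 * s ≤ t) :
    nearestExpo c s < nearestExpo c t := by
  have hs : |(s : ℝ) - c * 2 ^ nearestExpo c s| ≤ δ * 2 ^ nearestExpo c s := hs
  have ht : |(t : ℝ) - c * 2 ^ nearestExpo c t| ≤ ε * 2 ^ nearestExpo c t := ht
  by_contra! hcon
  have h1 : (2 : ℝ) ^ nearestExpo c t ≤ 2 ^ nearestExpo c s := pow_le_pow_right₀ (by norm_num) hcon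
  have h2 := (abs_le.1 hs).1
  have h3 := (abs_le.1 ht).2
  have h4 : (2 : ℝ) * s ≤ t := by exact_mod_cast hst
  have h5 : (0 : ℝ) < 2 ^ nearestExpo c t := by positivity
  have h6 : (0 : ℝ) < 2 ^ nearestExpo c s := by positivity
  have h7 : (0 : ℝ) < s := by exact_mod_cast h0
  nlinarith

/-- The excess of the densities `α k` of a pruning scheme over their limit `1 / c`. -/
def densityExcess (c : ℝ) : ℕ → ℝ
  | 0 => 1 - 1 / c
  | k + 1 => (1 / 2) ^ (k + 1) * densityExcess c k / 2

theorem densityExcess_pos {c : ℝ} (hc : 2 ≤ c) (k : ℕ) : 0 < densityExcess c k := by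
  induction k with
  | zero =>
    have : 1 / c ≤ 1 / 2 := by gcongr
    show 0 < 1 - 1 / c
    linarith
  | succ k ih => exact div_pos (mul_pos (by positivity) ih) two_pos

theorem half_pow_succ_le (k : ℕ) : (1 / 2 : ℝ) ^ (k + 1) ≤ 1 / 2 := by
  rw [pow_succ]
  exact mul_le_of_le_one_left (by norm_num) (pow_le_one₀ (by norm_num) (by norm_num))

theorem densityExcess_le {c : ℝ} (hc : 2 ≤ c) (k : ℕ) : densityExcess c k ≤ 1 - 1 / c := by
  induction k with
  | zero => exact le_rfl
  | succ k ih =>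
    have h1 := half_pow_succ_le k
    have h2 := densityExcess_pos hc k
    have h3 : (0 : ℝ) < (1 / 2) ^ (k + 1) := by positivity
    show (1 / 2) ^ (k + 1) * densityExcess c k / 2 ≤ _
    nlinarith

/-- The precision with which sizes approximate `c * 2 ^ n` at stage `k` of a pruning scheme. -/
def sizeTolerance (c : ℝ) (k : ℕ) : ℝ := (1 / 2) ^ (k + 1) * densityExcess c k

theorem sizeTolerance_pos {c : ℝ} (hc : 2 ≤ c) (k : ℕ) : 0 < sizeTolerance c k :=
  mul_pos (by positivity) (densityExcess_pos hc k)

theorem sizeTolerance_le {c : ℝ} (hc : 2 ≤ c) (k : ℕ) :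
    sizeTolerance c k ≤ 1 / 2 * densityExcess c k :=
  mul_le_mul_of_nonneg_right (half_pow_succ_le k) (densityExcess_pos hc k).le

theorem sizeTolerance_le_half {c : ℝ} (hc : 2 ≤ c) (k : ℕ) : sizeTolerance c k ≤ 1 / 2 := by
  have h1 := sizeTolerance_le hc k
  have h2 := densityExcess_le hc k
  have h3 : 0 < 1 / c := by positivity
  linarith

theorem inv_sub_inv_le {c δ : ℝ} (hc : 2 ≤ c) (hδ : 0 ≤ δ) : 1 / c - 1 / (c + δ) ≤ δ / 4 := by
  rw [div_sub_div _ _ (by positivity) (by positivity),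
    div_le_div_iff₀ (by positivity) (by norm_num)]
  have : 4 ≤ c * (c + δ) := by nlinarith
  nlinarith

/-- The pruning scheme for sizes close to `c * 2 ^ n` in the windows from `lo k` to `hi k`. -/
def PruningScheme.ofWindows (c : ℝ) (hc : c ∈ Set.Icc (2 : ℝ) 4) (lo hi : ℕ → ℕ)
    (lo_le_hi : ∀ k, lo k ≤ hi k) (lo_pos : ∀ k, 0 < lo k)
    (hi_le : ∀ k, (hi k : ℝ) ≤ (1 / 2) ^ (k + 1) * lo (k + 1)) : PruningScheme where
  sizes k := {s | s ∈ nearSizes c (sizeTolerance c k) ∧ lo k ≤ s ∧ s ≤ hi k}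
  expo := nearestExpo c
  lo := lo
  hi := hi
  α k := 1 / c + densityExcess c k
  β k := 1 / (c + sizeTolerance c k)
  θ k := (1 / 2) ^ (k + 1)
  lo_le hs := hs.2.1
  le_hi hs := hs.2.2
  lo_le_hi := lo_le_hi
  lo_pos := lo_pos
  hi_le := hi_le
  θ_pos k := by positivity
  θ_lt k := (half_pow_succ_le k).trans_lt (by norm_num)
  le_expo {k s} hs := by
    have h0 : |(s : ℝ) - c * 2 ^ nearestExpo c s| ≤ _ := hs.1
    have h1 := (abs_le.1 h0).2
    have h2 := sizeTolerance_pos hc.1 k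
    have h3 := hc.1
    rw [one_div_mul_eq_div, div_le_iff₀ (by positivity)]
    linarith
  expo_le {k s} hs := by
    have h0 : |(s : ℝ) - c * 2 ^ nearestExpo c s| ≤ _ := hs.1
    have h1 := (abs_le.1 h0).1
    have h2 := sizeTolerance_le hc.1 k
    have h3 := densityExcess_le hc.1 k
    have h4 := densityExcess_pos hc.1 k
    have h5 := sizeTolerance_pos hc.1 k
    have hc' := hc.1
    have hc0 : 0 < c := by linarith
    set n := nearestExpo c s
    set a := densityExcess c k
    set δ := sizeTolerance c k
    have h6 : (0 : ℝ) < 2 ^ n := by positivity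
    have h7 : 0 < 1 / c := by positivity
    -- The gain `a * c ≥ 2 * a` outweighs the loss `(1 / c + a) * δ ≤ a / 2`, because `1 / c + a ≤
    -- 1` and `δ ≤ a / 2`.
    have h8 : 1 ≤ (1 / c + a) * (c - δ) := by
      have e : (1 / c + a) * (c - δ) = 1 + a * c - (1 / c + a) * δ := by
        field_simp
      rw [e]
      nlinarith
    calc (2 : ℝ) ^ n ≤ (1 / c + a) * (c - δ) * 2 ^ n := le_mul_of_one_le_left h6.le h8
      _ = (1 / c + a) * ((c - δ) * 2 ^ n) := by ring
      _ ≤ (1 / c + a) * s := by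
        gcongr
        linarith
  expo_lt {j k s t} hjk hs ht := by
    have hlt : ∀ i, 2 * hi i ≤ lo (i + 1) := fun i => by
      have h1 := hi_le i
      have h2 := half_pow_succ_le i
      have h3 : (0 : ℝ) ≤ lo (i + 1) := by positivity
      have : (2 : ℝ) * hi i ≤ lo (i + 1) := by nlinarith
      exact_mod_cast this
    have hmono : Monotone lo := monotone_nat_of_le_succ fun i => by
      have := lo_le_hi i
      have := hlt i
      omega
    refine nearestExpo_lt hc.1 (sizeTolerance_le_half hc.1 j) (sizeTolerance_le_half hc.1 k)
      hs.1 ht.1 ((lo_pos j).trans_le hs.2.1) ?_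
    have h1 := hmono (Nat.succ_le_of_lt hjk)
    have h2 := hlt j
    have h3 := hs.2.2
    have h4 := ht.2.1
    simp only [Nat.succ_eq_add_one] at h1
    omega
  α_zero := by
    show 1 / c + (1 - 1 / c) ≤ 1
    linarith
  α_succ k := by
    show 1 / c + (1 / 2) ^ (k + 1) * densityExcess c k / 2 ≤ _
    -- With excess `a` and tolerance `θ * a`, the unpruned blocks contribute `θ * a` above `1 / c`,
    -- and the others cost at most `θ * a / 4`. The net gain exceeds the next excess `θ * a / 2`.
    have h1 := inv_sub_inv_le hc.1 (sizeTolerance_pos hc.1 k).le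
    have h2 := sizeTolerance_pos hc.1 k
    have h3 := half_pow_succ_le k
    have h4 : (0 : ℝ) < (1 / 2) ^ (k + 1) := by positivity
    have hc' := hc.1
    have h6 : 1 / (c + sizeTolerance c k) ≤ 1 / c := by gcongr; linarith
    have h5 : sizeTolerance c k = (1 / 2) ^ (k + 1) * densityExcess c k := rfl
    set b := 1 / (c + sizeTolerance c k)
    set θ := (1 / 2 : ℝ) ^ (k + 1)
    nlinarith
  β_le_α k := by
    have h2 := sizeTolerance_pos hc.1 k
    have h3 := densityExcess_pos hc.1 k
    have hc' := hc.1
    have h6 : 1 / (c + sizeTolerance c k) ≤ 1 / c := by gcongr; linarith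
    linarith
  le_β k := by
    have h2 := sizeTolerance_pos hc.1 k
    have h3 := sizeTolerance_le_half hc.1 k
    have hc1 := hc.1
    have hc2 := hc.2
    gcongr
    linarith

/-! ### Choice of the windows, the factor rules, and the conclusion. -/

namespace RootedGraph

variable {μ : Measure (GraphSpace 1 Unit)} [IsProbabilityMeasure μ]

/-- With high probability, the root lies below a top vertex for the sizes in a long window. -/
theorem exists_measure_not_covered_le
    (hord : ∀ᵐ g ∂(labelledLaw μ), IsAncestorOrder g.graph.EndLE) {A : Set ℕ} {N : ℕ}
    (hA : ∀ᵐ g ∂(labelledLaw μ), ∃ v, g.graph.EndLE (g.root 0) v ∧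
      N ≤ treeSize g.graph.EndLE v ∧ treeSize g.graph.EndLE v ∈ A) {ε : ℝ≥0∞} (hε : 0 < ε) :
    ∃ M ≥ N, labelledLaw μ {g | ¬ ∃ v, IsTopVertex g.graph.EndLE {s | s ∈ A ∧ N ≤ s ∧ s ≤ M} v ∧
      g.graph.EndLE (g.root 0) v} ≤ ε := by
  set E : ℕ → Set (RootedGraph 1 unitInterval) := fun M =>
    {g | ¬ ∃ v, (N ≤ treeSize g.graph.EndLE v ∧ treeSize g.graph.EndLE v ∈ A ∧
      treeSize g.graph.EndLE v ≤ M) ∧ g.graph.EndLE (g.root 0) v} with hE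
  have hEm : ∀ M, MeasurableSet (E M) := fun M => measurableSet_setOfPred.2 <| .not <|
    measurable_exists_cons (p := fun g => (N ≤ treeSize g.graph.EndLE (g.root 0) ∧
      treeSize g.graph.EndLE (g.root 0) ∈ A ∧ treeSize g.graph.EndLE (g.root 0) ≤ M) ∧
        g.graph.EndLE (g.root 1) (g.root 0)) <|
    .and ((measurable_from_top (f := fun s => N ≤ s ∧ s ∈ A ∧ s ≤ M)).comp (measurable_treeSize 0))
      (measurable_endLE _ _)
  have hanti : Antitone E := fun M M' hM g hg ⟨v, hv, hle⟩ =>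
    hg ⟨v, ⟨hv.1, hv.2.1, hv.2.2.trans hM⟩, hle⟩
  -- The events that no admissible ancestor has size at most `M` decrease to a null event, so
  -- continuity from above provides `M`.
  have h0 : labelledLaw μ (⋂ M, E M) = 0 := by
    refine measure_mono_null (fun g hg => ?_) (ae_iff.1 hA)
    intro hcon
    obtain ⟨v, hv, hN, hvA⟩ := hcon
    exact Set.mem_iInter.1 hg (treeSize g.graph.EndLE v) ⟨v, ⟨hN, hvA, le_rfl⟩, hv⟩
  have hlim := tendsto_measure_iInter_atTop (μ := labelledLaw μ)
    (fun M => (hEm M).nullMeasurableSet) hanti ⟨0, measure_ne_top _ _⟩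
  rw [h0] at hlim
  obtain ⟨M, hM, hMN⟩ := ((hlim.eventually_lt_const hε).and (eventually_ge_atTop N)).exists
  refine ⟨M, hMN, le_trans (measure_mono_ae ?_) hM.le⟩
  filter_upwards [hord] with g ho hg hcon
  obtain ⟨v, hv, hle⟩ := hcon
  exact hg (ho.exists_isTopVertex ⟨M, fun s hs => hs.2.2⟩ hle ⟨hv.2.1, hv.1, hv.2.2⟩)

theorem exists_pruningScheme (hergodic : IsErgodic μ)
    (htree : AlmostSurely μ fun T => IsOneEndedTree T.graph) :
    ∃ P : PruningScheme, Summable P.θ ∧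
      ∑' k, labelledLaw μ {g | ¬ ∃ v, IsTopVertex g.graph.EndLE (P.sizes k) v ∧
        g.graph.EndLE (g.root 0) v} ≠ ∞ := by
  have hord : ∀ᵐ g ∂(labelledLaw μ), IsAncestorOrder g.graph.EndLE := by
    filter_upwards [ae_of_almostSurely htree] with g hg using
      IsOneEndedTree.isAncestorOrder hg g.locallyFinite
  obtain ⟨c, hc, hrec⟩ := hergodic.exists_isRecurrent htree
  have hnear : ∀ k N, ∀ᵐ g ∂(labelledLaw μ), ∃ v, g.graph.EndLE (g.root 0) v ∧
      N ≤ treeSize g.graph.EndLE v ∧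
        treeSize g.graph.EndLE v ∈ nearSizes c (sizeTolerance c k) := fun k N => by
    filter_upwards [ae_of_almostSurely (hrec _ (sizeTolerance_pos hc.1 k))] with g hg
    obtain ⟨v, h1, h2, n, h3⟩ := hg (g.root 0) N
    exact ⟨v, h1, h2, mem_nearSizes hc.1 (sizeTolerance_le_half hc.1 k) h3⟩
  have hε : ∀ k : ℕ, (0 : ℝ≥0∞) < 2⁻¹ ^ k := fun k => ENNReal.pow_pos (by simp) k
  choose M hMN hM using fun k N => exists_measure_not_covered_le hord (hnear k N) (hε k)
  -- Each window starts `2 ^ (k + 1)` times beyond the end of the previous one, which is what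
  -- `hi_le` asks for with `θ k = (1 / 2) ^ (k + 1)`.
  set lo : ℕ → ℕ := fun k => Nat.rec 1 (fun k N => 2 ^ (k + 1) * (M k N + 1)) k with hlo
  have hlo_succ : ∀ k, lo (k + 1) = 2 ^ (k + 1) * (M k (lo k) + 1) := fun k => rfl
  have hlo_pos : ∀ k, 0 < lo k := fun k => by
    cases k with
    | zero => exact one_pos
    | succ k => rw [hlo_succ]; positivity
  refine ⟨.ofWindows c hc lo (fun k => M k (lo k)) (fun k => hMN k _) hlo_pos fun k => ?_, ?_, ?_⟩
  · rw [hlo_succ]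
    push_cast
    rw [← mul_assoc, ← mul_pow]
    norm_num
  · exact (summable_nat_add_iff 1).2 summable_geometric_two
  · refine ne_top_of_le_ne_top ?_ (ENNReal.tsum_le_tsum fun k => hM k (lo k))
    rw [ENNReal.tsum_geometric, ENNReal.one_sub_inv_two]
    simp

/-- The vertices that survive the pruning are a factor of iid. -/
def survivors (P : PruningScheme) : FiidSet :=
  have h := measurableSet_iff.1 (measurableSet_setOfPred.2 (measurable_survives P (0 : Fin 1)))
  ⟨h.choose, h.choose_spec.1⟩

theorem survivors_eval (P : PruningScheme) (g : RootedGraph 1 Unit) (lab : g.V → unitInterval) :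
    (survivors P).eval g lab = {x | Survives g.graph.EndLE lab P x} :=
  have h := measurableSet_iff.1 (measurableSet_setOfPred.2 (measurable_survives P (0 : Fin 1)))
  Set.ext fun x => Set.ext_iff.1 h.choose_spec.2 (g.decorate ![x] lab)

/-- The partitions into the blocks of the pruning are factors of iid. -/
def blocks (P : PruningScheme) (n : ℕ) : FiidRel :=
  have h := measurableSet_iff.1
    (measurableSet_setOfPred.2 (measurable_sameBlock P n (0 : Fin 2) 1))
  ⟨h.choose, h.choose_spec.1⟩

theorem blocks_eval (P : PruningScheme) (n : ℕ) (g : RootedGraph 1 Unit)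
    (lab : g.V → unitInterval) (x y : g.V) :
    (blocks P n).eval g lab x y ↔ SameBlock g.graph.EndLE lab P n x y :=
  have h := measurableSet_iff.1
    (measurableSet_setOfPred.2 (measurable_sameBlock P n (0 : Fin 2) 1))
  Set.ext_iff.1 h.choose_spec.2 (g.decorate ![x, y] lab)

theorem ae_pruning (hμ : IsUnimodular μ) (P : PruningScheme)
    (htree : AlmostSurely μ fun T => IsOneEndedTree T.graph) (hθ : Summable P.θ)
    (hcov : ∑' k, labelledLaw μ {g | ¬ ∃ v, IsTopVertex g.graph.EndLE (P.sizes k) v ∧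
      g.graph.EndLE (g.root 0) v} ≠ ∞) :
    AlmostSurely μ fun T => ∀ᵐ lab ∂(iidLabels T.V), Function.Injective lab ∧
      (∀ x, ∀ᶠ k in atTop, IsGoodAt T.graph.EndLE lab P k x) ∧
      ∀ x, ∀ᶠ k in atTop, ¬ IsRemovedAt T.graph.EndLE lab P k x := by
  have hord : ∀ᵐ g ∂(labelledLaw μ), IsAncestorOrder g.graph.EndLE := by
    filter_upwards [ae_of_almostSurely htree] with g hg using
      IsOneEndedTree.isAncestorOrder hg g.locallyFinite
  refine almostSurely_of_ae (P := fun g => Function.Injective g.mark ∧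
    (∀ x, ∀ᶠ k in atTop, IsGoodAt g.graph.EndLE g.mark P k x) ∧
      ∀ x, ∀ᶠ k in atTop, ¬ IsRemovedAt g.graph.EndLE g.mark P k x)
    (measurableSet_setOfPred.2 (measurable_injective_mark.and (.and ?_ ?_))) ?_
  · simp only [eventually_atTop]
    exact measurable_forall_cons (p := fun g => ∃ K, ∀ k ≥ K,
      IsGoodAt g.graph.EndLE g.mark P k (g.root 0)) <| Measurable.exists fun K =>
        Measurable.forall fun k => measurable_const.imp (measurable_isGoodAt P k 0)
  · simp only [eventually_atTop]
    exact measurable_forall_cons (p := fun g => ∃ K, ∀ k ≥ K,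
      ¬ IsRemovedAt g.graph.EndLE g.mark P k (g.root 0)) <| Measurable.exists fun K =>
        Measurable.forall fun k => measurable_const.imp (measurable_isRemovedAt P k 0).not
  · filter_upwards [ae_injective_mark_labelledLaw, ae_eventually_isGoodAt hμ hord P hθ hcov,
      ae_eventually_not_isRemovedAt hμ hord P] with g h1 h2 h3 using ⟨h1, h2, h3⟩

end RootedGraph

end

theorem lemma4p1 (d : ℕ) (μ : Measure (GraphSpace 1 Unit)) [IsProbabilityMeasure μ]
    (hunimodular : IsUnimodular μ) (hergodic : IsErgodic μ)
    (htree : AlmostSurely μ fun T => IsOneEndedTree T.graph)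
    (hdeg : AlmostSurely μ fun T => ∀ v, (T.graph.neighborSet v).ncard ≤ d) :
    ∃ (U : FiidSet) (Q : ℕ → FiidRel),
      AlmostSurely μ fun T => ∀ᵐ lab ∂(iidLabels T.V),
        (U.eval T lab).Nonempty ∧
        (T.graph.induce (U.eval T lab)).Connected ∧
        (∀ n, IsPartitionOf ((Q n).eval T lab) (U.eval T lab)) ∧
        (∀ m n, m ≤ n → ∀ x y, (Q m).eval T lab x y → (Q n).eval T lab x y) ∧
        (∀ x ∈ U.eval T lab, ∀ y ∈ U.eval T lab, ∀ᶠ n in atTop, (Q n).eval T lab x y) ∧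
        (∀ x ∈ U.eval T lab, {n : ℕ |
          (T.graph.induce {y | (Q n).eval T lab x y}).Connected ∧
          {y | (Q n).eval T lab x y}.ncard = 2 ^ n}.Infinite) := by
  obtain ⟨P, hθ, hcov⟩ := RootedGraph.exists_pruningScheme hergodic htree
  refine ⟨RootedGraph.survivors P, RootedGraph.blocks P, ?_⟩
  filter_upwards [htree, RootedGraph.ae_pruning hunimodular P htree hθ hcov] with t h1 h2 g hg
  filter_upwards [h2 g hg] with lab ⟨hl, hgood, hrem⟩
  have hQ : ∀ n, (RootedGraph.blocks P n).eval g lab = SameBlock g.graph.EndLE lab P n :=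
    fun n => funext fun x => funext fun y => propext (RootedGraph.blocks_eval P n g lab x y)
  obtain ⟨k1, k2, k3, k4, k5, k6⟩ := (h1 g hg).pruning_conclusion g.locallyFinite hl hgood hrem
  rw [RootedGraph.survivors_eval]
  simp_rw [hQ]
  refine ⟨k1, k2, k3, k4, k5, fun x hx => (k6 x hx).mono fun n hn => ⟨?_, hn.2⟩⟩
  rw [hQ n]
  exact hn.1
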